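/- Let $\mathrm{Spin}(8)\subset \mathrm{C}\ell(8)$ be the spin group of $\mathbb{R}^8=\mathbb{H}\oplus\mathbb{H}$ and let $\Delta_+$ be the space of positive-chirality spinors, i.e. the $+1$-eigenspace of the volume element $e_1e_2\cdots e_8$ (for the standard basis $(1,0),(i,0),(j,0),(k,0),(0,1),(0,i),(0,j),(0,k)$) on the irreducible real 16-dimensional $\mathrm{C}\ell(8)$-module. Let $\mathrm{Sp}(1)$ be the group of unit quaternions. There is an injective homomorphism $\mathrm{Sp}(1)\times\mathrm{Sp}(1)\to\mathrm{Spin}(8)$ which lifts the action $(u_1,u_2)\cdot(x_1,x_2)=(u_1x_1,u_2x_2)$ on $\mathbb{H}\oplus\mathbb{H}$, and, regarding $\mathrm{Sp}(1)\times\mathrm{Sp}(1)$ as a subgroup of $\mathrm{Spin}(8)$ through it, the following holds. Let $\Gamma<\mathrm{Spin}(8)$ be a finite subgroup with $-\mathbf{1}\notin\Gamma$ whose space $\Delta_+^\Gamma$ of invariant positive-chirality spinors has dimension $\mathscr{N}\geq 5$. Then: 1. some conjugate of $\Gamma$ in $\mathrm{Spin}(8)$ is contained in the diagonal subgroup $\mathrm{Sp}(1)\cong\mathrm{Spin}(3)$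 of $\mathrm{Sp}(1)\times\mathrm{Sp}(1)$; 2. for every conjugate $C=g\Gamma g^{-1}$, $g\in\mathrm{Spin}(8)$, that is contained in $\mathrm{Sp}(1)\times\mathrm{Sp}(1)$, the subgroups $A_0=\{a\mid (a,1)\in C\}$ and $B_0=\{b\mid (1,b)\in C\}$ are trivial; 3. $\Gamma$ acts freely on the unit sphere $S^7\subset\mathbb{R}^8$; 4. $S^7/\Gamma$ is smooth: with the quotient topology it is Hausdorff and second countable, and it has the structure of a smooth 7-manifold for which the projection $S^7\to S^7/\Gamma$ is a local diffeomorphism; 5. $\Gamma$ already appears in the classification of smooth quotients by graphs of automorphisms of ADE subgroups: some conjugate of $\Gamma$ in $\mathrm{Spin}(8)$ is equal to the graph $\{(a,a)\mid a\in A\}\subset A\times A$ of the identity automorphism of one of the following ADE subgroups $A$ of $\mathrm{Sp}(1)$: the cyclic group generated by $e^{2\pi i/n}$, $n\geq 1$ (trivial for $n=1$); the binary dihedral group generated by $j$ and $e^{\pi i/n}$, $n\geq 2$; the binary tetrahedral group generated by $\frac{(1+i)(1+j)}{2}$ and $\frac{(1+j)(1+i)}{2}$; the binary octahedral group generated by $\frac{(1+i)(1+j)}{2}$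 and $\frac{1+i}{\sqrt2}$; or the binary icosahedral group generated by $\frac{(1+i)(1+j)}{2}$ and $\frac{\phi+\phi^{-1}i+j}{2}$, where $\phi=\frac{1+\sqrt5}{2}$. -/

import Mathlib

open scoped Quaternion Manifold ContDiff

noncomputable section

namespace SphericalOrbifold

/-- Euclidean `ℝ⁸`, realised as `ℍ ⊕ ℍ` with `‖(x, y)‖² = |x|² + |y|²`. -/
abbrev V8 : Type := WithLp 2 (ℍ[ℝ] × ℍ[ℝ])

/-- The quaternion `a + b i + c j + d k`. -/
def quat (a b c d : ℝ) : ℍ[ℝ] := ⟨a, b, c, d⟩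

/-- The point `(x, y)` of `ℍ ⊕ ℍ`. -/
def pt (x y : ℍ[ℝ]) : V8 := WithLp.toLp 2 (x, y)

/-- The quadratic form `-‖v‖²`, so that `v * v = -‖v‖²` in the Clifford algebra. -/
def Q8 : QuadraticForm ℝ V8 := -(LinearMap.BilinMap.toQuadraticMap (innerₗ V8))

theorem Q8_apply (v : V8) : Q8 v = -‖v‖ ^ 2 := by
  simp [Q8]

theorem V8_norm_sq (v : V8) :
    ‖v‖ ^ 2 = Quaternion.normSq v.fst + Quaternion.normSq v.snd := by
  rw [WithLp.prod_norm_sq_eq_of_L2, Quaternion.normSq_eq_norm_mul_self,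
    Quaternion.normSq_eq_norm_mul_self, sq, sq]

/-- The real Clifford algebra `Cℓ(8)`. -/
abbrev Cl8 : Type := CliffordAlgebra Q8

/-- The group `Spin(8)`, inside `Cℓ(8)`. -/
abbrev Spin8 : Type := spinGroup Q8

/-! ### The spinor module -/

/-- The (Cayley–Dickson) octonion product on `ℍ × ℍ`. -/
def octMul (p q : ℍ[ℝ] × ℍ[ℝ]) : ℍ[ℝ] × ℍ[ℝ] :=
  (p.1 * q.1 - star q.2 * p.2, q.2 * p.1 + p.2 * star q.1)

/-- Octonion conjugation. -/
def octConj (p : ℍ[ℝ] × ℍ[ℝ]) : ℍ[ℝ] × ℍ[ℝ] := (star p.1, -p.2)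

/-- The 16-dimensional real vector space underlying the irreducible `Cℓ(8)`-module. -/
abbrev Spinor : Type := (ℍ[ℝ] × ℍ[ℝ]) × (ℍ[ℝ] × ℍ[ℝ])

theorem octMul_add_left (p p' q : ℍ[ℝ] × ℍ[ℝ]) :
    octMul (p + p') q = octMul p q + octMul p' q := by
  simp only [octMul, Prod.fst_add, Prod.snd_add, Prod.mk_add_mk, add_mul, mul_add]
  congr 1 <;> abel

theorem octMul_add_right (p q q' : ℍ[ℝ] × ℍ[ℝ]) :
    octMul p (q + q') = octMul p q + octMul p q' := by
  simp only [octMul, Prod.fst_add, Prod.snd_add, Prod.mk_add_mk, add_mul, mul_add, star_add]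
  congr 1 <;> abel

theorem octMul_smul_left (c : ℝ) (p q : ℍ[ℝ] × ℍ[ℝ]) :
    octMul (c • p) q = c • octMul p q := by
  simp only [octMul, Prod.smul_fst, Prod.smul_snd, Prod.smul_mk, smul_mul_assoc, mul_smul_comm,
    smul_sub, smul_add]

theorem octMul_smul_right (c : ℝ) (p q : ℍ[ℝ] × ℍ[ℝ]) :
    octMul p (c • q) = c • octMul p q := by
  simp only [octMul, Prod.smul_fst, Prod.smul_snd, Prod.smul_mk, smul_mul_assoc, mul_smul_comm,
    smul_sub, smul_add, Quaternion.star_smul]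

theorem octConj_add (p q : ℍ[ℝ] × ℍ[ℝ]) : octConj (p + q) = octConj p + octConj q := by
  simp only [octConj, Prod.fst_add, Prod.snd_add, Prod.mk_add_mk, star_add, neg_add]

theorem octConj_smul (c : ℝ) (p : ℍ[ℝ] × ℍ[ℝ]) : octConj (c • p) = c • octConj p := by
  simp only [octConj, Prod.smul_fst, Prod.smul_snd, Prod.smul_mk, Quaternion.star_smul, smul_neg]

theorem octMul_octConj_left (p q : ℍ[ℝ] × ℍ[ℝ]) :
    octMul (octConj p) (octMul p q)
      = (Quaternion.normSq p.1 + Quaternion.normSq p.2) • q := by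
  obtain ⟨a, b⟩ := p
  obtain ⟨c, d⟩ := q
  simp only [octMul, octConj, Prod.smul_mk, Quaternion.normSq_def']
  refine Prod.ext ?_ ?_ <;> apply Quaternion.ext <;> simp <;> ring

theorem octMul_octConj_right (p q : ℍ[ℝ] × ℍ[ℝ]) :
    octMul p (octMul (octConj p) q)
      = (Quaternion.normSq p.1 + Quaternion.normSq p.2) • q := by
  obtain ⟨a, b⟩ := p
  obtain ⟨c, d⟩ := q
  simp only [octMul, octConj, Prod.smul_mk, Quaternion.normSq_def']
  refine Prod.ext ?_ ?_ <;> apply Quaternion.ext <;> simp <;> ring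

/-- Clifford multiplication of spinors by vectors: `v · (s, t) = (-v̄ t, v s)`, with octonion
products on the right-hand side. -/
def gamma : V8 →ₗ[ℝ] Module.End ℝ Spinor :=
  LinearMap.mk₂ ℝ
    (fun v s => (-octMul (octConj v.ofLp) s.2, octMul v.ofLp s.1))
    (fun v w s => by
      simp only [WithLp.ofLp_add, octConj_add, octMul_add_left, neg_add, Prod.mk_add_mk])
    (fun c v s => by
      simp only [WithLp.ofLp_smul, octConj_smul, octMul_smul_left, Prod.smul_mk, smul_neg])
    (fun v s t => by
      simp only [Prod.fst_add, Prod.snd_add, octMul_add_right, neg_add, Prod.mk_add_mk])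
    (fun c v s => by
      simp only [Prod.smul_fst, Prod.smul_snd, octMul_smul_right, Prod.smul_mk, smul_neg])

theorem gamma_apply (v : V8) (s : Spinor) :
    gamma v s = (-octMul (octConj v.ofLp) s.2, octMul v.ofLp s.1) := rfl

theorem gamma_sq (v : V8) :
    gamma v * gamma v = algebraMap ℝ (Module.End ℝ Spinor) (Q8 v) := by
  refine LinearMap.ext fun s => ?_
  have h (p q : ℍ[ℝ] × ℍ[ℝ]) : octMul p (-q) = -octMul p q := by
    rw [← neg_one_smul ℝ q, octMul_smul_right, neg_one_smul]
  rw [Module.algebraMap_end_apply, Q8_apply, V8_norm_sq, Module.End.mul_apply, gamma_apply,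
    gamma_apply, h, octMul_octConj_left, octMul_octConj_right]
  exact Prod.ext (neg_smul _ _).symm (neg_smul _ _).symm

/-- The spinor module of `Cℓ(8)`: a real 16-dimensional, hence irreducible, representation. -/
def cliffordRep : Cl8 →ₐ[ℝ] Module.End ℝ Spinor :=
  CliffordAlgebra.lift Q8 ⟨gamma, gamma_sq⟩

/-- The volume element `e₁ e₂ ⋯ e₈` of `Cℓ(8)` for the standard ordered orthonormal basis
`(1,0), (i,0), (j,0), (k,0), (0,1), (0,i), (0,j), (0,k)` of `ℍ ⊕ ℍ`. -/
def volumeElement : Cl8 :=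
  (List.map (fun v => CliffordAlgebra.ι Q8 v)
    [pt (quat 1 0 0 0) 0, pt (quat 0 1 0 0) 0, pt (quat 0 0 1 0) 0, pt (quat 0 0 0 1) 0,
     pt 0 (quat 1 0 0 0), pt 0 (quat 0 1 0 0), pt 0 (quat 0 0 1 0), pt 0 (quat 0 0 0 1)]).prod

/-- The positive-chirality spinors `Δ₊`: the `+1`-eigenspace of the volume element. -/
def positiveSpinors : Submodule ℝ Spinor :=
  Module.End.eigenspace (cliffordRep volumeElement) 1

/-- The space `Δ₊^Γ` of positive-chirality spinors fixed by every element of `Γ`. -/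
def invariantSpinors (Γ : Subgroup Spin8) : Submodule ℝ Spinor :=
  positiveSpinors ⊓ ⨅ γ ∈ Γ, Module.End.eigenspace (cliffordRep (γ : Cl8)) 1

/-! ### The action of `Spin(8)` on `ℝ⁸` and on `S⁷` -/

theorem ι_injective : Function.Injective (CliffordAlgebra.ι Q8) := by
  intro v w h
  have h1 := congrArg (fun x => cliffordRep x ((1, 0), (0, 0))) h
  simp only [cliffordRep, CliffordAlgebra.lift_ι_apply, gamma_apply] at h1
  have h2 : octMul v.ofLp (1, 0) = octMul w.ofLp (1, 0) := congrArg Prod.snd h1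
  simp only [octMul, star_zero, star_one, zero_mul, mul_one, sub_zero, zero_add] at h2
  exact (WithLp.ofLp_injective 2) h2

theorem exists_vector (γ : Spin8) (v : V8) :
    ∃ w : V8, CliffordAlgebra.ι Q8 w
      = (γ : Cl8) * CliffordAlgebra.ι Q8 v * ((γ⁻¹ : Spin8) : Cl8) := by
  have : Invertible (2 : ℝ) := invertibleOfNonzero two_ne_zero
  obtain ⟨w, hw⟩ := spinGroup.conjAct_smul_ι_mem_range_ι (x := spinGroup.toUnits γ) γ.2 v
  exact ⟨w, hw⟩

/-- The vector representation: `rotate γ v` is the vector `γ v γ⁻¹`. -/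
def rotate (γ : Spin8) (v : V8) : V8 := (exists_vector γ v).choose

theorem ι_rotate (γ : Spin8) (v : V8) :
    CliffordAlgebra.ι Q8 (rotate γ v)
      = (γ : Cl8) * CliffordAlgebra.ι Q8 v * ((γ⁻¹ : Spin8) : Cl8) :=
  (exists_vector γ v).choose_spec

theorem rotate_one (v : V8) : rotate 1 v = v := by
  apply ι_injective
  rw [ι_rotate]
  simp

theorem rotate_mul (γ δ : Spin8) (v : V8) : rotate (γ * δ) v = rotate γ (rotate δ v) := by
  apply ι_injective
  rw [ι_rotate, ι_rotate, ι_rotate]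
  simp only [mul_inv_rev, Submonoid.coe_mul, mul_assoc]

theorem norm_rotate (γ : Spin8) (v : V8) : ‖rotate γ v‖ = ‖v‖ := by
  have key : algebraMap ℝ Cl8 (Q8 (rotate γ v)) = algebraMap ℝ Cl8 (Q8 v) := by
    have hγ : ((γ⁻¹ : Spin8) : Cl8) * (γ : Cl8) = 1 := by
      rw [← Submonoid.coe_mul, inv_mul_cancel, Submonoid.coe_one]
    have hγ' : (γ : Cl8) * ((γ⁻¹ : Spin8) : Cl8) = 1 := by
      rw [← Submonoid.coe_mul, mul_inv_cancel, Submonoid.coe_one]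
    rw [← CliffordAlgebra.ι_sq_scalar, ι_rotate]
    calc (γ : Cl8) * CliffordAlgebra.ι Q8 v * ((γ⁻¹ : Spin8) : Cl8)
          * ((γ : Cl8) * CliffordAlgebra.ι Q8 v * ((γ⁻¹ : Spin8) : Cl8))
        = (γ : Cl8) * CliffordAlgebra.ι Q8 v * (((γ⁻¹ : Spin8) : Cl8) * (γ : Cl8))
          * CliffordAlgebra.ι Q8 v * ((γ⁻¹ : Spin8) : Cl8) := by simp only [mul_assoc]
      _ = (γ : Cl8) * (CliffordAlgebra.ι Q8 v * CliffordAlgebra.ι Q8 v)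
          * ((γ⁻¹ : Spin8) : Cl8) := by rw [hγ]; simp only [mul_assoc, one_mul]
      _ = algebraMap ℝ Cl8 (Q8 v) := by
          rw [CliffordAlgebra.ι_sq_scalar, ← Algebra.commutes, mul_assoc, hγ', mul_one]
  have h := congrArg (fun x => cliffordRep x ((1, 0), (0, 0))) key
  simp only [AlgHom.commutes, Module.algebraMap_end_apply] at h
  have h2 : Q8 (rotate γ v) = Q8 v := by
    have := congrArg (fun s : Spinor => s.1.1.re) h
    simpa using this
  rw [Q8_apply, Q8_apply, neg_inj] at h2
  exact (sq_eq_sq₀ (norm_nonneg _) (norm_nonneg _)).1 h2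

/-- The round unit sphere `S⁷ ⊂ ℝ⁸ = ℍ ⊕ ℍ`. -/
abbrev S7 : Type := Metric.sphere (0 : V8) 1

instance : MulAction Spin8 S7 where
  smul γ x := ⟨rotate γ x, by
    rw [mem_sphere_zero_iff_norm, norm_rotate, ← mem_sphere_zero_iff_norm]; exact x.2⟩
  one_smul x := Subtype.ext (rotate_one x)
  mul_smul γ δ x := Subtype.ext (rotate_mul γ δ x)

theorem coe_smul_S7 (γ : Spin8) (x : S7) : ((γ • x : S7) : V8) = rotate γ x := rfl

instance : Fact (Module.finrank ℝ V8 = 7 + 1) :=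
  ⟨by
    rw [(WithLp.linearEquiv 2 ℝ (ℍ[ℝ] × ℍ[ℝ])).finrank_eq, Module.finrank_prod,
      Quaternion.finrank_eq_four]⟩

/-- The orbit space `S⁷/Γ`. -/
abbrev OrbitSpace (Γ : Subgroup Spin8) : Type := MulAction.orbitRel.Quotient Γ S7

/-- `Γ` acts freely on `S⁷`: all stabilisers are trivial. -/
def ActsFreely (Γ : Subgroup Spin8) : Prop :=
  ∀ x : S7, MulAction.stabilizer Γ x = ⊥

/-- `S⁷/Γ` is smooth: the orbit space, with the quotient topology, is a smooth manifold in such a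
way that the projection `S⁷ → S⁷/Γ` is a local diffeomorphism. -/
def IsSmoothQuotient (Γ : Subgroup Spin8) : Prop :=
  T2Space (OrbitSpace Γ) ∧ SecondCountableTopology (OrbitSpace Γ) ∧
    ∃ _ : ChartedSpace (EuclideanSpace ℝ (Fin 7)) (OrbitSpace Γ),
      IsManifold (𝓡 7) ∞ (OrbitSpace Γ) ∧
      IsLocalDiffeomorph (𝓡 7) (𝓡 7) ∞
        (fun x : S7 => (Quotient.mk (MulAction.orbitRel Γ S7) x : OrbitSpace Γ))

/-! ### Unit quaternions, `Sp(1) × Sp(1)` and the ADE subgroups -/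

/-- The group `Sp(1)` of unit quaternions. -/
abbrev Sp1 : Type := unitary ℍ[ℝ]

/-- The unit quaternion `a + b i + c j + d k`. -/
def unitQuaternion (a b c d : ℝ) (h : a ^ 2 + b ^ 2 + c ^ 2 + d ^ 2 = 1) : Sp1 :=
  ⟨quat a b c d, by
    have h' : Quaternion.normSq (quat a b c d) = 1 := (Quaternion.normSq_def' _).trans h
    rw [Unitary.mem_iff, Quaternion.star_mul_self, Quaternion.self_mul_star, h']
    simp⟩

/-- The unit quaternion `e^{iθ}`. -/
def expI (θ : ℝ) : Sp1 :=
  unitQuaternion (Real.cos θ) (Real.sin θ) 0 0 (by simp)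

/-- The quaternion `j`. -/
def quatJ : Sp1 := unitQuaternion 0 0 1 0 (by norm_num)

/-- `(1 + i)(1 + j)/2 = (1 + i + j + k)/2`. -/
def quatZeta : Sp1 := unitQuaternion (1 / 2) (1 / 2) (1 / 2) (1 / 2) (by norm_num)

/-- `(1 + j)(1 + i)/2 = (1 + i + j - k)/2`. -/
def quatZeta' : Sp1 := unitQuaternion (1 / 2) (1 / 2) (1 / 2) (-(1 / 2)) (by norm_num)

/-- `(1 + i)/√2`. -/
def quatXi : Sp1 := unitQuaternion (1 / √2) (1 / √2) 0 0 (by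
  rw [div_pow, Real.sq_sqrt (by norm_num)]; norm_num)

/-- `(φ + φ⁻¹ i + j)/2`, with `φ` the golden ratio. -/
def quatEta : Sp1 := unitQuaternion (Real.goldenRatio / 2) (Real.goldenRatio⁻¹ / 2) (1 / 2) 0 (by
  rw [Real.inv_goldenRatio]
  have h1 := Real.goldenRatio_sq
  have h2 := Real.goldenConj_sq
  have h3 := Real.goldenRatio_add_goldenConj
  linarith)

/-- The ADE subgroups of `Sp(1)`, as explicit subgroups (the trivial group is the cyclic one with
`n = 1`). -/
inductive IsADE : Subgroup Sp1 → Prop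
  | A (n : ℕ) (hn : 1 ≤ n) : IsADE (Subgroup.closure {expI (2 * Real.pi / n)})
  | D (n : ℕ) (hn : 2 ≤ n) : IsADE (Subgroup.closure {quatJ, expI (Real.pi / n)})
  | E6 : IsADE (Subgroup.closure {quatZeta, quatZeta'})
  | E7 : IsADE (Subgroup.closure {quatZeta, quatXi})
  | E8 : IsADE (Subgroup.closure {quatZeta, quatEta})

/-- `(u₁, u₂) · (x₁, x₂) = (u₁ x₁, u₂ x₂)` on `ℍ ⊕ ℍ`. -/
def leftMul (u : Sp1 × Sp1) (v : V8) : V8 :=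
  pt ((u.1 : ℍ[ℝ]) * v.fst) ((u.2 : ℍ[ℝ]) * v.snd)

/-- The homomorphism `j` embeds `Sp(1) × Sp(1)` in `Spin(8)` over its action on `ℍ ⊕ ℍ = ℝ⁸` by
left multiplication. -/
def IsSpinLift (j : Sp1 × Sp1 →* Spin8) : Prop :=
  Function.Injective j ∧ ∀ (u : Sp1 × Sp1) (v : V8), rotate (j u) v = leftMul u v

/-- The graph `{(a, τ a) | a ∈ A}` of an automorphism `τ` of a subgroup `A` of `Sp(1)`. -/
def graph (A : Subgroup Sp1) (τ : A ≃* A) : Subgroup (Sp1 × Sp1) :=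
  (A.subtype.prod (A.subtype.comp τ.toMonoidHom)).range

/-- The diagonal `Sp(1)` (isomorphic to `Spin(3)`) in `Sp(1) × Sp(1)`. -/
def diagonal : Subgroup (Sp1 × Sp1) :=
  ((MonoidHom.id Sp1).prod (MonoidHom.id Sp1)).range

/-- The conjugate subgroup `g Γ g⁻¹`. -/
def conj (g : Spin8) (Γ : Subgroup Spin8) : Subgroup Spin8 :=
  Γ.map (MulAut.conj g).toMonoidHom

end SphericalOrbifold

end

/-!
Write `Δ = 𝕆 ⊕ 𝕆` for the spinor module, with positive spinors `𝕆 ⊕ 0`, where `𝕆 = ℍ ⊕ ℍ`. Then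
`Spin(8)` consists of the triples `(φ, β, δ)` of isometries of `𝕆` with `δ (v s) = φ v · β s`
(triality), acting by `φ` on vectors and by `β` and `δ` on the two kinds of spinors. Every triple
occurs by `exists_spin_of_triality`: `φ` lifts to the pin group as a product of unit vectors
(`hasPinLift`), and by Schur's lemma on `Δ` that lift is `β ⊕ δ` up to a sign. Moreover the spinor
representation is faithful (`spin_eq_of_cliffordRep_eq`), because an even element of the Clifford
algebra that commutes with all vectors is a scalar.

The triple of a pair `(u₁, u₂)` of unit quaternions is `φ = δ = (u₁ ·, u₂ ·)`, `β (p, q) = (p, u₂ q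
u₁⁻¹)`; this gives the homomorphism `spinLift`. Right alternativity shows that the product of two
reflections of the positive spinors is the `β` of a triple, so `Spin(8)` moves any space of positive
spinors of dimension at least five onto one that contains `ℍ ⊕ ℝ` (`exists_spin_standard_mem`). If
an element fixes `ℍ ⊕ ℝ`, then `φ = δ` commutes with right multiplication by `ℍ ⊕ ℝ`, and therefore
is left multiplication by a unit quaternion on both summands (`mem_diagonal_of_fixes_standard`). So
`Γ` is conjugate into the diagonal `Sp(1)`, whose elements `≠ 1` have no fixed point on `S⁷`.
Freeness gives the triviality of the kernels of the two projections of a conjugate of `Γ` in `Sp(1)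
× Sp(1)`, and the smooth structure: the projection `S⁷ → S⁷/Γ` is a covering with smooth deck
transformations, and its local inverses, composed with charts of `S⁷`, serve as charts.

It remains to classify the finite subgroups `G` of `Sp(1)` up to conjugation (`exists_conj_isADE`).
Suppose `-1 ∈ G`, and let `c = Re b` be the largest real part of an element `≠ 1`. If conjugation by
`G` fixes or inverts `b`, then `G` lies in the normaliser of a circle and is cyclic or binary
dihedral. Otherwise, among the pairs `b, b'` of non-commuting elements of real part `c` take one
with `Re (b b'⁻¹)` maximal; comparing it with the pair `b' b b'⁻¹, b` gives `4c² - 2c - 1 ≤ 0`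
(`re_bounds_of_pair`). Then few real parts are possible (`re_mem_of_re_le`), and `Re (b b') + Re (b
b'⁻¹) = 2c²` then leaves only `c = 1/2`, `√2/2`, `φ/2`, with known half-traces of `b`, `b'` and
their product. As a pair of unit quaternions is determined up to conjugation by these half-traces
(`exists_conj_pair`), `G` contains a conjugate of the standard generators of the binary tetrahedral,
octahedral or icosahedral group `S`. Finally `G` is not larger: an element `x` of `G ∖ S` whose real
part is maximal in its coset `x S` could not have norm one, because `Re (x s) ≤ c` for all `s ∈ S`.
If `-1 ∉ G`, then `G` has no imaginary elements, so `G ∪ -G` falls under the cyclic case.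
-/

noncomputable section

namespace SphericalOrbifold

/-! ### Even elements of a Clifford algebra that commute with all vectors -/

section Centre

variable {E : Type*} [NormedAddCommGroup E] [InnerProductSpace ℝ E]

/-- An element of the exterior algebra that is killed by all contractions is a scalar: the operator
`∑ eᵢ ∧ (eᵢ ⌟ ·)`, which multiplies forms of degree `n` by `n`, kills it. -/
theorem exterior_eq_algebraMap_of_contractLeft_eq_zero [FiniteDimensional ℝ E]
    (x : ExteriorAlgebra ℝ E)
    (hx : ∀ d : Module.Dual ℝ E,
      CliffordAlgebra.contractLeft (Q := (0 : QuadraticForm ℝ E)) d x = 0) :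
    ∃ r : ℝ, x = algebraMap ℝ (ExteriorAlgebra ℝ E) r := by
  classical
  let b := Module.finBasis ℝ E
  -- the Euler operator, which multiplies `⋀ⁿ` by `n`
  let N : ExteriorAlgebra ℝ E →ₗ[ℝ] ExteriorAlgebra ℝ E :=
    ∑ i, (LinearMap.mulLeft ℝ (ExteriorAlgebra.ι ℝ (b i))) ∘ₗ
      (CliffordAlgebra.contractLeft (Q := (0 : QuadraticForm ℝ E)) (b.coord i))
  have hN (n : ℕ) (y : ExteriorAlgebra ℝ E) (hy : y ∈ ⋀[ℝ]^n E) : N y = (n : ℝ) • y := by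
    induction hy using Submodule.pow_induction_on_left' with
    | algebraMap r => simp [N, CliffordAlgebra.contractLeft_algebraMap]
    | add x y i hx hy h1 h2 => rw [map_add, h1, h2, smul_add]
    | mem_mul m hm i x hx h =>
      obtain ⟨a, rfl⟩ := hm
      have h0 : ∑ j, ExteriorAlgebra.ι ℝ (b j) * (b.coord j a • x)
          = ExteriorAlgebra.ι ℝ a * x := by
        conv_rhs => rw [← b.sum_repr a]
        rw [map_sum, Finset.sum_mul]
        simp
      have h1 : N (ExteriorAlgebra.ι ℝ a * x)
          = ExteriorAlgebra.ι ℝ a * x + ExteriorAlgebra.ι ℝ a * N x := by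
        simp only [N, LinearMap.sum_apply, LinearMap.comp_apply, LinearMap.mulLeft_apply]
        conv_rhs => lhs; rw [← h0]
        rw [Finset.mul_sum, ← Finset.sum_add_distrib]
        refine Finset.sum_congr rfl fun j _ => ?_
        erw [CliffordAlgebra.contractLeft_ι_mul]
        rw [mul_sub, sub_eq_add_neg, ← mul_assoc, ← mul_assoc, ← neg_mul]
        congr 2
        rw [eq_comm, ← add_eq_zero_iff_eq_neg]
        exact ExteriorAlgebra.ι_add_mul_swap _ _
      rw [h1, h, mul_smul_comm, Nat.cast_succ, add_smul, one_smul, add_comm]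
  have hx0 : N x = 0 := by simp [N, hx]
  have key (n : ℕ) (hn : n ≠ 0) :
      (DirectSum.decompose (fun n => ⋀[ℝ]^n E) x n : ExteriorAlgebra ℝ E) = 0 := by
    have hcomm : (DirectSum.decompose (fun n => ⋀[ℝ]^n E) (N x) n : ExteriorAlgebra ℝ E)
        = (n : ℝ) • (DirectSum.decompose (fun n => ⋀[ℝ]^n E) x n : ExteriorAlgebra ℝ E) := by
      refine DirectSum.Decomposition.inductionOn (fun n => ⋀[ℝ]^n E) ?_ ?_ ?_ x
      · simp
      · intro i m
        rw [hN i m m.2, DirectSum.decompose_smul]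
        by_cases h : i = n
        · subst h
          simp [DirectSum.smul_apply]
        · simp [DirectSum.decompose_coe, DirectSum.smul_apply,
            DirectSum.of_eq_of_ne _ _ _ (Ne.symm h)]
      · intro m m' h1 h2
        rw [map_add, DirectSum.decompose_add, DirectSum.decompose_add]
        simp [h1, h2]
    rw [hx0] at hcomm
    simpa [hn] using hcomm.symm
  have h2 : x = (DirectSum.decompose (fun n => ⋀[ℝ]^n E) x 0 : ExteriorAlgebra ℝ E) := by
    conv_lhs => rw [← DirectSum.sum_support_decompose (fun n => ⋀[ℝ]^n E) x]
    rw [Finset.sum_eq_single 0]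
    · intro i _ hi; exact key i hi
    · intro h; simpa using h
  have h3 := (DirectSum.decompose (fun n => ⋀[ℝ]^n E) x 0).2
  simp only [pow_zero, Submodule.mem_one] at h3
  obtain ⟨r, hr⟩ := h3
  exact ⟨r, by rw [h2, hr]⟩

/-- The graded commutator with a vector is the contraction with its dual form. -/
theorem ι_mul_sub_involute_mul_ι {Q : QuadraticForm ℝ E} (v : E) (x : CliffordAlgebra Q) :
    CliffordAlgebra.ι Q v * x - CliffordAlgebra.involute x * CliffordAlgebra.ι Q v
      = CliffordAlgebra.contractLeft (Q.polarBilin v) x := by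
  induction x using CliffordAlgebra.left_induction with
  | algebraMap r =>
    rw [AlgHom.commutes, ← Algebra.commutes, sub_self, CliffordAlgebra.contractLeft_algebraMap]
  | add x y hx hy => rw [map_add, map_add, ← hx, ← hy]; noncomm_ring
  | ι_mul x m hx =>
    rw [CliffordAlgebra.contractLeft_ι_mul, ← hx, map_mul, CliffordAlgebra.involute_ι,
      QuadraticMap.polarBilin_apply_apply, Algebra.smul_def, ← CliffordAlgebra.ι_mul_ι_add_swap]
    noncomm_ring

/-- An even element of a nondegenerate Clifford algebra that commutes with all vectors is a scalar:
all contractions kill it, and they correspond to those of the exterior algebra. -/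
theorem eq_algebraMap_of_even_of_commute [FiniteDimensional ℝ E] {Q : QuadraticForm ℝ E}
    (hQ : Function.Surjective Q.polarBilin) (x : CliffordAlgebra Q)
    (hx : CliffordAlgebra.involute x = x)
    (hc : ∀ v, CliffordAlgebra.ι Q v * x = x * CliffordAlgebra.ι Q v) :
    ∃ r : ℝ, x = algebraMap ℝ (CliffordAlgebra Q) r := by
  have : Invertible (2 : ℝ) := invertibleOfNonzero two_ne_zero
  obtain ⟨r, hr⟩ := exterior_eq_algebraMap_of_contractLeft_eq_zero
    (CliffordAlgebra.equivExterior Q x) (fun d => by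
      obtain ⟨v, rfl⟩ := hQ d
      have h := ι_mul_sub_involute_mul_ι v x
      rw [hx, hc, sub_self] at h
      erw [CliffordAlgebra.equivExterior, CliffordAlgebra.changeFormEquiv_apply,
        ← CliffordAlgebra.changeForm_contractLeft, ← h, map_zero])
  refine ⟨r, (CliffordAlgebra.equivExterior Q).injective ?_⟩
  rw [hr, CliffordAlgebra.equivExterior, CliffordAlgebra.changeFormEquiv_apply,
    CliffordAlgebra.changeForm_algebraMap]

end Centre

/-! ### The spinor representation -/

@[simp] theorem quat_re (a b c d : ℝ) : (quat a b c d).re = a := rfl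
@[simp] theorem quat_imI (a b c d : ℝ) : (quat a b c d).imI = b := rfl
@[simp] theorem quat_imJ (a b c d : ℝ) : (quat a b c d).imJ = c := rfl
@[simp] theorem quat_imK (a b c d : ℝ) : (quat a b c d).imK = d := rfl

theorem cliffordRep_ι (v : V8) : cliffordRep (CliffordAlgebra.ι Q8 v) = gamma v :=
  CliffordAlgebra.lift_ι_apply _ _ _

theorem quat_mul_quat (a b c d a' b' c' d' : ℝ) :
    quat a b c d * quat a' b' c' d' =
      quat (a * a' - b * b' - c * c' - d * d') (a * b' + b * a' + c * d' - d * c')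
        (a * c' - b * d' + c * a' + d * b') (a * d' + b * c' - c * b' + d * a') := by
  apply Quaternion.ext <;> simp

theorem star_quat (a b c d : ℝ) : star (quat a b c d) = quat a (-b) (-c) (-d) := by
  apply Quaternion.ext <;> simp

theorem neg_quat (a b c d : ℝ) : -quat a b c d = quat (-a) (-b) (-c) (-d) := by
  apply Quaternion.ext <;> simp

theorem quat_neg_one : quat (-1) 0 0 0 = -1 := by
  apply Quaternion.ext <;> simp

theorem gamma_pt_left_mul (a b : ℍ[ℝ]) (s : Spinor) :
    gamma (pt a 0) (gamma (pt b 0) s) =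
      ((-(star a * b * s.1.1), -(s.1.2 * (b * star a))),
        (-(a * star b * s.2.1), -(s.2.2 * (star b * a)))) := by
  simp only [gamma_apply, pt, octMul, octConj]
  refine Prod.ext (Prod.ext ?_ ?_) (Prod.ext ?_ ?_) <;> simp [mul_assoc]

theorem gamma_pt_right_mul (a b : ℍ[ℝ]) (s : Spinor) :
    gamma (pt 0 a) (gamma (pt 0 b) s) =
      ((-(s.1.1 * (star b * a)), -(a * star b * s.1.2)),
        (-(s.2.1 * (star b * a)), -(a * star b * s.2.2))) := by
  simp only [gamma_apply, pt, octMul, octConj]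
  refine Prod.ext (Prod.ext ?_ ?_) (Prod.ext ?_ ?_) <;> simp [mul_assoc]

theorem cliffordRep_volumeElement (s : Spinor) :
    cliffordRep volumeElement s = (s.1, -s.2) := by
  obtain ⟨⟨a, b⟩, ⟨c, d⟩⟩ := s
  have h0 : quat 0 (-1) 0 0 = -quat 0 1 0 0 := by simp [neg_quat]
  have h1 (a : ℍ[ℝ]) : quat 0 1 0 0 * (quat 0 1 0 0 * a) = -a := by
    rw [← mul_assoc, quat_mul_quat]; norm_num [quat_neg_one]
  have h2 (a : ℍ[ℝ]) : a * quat 0 1 0 0 * quat 0 1 0 0 = -a := by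
    rw [mul_assoc, quat_mul_quat]; norm_num [quat_neg_one]
  simp only [volumeElement, List.map_cons, List.map_nil, List.prod_cons, List.prod_nil, map_mul,
    mul_one, cliffordRep_ι, Module.End.mul_apply, gamma_pt_left_mul, gamma_pt_right_mul,
    star_quat, quat_mul_quat]
  norm_num
  simp [h0, h1, h2]

theorem oct_eq_zero_of_eq_neg {p : ℍ[ℝ] × ℍ[ℝ]} (h : p = -p) : p = 0 := by
  have h2 : (2 : ℝ) • p = 0 := by rw [two_smul]; nth_rw 2 [h]; exact add_neg_cancel p
  exact (smul_eq_zero.mp h2).resolve_left two_ne_zero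

theorem mem_positiveSpinors (s : Spinor) : s ∈ positiveSpinors ↔ s.2 = 0 := by
  rw [positiveSpinors, Module.End.mem_eigenspace_iff, cliffordRep_volumeElement, one_smul]
  constructor
  · intro h
    exact oct_eq_zero_of_eq_neg (congrArg Prod.snd h).symm
  · intro h
    ext <;> simp [h]

/-- The squared norm of an octonion. -/
def octNormSq (p : ℍ[ℝ] × ℍ[ℝ]) : ℝ := Quaternion.normSq p.1 + Quaternion.normSq p.2

/-- The squared norm of a spinor. -/
def spinorNormSq (s : Spinor) : ℝ := octNormSq s.1 + octNormSq s.2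

/-- The octonion norm is multiplicative. -/
theorem octNormSq_mul (p q : ℍ[ℝ] × ℍ[ℝ]) : octNormSq (octMul p q) = octNormSq p * octNormSq q := by
  obtain ⟨a, b⟩ := p
  obtain ⟨c, d⟩ := q
  simp only [octNormSq, octMul, Quaternion.normSq_def']
  simp
  ring

theorem octNormSq_conj (p : ℍ[ℝ] × ℍ[ℝ]) : octNormSq (octConj p) = octNormSq p := by
  simp [octNormSq, octConj]

theorem octNormSq_neg (p : ℍ[ℝ] × ℍ[ℝ]) : octNormSq (-p) = octNormSq p := by
  simp [octNormSq]

theorem octNormSq_ofLp (v : V8) : octNormSq v.ofLp = ‖v‖ ^ 2 := (V8_norm_sq v).symm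

theorem octNormSq_eq_zero {p : ℍ[ℝ] × ℍ[ℝ]} : octNormSq p = 0 ↔ p = 0 := by
  rw [octNormSq, add_eq_zero_iff_of_nonneg Quaternion.normSq_nonneg Quaternion.normSq_nonneg,
    Quaternion.normSq_eq_zero, Quaternion.normSq_eq_zero, Prod.ext_iff]
  rfl

theorem spinorNormSq_gamma (v : V8) (s : Spinor) :
    spinorNormSq (gamma v s) = ‖v‖ ^ 2 * spinorNormSq s := by
  rw [gamma_apply, spinorNormSq, spinorNormSq, octNormSq_neg, octNormSq_mul, octNormSq_mul,
    octNormSq_conj, octNormSq_ofLp]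
  ring

theorem spinorNormSq_smul (r : ℝ) (s : Spinor) : spinorNormSq (r • s) = r ^ 2 * spinorNormSq s := by
  simp only [spinorNormSq, octNormSq, Prod.smul_fst, Prod.smul_snd, Quaternion.normSq_smul]
  ring

theorem spinorNormSq_eq_zero {s : Spinor} : spinorNormSq s = 0 ↔ s = 0 := by
  have h (p : ℍ[ℝ] × ℍ[ℝ]) : 0 ≤ octNormSq p :=
    add_nonneg Quaternion.normSq_nonneg Quaternion.normSq_nonneg
  rw [spinorNormSq, add_eq_zero_iff_of_nonneg (h _) (h _), octNormSq_eq_zero, octNormSq_eq_zero,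
    Prod.ext_iff (x := s)]
  rfl

theorem octMul_one_right (p : ℍ[ℝ] × ℍ[ℝ]) : octMul p (1, 0) = p := by
  simp [octMul]

theorem octMul_one_left (p : ℍ[ℝ] × ℍ[ℝ]) : octMul (1, 0) p = p := by
  simp [octMul]

theorem octMul_neg_right (p q : ℍ[ℝ] × ℍ[ℝ]) : octMul p (-q) = -octMul p q := by
  rw [← neg_one_smul ℝ q, octMul_smul_right, neg_one_smul]

theorem octMul_zero_right (p : ℍ[ℝ] × ℍ[ℝ]) : octMul p 0 = 0 := by
  simp [octMul]

theorem gamma_fst (v : V8) (s : ℍ[ℝ] × ℍ[ℝ]) : gamma v (s, 0) = (0, octMul v.ofLp s) := by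
  rw [gamma_apply, octMul_zero_right, neg_zero]

theorem gamma_snd (v : V8) (t : ℍ[ℝ] × ℍ[ℝ]) :
    gamma v (0, t) = (-octMul (octConj v.ofLp) t, 0) := by
  rw [gamma_apply, octMul_zero_right]

/-- The nucleus of the octonions is the real line. -/
theorem eq_smul_one_of_assoc (c : ℍ[ℝ] × ℍ[ℝ])
    (h : ∀ v s, octMul (octMul v s) c = octMul v (octMul s c)) :
    ∃ r : ℝ, c = r • (1, 0) := by
  have h1 := h (quat 0 1 0 0, 0) (quat 0 0 1 0, 0)
  have h2 := h (quat 0 1 0 0, 0) (0, 1)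
  have h3 := h (quat 0 0 1 0, 0) (0, 1)
  simp [octMul, Prod.ext_iff, Quaternion.ext_iff] at h1 h2 h3
  refine ⟨c.1.re, ?_⟩
  simp only [Prod.ext_iff, Quaternion.ext_iff, Prod.smul_fst, Prod.smul_snd, Quaternion.re_smul,
    Quaternion.imI_smul, Quaternion.imJ_smul, Quaternion.imK_smul]
  simp
  grind

/-- Schur's lemma for the spinor module. An endomorphism that commutes with Clifford multiplication
is right multiplication by an octonion `c` on both chiralities, and `c` lies in the nucleus. -/
theorem eq_smul_one_of_commute (M : Module.End ℝ Spinor) (h : ∀ v, M * gamma v = gamma v * M) :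
    ∃ r : ℝ, M = r • 1 := by
  have hω : M * cliffordRep volumeElement = cliffordRep volumeElement * M := by
    simp only [volumeElement, map_list_prod, List.map_map]
    refine (Commute.list_prod_right _ _ fun x hx => ?_).eq
    obtain ⟨v, -, rfl⟩ := List.mem_map.mp hx
    rw [Function.comp_apply, cliffordRep_ι]
    exact h v
  have hω' (s : Spinor) := congrArg (fun f : Module.End ℝ Spinor => f s) hω
  simp only [Module.End.mul_apply, cliffordRep_volumeElement] at hω'
  have h' (v : V8) (s : Spinor) : M (gamma v s) = gamma v (M s) :=
    congrArg (fun f : Module.End ℝ Spinor => f s) (h v)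
  have h1 (s) : M (s, 0) = ((M (s, 0)).1, 0) := by
    have := hω' (s, 0)
    rw [neg_zero, Prod.ext_iff] at this
    exact Prod.ext rfl (oct_eq_zero_of_eq_neg this.2)
  set c := (M ((1, 0), 0)).1 with hc
  have hv (v) : M (0, v) = (0, octMul v c) := by
    have := h' (WithLp.toLp 2 v) ((1, 0), 0)
    rw [h1, gamma_fst, gamma_fst] at this
    simpa [octMul_one_right] using this
  have hs (s) : M (s, 0) = (octMul s c, 0) := by
    have := h' (WithLp.toLp 2 (1, 0)) (0, -s)
    rw [hv, gamma_snd, gamma_snd] at this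
    have e : octConj (1, 0) = (1, 0) := by simp [octConj]
    have e2 : octMul (-s) c = -octMul s c := by
      rw [← neg_one_smul ℝ s, octMul_smul_left, neg_one_smul]
    simpa [octMul_one_left, e, e2] using this
  obtain ⟨r, hr⟩ := eq_smul_one_of_assoc c (fun v s => by
    have := h' (WithLp.toLp 2 v) (s, 0)
    rw [hs, gamma_fst, gamma_fst, hv] at this
    exact congrArg Prod.snd this)
  refine ⟨r, LinearMap.ext fun s => ?_⟩
  have e : s = (s.1, 0) + (0, s.2) := by simp
  rw [e, map_add, hs, hv, hr, octMul_smul_right, octMul_smul_right, octMul_one_right,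
    octMul_one_right]
  exact Prod.ext (by simp) (by simp)

theorem volume_mul_gamma (v : V8) :
    cliffordRep volumeElement * gamma v = -(gamma v * cliffordRep volumeElement) := by
  refine LinearMap.ext fun s => ?_
  simp only [Module.End.mul_apply, LinearMap.neg_apply, cliffordRep_volumeElement, gamma_apply,
    octMul_neg_right]
  simp

theorem volume_mul_volume :
    cliffordRep volumeElement * cliffordRep volumeElement = 1 := by
  refine LinearMap.ext fun s => ?_
  simp [Module.End.mul_apply, cliffordRep_volumeElement]

theorem eq_smul_volume_of_anticommute (M : Module.End ℝ Spinor)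
    (h : ∀ v, M * gamma v = -(gamma v * M)) : ∃ r : ℝ, M = r • cliffordRep volumeElement := by
  obtain ⟨r, hr⟩ := eq_smul_one_of_commute (M * cliffordRep volumeElement) (fun v => by
    have e : M * (-(gamma v * cliffordRep volumeElement))
        = -(M * gamma v) * cliffordRep volumeElement := by
      refine LinearMap.ext fun s => ?_
      simp [Module.End.mul_apply]
    rw [mul_assoc, volume_mul_gamma, e, h, neg_neg, mul_assoc])
  exact ⟨r, by rw [← mul_one M, ← volume_mul_volume, ← mul_assoc, hr, smul_mul_assoc, one_mul]⟩

theorem Q8_polarBilin (v w : V8) : Q8.polarBilin v w = -2 * inner ℝ v w := by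
  rw [QuadraticMap.polarBilin_apply_apply, QuadraticMap.polar, Q8_apply, Q8_apply, Q8_apply,
    norm_add_sq_real]
  ring

theorem Q8_polarBilin_surjective : Function.Surjective Q8.polarBilin := by
  have : FiniteDimensional ℝ V8 := inferInstance
  intro d
  refine ⟨(-(1 / 2 : ℝ)) • (InnerProductSpace.toDual ℝ V8).symm (LinearMap.toContinuousLinearMap d),
    LinearMap.ext fun w => ?_⟩
  rw [Q8_polarBilin, inner_smul_left, InnerProductSpace.toDual_symm_apply]
  simp

/-- The representation of `Spin(8)` on all spinors is faithful: an element of the kernel commutes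
with all vectors, so it is a scalar. -/
theorem spin_eq_of_cliffordRep_eq {γ δ : Spin8} (h : cliffordRep γ = cliffordRep δ) : γ = δ := by
  have hinv : ((δ⁻¹ : Spin8) : Cl8) * (δ : Cl8) = 1 := by
    rw [← Submonoid.coe_mul, inv_mul_cancel, Submonoid.coe_one]
  set x : Spin8 := δ⁻¹ * γ with hx
  have hrep : cliffordRep (x : Cl8) = 1 := by
    rw [hx, Submonoid.coe_mul, map_mul, h, ← map_mul, hinv, map_one]
  have hxinv : ((x⁻¹ : Spin8) : Cl8) * (x : Cl8) = 1 := by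
    rw [← Submonoid.coe_mul, inv_mul_cancel, Submonoid.coe_one]
  have hrepinv : cliffordRep ((x⁻¹ : Spin8) : Cl8) = 1 := by
    have := congrArg cliffordRep hxinv
    rwa [map_mul, hrep, mul_one, map_one] at this
  have hgamma : Function.Injective gamma := fun v w hvw => by
    have := congrArg (fun f : Module.End ℝ Spinor => (f ((1, 0), 0)).2) hvw
    simp only [gamma_apply, octMul_one_right] at this
    exact WithLp.ofLp_injective 2 this
  have hrot (v : V8) : rotate x v = v := by
    apply hgamma
    rw [← cliffordRep_ι, ι_rotate, map_mul, map_mul, hrep, hrepinv, cliffordRep_ι, one_mul, mul_one]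
  obtain ⟨r, hr⟩ := eq_algebraMap_of_even_of_commute Q8_polarBilin_surjective (x : Cl8)
    (spinGroup.involute_eq x.2) (fun v => by
      conv_lhs => rw [← hrot v, ι_rotate, mul_assoc, hxinv, mul_one])
  have hr1 : r = 1 := by
    rw [hr, AlgHom.commutes] at hrep
    have := congrArg (fun f : Module.End ℝ Spinor => (f ((1, 0), 0)).1.1.re) hrep
    simpa [Module.algebraMap_end_apply] using this
  have hx1 : x = 1 := Subtype.ext (by rw [hr, hr1, map_one]; rfl)
  rw [hx] at hx1
  exact (inv_mul_eq_one.mp hx1).symm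

/-! ### Lifting isometries to the spin group -/

theorem ι_mul_ι_add_swap_V8 (v w : V8) :
    CliffordAlgebra.ι Q8 v * CliffordAlgebra.ι Q8 w
        + CliffordAlgebra.ι Q8 w * CliffordAlgebra.ι Q8 v
      = algebraMap ℝ Cl8 (-2 * inner ℝ v w) := by
  rw [CliffordAlgebra.ι_mul_ι_add_swap, ← Q8_polarBilin, QuadraticMap.polarBilin_apply_apply]

theorem ι_sq_of_norm_one {v : V8} (hv : ‖v‖ = 1) :
    CliffordAlgebra.ι Q8 v * CliffordAlgebra.ι Q8 v = -1 := by
  rw [CliffordAlgebra.ι_sq_scalar, Q8_apply, hv]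
  simp

theorem ι_mem_pinGroup {v : V8} (hv : ‖v‖ = 1) : CliffordAlgebra.ι Q8 v ∈ pinGroup Q8 := by
  have h1 := ι_sq_of_norm_one hv
  let u : Cl8ˣ := ⟨CliffordAlgebra.ι Q8 v, -CliffordAlgebra.ι Q8 v,
    by rw [mul_neg, h1, neg_neg], by rw [neg_mul, h1, neg_neg]⟩
  have hstar : star (CliffordAlgebra.ι Q8 v) = -CliffordAlgebra.ι Q8 v := by
    rw [CliffordAlgebra.star_def, CliffordAlgebra.involute_ι, map_neg, CliffordAlgebra.reverse_ι]
  refine pinGroup.mem_iff.mpr ⟨⟨u, Subgroup.subset_closure ⟨v, rfl⟩, rfl⟩, ?_⟩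
  rw [Unitary.mem_iff, hstar, mul_neg, neg_mul, h1, neg_neg]
  exact ⟨rfl, rfl⟩

theorem norm_pt_sq (x y : ℍ[ℝ]) : ‖pt x y‖ ^ 2 = Quaternion.normSq x + Quaternion.normSq y :=
  V8_norm_sq _

theorem neg_mem_pinGroup {x : Cl8} (hx : x ∈ pinGroup Q8) : -x ∈ pinGroup Q8 := by
  have h : ‖pt 1 0‖ = 1 := by
    have := norm_pt_sq 1 0
    rw [map_one, map_zero, add_zero] at this
    exact (pow_eq_one_iff_of_nonneg (norm_nonneg _) two_ne_zero).mp this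
  have h1 := mul_mem (mul_mem (ι_mem_pinGroup h) (ι_mem_pinGroup h)) hx
  rwa [ι_sq_of_norm_one h, neg_one_mul] at h1

/-- A unit vector `v` acts on vectors by `w ↦ v w v⁻¹`, minus the reflection in `v^⊥`. -/
theorem ι_mul_ι_eq_neg_reflection {v : V8} (hv : ‖v‖ = 1) (w : V8) :
    CliffordAlgebra.ι Q8 v * CliffordAlgebra.ι Q8 w
      = -(CliffordAlgebra.ι Q8 ((ℝ ∙ v)ᗮ.reflection w) * CliffordAlgebra.ι Q8 v) := by
  rw [Submodule.reflection_orthogonal_apply, Submodule.reflection_singleton_apply, hv]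
  have h := ι_mul_ι_add_swap_V8 v w
  have h1 := ι_sq_of_norm_one hv
  simp only [neg_sub, map_sub, map_nsmul, map_smul, sub_mul, smul_mul_assoc, h1]
  rw [eq_sub_of_add_eq h, Algebra.algebraMap_eq_smul_one]
  simp only [smul_neg, RCLike.ofReal_real_eq_id, id, one_pow, div_one]
  module

theorem cliffordRep_ι_mul_volume (v : V8) :
    cliffordRep (CliffordAlgebra.ι Q8 v) * cliffordRep volumeElement
      = -(cliffordRep volumeElement * cliffordRep (CliffordAlgebra.ι Q8 v)) := by
  rw [cliffordRep_ι, volume_mul_gamma, neg_neg]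

/-- The theorem of Cartan and Dieudonné, with reflections in the hyperplanes orthogonal to unit
vectors. -/
theorem exists_list_reflection {E : Type*} [NormedAddCommGroup E] [InnerProductSpace ℝ E]
    [FiniteDimensional ℝ E] (φ : E ≃ₗᵢ[ℝ] E) :
    ∃ l : List E, (∀ v ∈ l, ‖v‖ = 1) ∧ φ = (l.map fun v => (ℝ ∙ v)ᗮ.reflection).prod := by
  obtain ⟨l, -, rfl⟩ := φ.reflections_generate_dim
  induction l with
  | nil => exact ⟨[], by simp, rfl⟩
  | cons u l ih =>
    obtain ⟨l', hl', h⟩ := ih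
    rw [List.map_cons, List.prod_cons, h]
    by_cases hu : u = 0
    · subst hu
      have h0 : (ℝ ∙ (0 : E))ᗮ.reflection = 1 := by
        ext v : 1
        apply Submodule.reflection_mem_subspace_eq_self
        simp
      rw [h0, one_mul]
      exact ⟨l', hl', rfl⟩
    · have hspan : (ℝ ∙ u) = (ℝ ∙ (‖u‖⁻¹ • u)) := by
        rw [Submodule.span_singleton_smul_eq]
        exact (inv_ne_zero (norm_ne_zero_iff.mpr hu)).isUnit
      refine ⟨(‖u‖⁻¹ • u) :: l', ?_, ?_⟩
      · rintro v (_ | ⟨_, hv⟩)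
        exacts [norm_smul_inv_norm hu, hl' v hv]
      · simp only [hspan, List.map_cons, List.prod_cons]

/-- A lift of `φ` to the pin group: a product of unit vectors inducing `±φ` on `ℝ⁸`, with the sign
given by its parity. The action on spinors is isometric and preserves or exchanges the two
chiralities, according to the parity. -/
def HasPinLift (φ : V8 ≃ₗᵢ[ℝ] V8) : Prop :=
  ∃ x ∈ pinGroup Q8, (∀ s, spinorNormSq (cliffordRep x s) = spinorNormSq s) ∧
    ((x ∈ CliffordAlgebra.evenOdd Q8 0 ∧
        cliffordRep x * cliffordRep volumeElement = cliffordRep volumeElement * cliffordRep x ∧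
        (∀ v, CliffordAlgebra.ι Q8 (φ v) * x = x * CliffordAlgebra.ι Q8 v)) ∨
      (x ∈ CliffordAlgebra.evenOdd Q8 1 ∧
        cliffordRep x * cliffordRep volumeElement = -(cliffordRep volumeElement * cliffordRep x) ∧
        (∀ v, CliffordAlgebra.ι Q8 (φ v) * x = -(x * CliffordAlgebra.ι Q8 v))))

theorem end_neg_mul (f g : Module.End ℝ Spinor) : -f * g = -(f * g) := rfl

theorem HasPinLift.reflection_mul {φ : V8 ≃ₗᵢ[ℝ] V8} (h : HasPinLift φ) {w : V8} (hw : ‖w‖ = 1) :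
    HasPinLift ((ℝ ∙ w)ᗮ.reflection * φ) := by
  obtain ⟨x, hx, hn, hpar⟩ := h
  have hι := CliffordAlgebra.ι_mem_evenOdd_one Q8 w
  have key (v : V8) : CliffordAlgebra.ι Q8 (((ℝ ∙ w)ᗮ.reflection * φ) v)
      * (CliffordAlgebra.ι Q8 w * x)
      = -(CliffordAlgebra.ι Q8 w * (CliffordAlgebra.ι Q8 (φ v) * x)) := by
    rw [← mul_assoc, ← mul_assoc, ι_mul_ι_eq_neg_reflection hw, neg_mul, neg_neg]
    rfl
  refine ⟨CliffordAlgebra.ι Q8 w * x, mul_mem (ι_mem_pinGroup hw) hx, fun s => ?_, ?_⟩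
  · rw [map_mul, Module.End.mul_apply, cliffordRep_ι, spinorNormSq_gamma, hw, hn]
    ring
  · rcases hpar with ⟨he, hω, hc⟩ | ⟨ho, hω, hc⟩
    · refine Or.inr ⟨?_, ?_, fun v => ?_⟩
      · exact CliffordAlgebra.evenOdd_mul_le Q8 1 0 (Submodule.mul_mem_mul hι he)
      · rw [map_mul, mul_assoc, hω, ← mul_assoc, cliffordRep_ι_mul_volume,
          end_neg_mul, mul_assoc]
      · rw [key, hc, mul_assoc]
    · refine Or.inl ⟨?_, ?_, fun v => ?_⟩
      · exact CliffordAlgebra.evenOdd_mul_le Q8 1 1 (Submodule.mul_mem_mul hι ho)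
      · have e : cliffordRep (CliffordAlgebra.ι Q8 w) * -(cliffordRep volumeElement * cliffordRep x)
            = -(cliffordRep (CliffordAlgebra.ι Q8 w) * cliffordRep volumeElement)
              * cliffordRep x := by
          refine LinearMap.ext fun s => ?_
          simp [Module.End.mul_apply]
        rw [map_mul, mul_assoc, hω, e, cliffordRep_ι_mul_volume, neg_neg, mul_assoc]
      · rw [key, hc, mul_neg, neg_neg, mul_assoc]

/-- Every orthogonal transformation of `ℝ⁸` lifts to the pin group. -/
theorem hasPinLift (φ : V8 ≃ₗᵢ[ℝ] V8) : HasPinLift φ := by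
  obtain ⟨l, hl, rfl⟩ := exists_list_reflection φ
  induction l with
  | nil =>
    exact ⟨1, one_mem _, by simp, Or.inl ⟨SetLike.GradedOne.one_mem, by simp, by simp⟩⟩
  | cons u l ih =>
    rw [List.map_cons, List.prod_cons]
    exact (ih fun v hv => hl v (List.mem_cons_of_mem _ hv)).reflection_mul (hl u List.mem_cons_self)

/-- An isometry `T` of the spinor module which preserves chirality and intertwines Clifford
multiplication along an orthogonal transformation of `ℝ⁸` is the action of an element of
`Spin(8)`. -/
theorem exists_spin_of_intertwiner (φ : V8 ≃ₗᵢ[ℝ] V8) (T : Module.End ℝ Spinor)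
    (hn : ∀ s, spinorNormSq (T s) = spinorNormSq s)
    (hω : T * cliffordRep volumeElement = cliffordRep volumeElement * T)
    (hT : ∀ v, T * gamma v = gamma (φ v) * T) : ∃ γ : Spin8, cliffordRep γ = T := by
  obtain ⟨x, hx, hxn, hpar⟩ := hasPinLift φ
  have hxs (s) : cliffordRep x (cliffordRep (star x) s) = s := by
    rw [← Module.End.mul_apply, ← map_mul, pinGroup.mul_star_self_of_mem hx, map_one,
      Module.End.one_apply]
  have hsx (s) : cliffordRep (star x) (cliffordRep x s) = s := by
    rw [← Module.End.mul_apply, ← map_mul, pinGroup.star_mul_self_of_mem hx, map_one,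
      Module.End.one_apply]
  have hT' (v s) : T (gamma v s) = gamma (φ v) (T s) :=
    congrArg (fun f : Module.End ℝ Spinor => f s) (hT v)
  have hnz : spinorNormSq ((1, 0), 0) = 1 := by simp [spinorNormSq, octNormSq]
  rcases hpar with ⟨he, -, hc⟩ | ⟨-, hωx, hc⟩
  · -- for an even lift, `x⁻¹ T` is a scalar, and it is `±1` because `T` is isometric
    have hc' (v s) : gamma (φ v) (cliffordRep x s) = cliffordRep x (gamma v s) := by
      rw [← cliffordRep_ι, ← cliffordRep_ι, ← Module.End.mul_apply, ← map_mul, hc, map_mul,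
        Module.End.mul_apply]
    obtain ⟨r, hr⟩ := eq_smul_one_of_commute (cliffordRep (star x) * T) (fun v => by
      refine LinearMap.ext fun s => ?_
      rw [Module.End.mul_apply, Module.End.mul_apply, Module.End.mul_apply, Module.End.mul_apply,
        hT', ← hsx (gamma v _), ← hc', hxs])
    have hTx (s) : T s = r • cliffordRep x s := by
      have := congrArg (fun f : Module.End ℝ Spinor => cliffordRep x (f s)) hr
      simpa [Module.End.mul_apply, hxs] using this
    have hr2 : r ^ 2 = 1 := by
      have := hn ((1, 0), 0)
      rwa [hTx, spinorNormSq_smul, hxn, hnz, mul_one] at this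
    rcases (sq_eq_sq_iff_eq_or_eq_neg.mp (hr2.trans (one_pow 2).symm)) with rfl | rfl
    · exact ⟨⟨x, spinGroup.mem_iff.mpr ⟨hx, he⟩⟩, LinearMap.ext fun s => by rw [hTx, one_smul]⟩
    · refine ⟨⟨-x, spinGroup.mem_iff.mpr ⟨neg_mem_pinGroup hx, neg_mem he⟩⟩,
        LinearMap.ext fun s => ?_⟩
      rw [hTx, map_neg, LinearMap.neg_apply, neg_one_smul]
  · -- for an odd lift, `x⁻¹ T` would be a multiple of the volume element, so `T` would exchange the
    -- chiralities
    exfalso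
    have hc' (v s) : gamma (φ v) (cliffordRep x s) = -cliffordRep x (gamma v s) := by
      rw [← cliffordRep_ι, ← cliffordRep_ι, ← Module.End.mul_apply, ← map_mul, hc, map_neg, map_mul,
        LinearMap.neg_apply, Module.End.mul_apply]
    obtain ⟨r, hr⟩ := eq_smul_volume_of_anticommute (cliffordRep (star x) * T) (fun v => by
      refine LinearMap.ext fun s => ?_
      rw [LinearMap.neg_apply, Module.End.mul_apply, Module.End.mul_apply, Module.End.mul_apply,
        Module.End.mul_apply, hT', ← hsx (gamma v _), ← map_neg, ← hc', hxs])
    have hTx (s) : T s = r • cliffordRep x (cliffordRep volumeElement s) := by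
      have := congrArg (fun f : Module.End ℝ Spinor => cliffordRep x (f s)) hr
      simpa [Module.End.mul_apply, hxs] using this
    have h1 := congrArg (fun f : Module.End ℝ Spinor => f ((1, 0), 0)) hω
    have h2 := congrArg (fun f : Module.End ℝ Spinor => f ((1, 0), 0)) hωx
    have h3 := hn ((1, 0), 0)
    simp only [Module.End.mul_apply, LinearMap.neg_apply, cliffordRep_volumeElement, hTx, neg_zero]
      at h1 h2 h3
    set y := cliffordRep x ((1, 0), 0)
    have hy1 : r • y.2 = 0 := oct_eq_zero_of_eq_neg (congrArg Prod.snd h1)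
    have hy2 : y.1 = 0 := oct_eq_zero_of_eq_neg (congrArg Prod.fst h2)
    have hy : r • y = 0 := Prod.ext (by simp [hy2]) hy1
    rw [hy, hnz, spinorNormSq_eq_zero.mpr rfl] at h3
    exact zero_ne_one h3

/-! ### Triality triples -/

/-- A triple `(φ, β, δ)` of isometries with `δ (v s) = φ v · β s` for the octonion product is
realised by an element of `Spin(8)`. -/
theorem exists_spin_of_triality (φ : V8 ≃ₗᵢ[ℝ] V8)
    (β δ : (ℍ[ℝ] × ℍ[ℝ]) →ₗ[ℝ] (ℍ[ℝ] × ℍ[ℝ]))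
    (hβ : ∀ s, octNormSq (β s) = octNormSq s) (hδ : ∀ t, octNormSq (δ t) = octNormSq t)
    (h : ∀ v s, δ (octMul v.ofLp s) = octMul (φ v).ofLp (β s)) :
    ∃ γ : Spin8, ∀ s, cliffordRep γ s = (β s.1, δ s.2) := by
  have hnorm (v : V8) : octNormSq (φ v).ofLp = octNormSq v.ofLp := by
    rw [octNormSq_ofLp, octNormSq_ofLp, φ.norm_map]
  -- the norm identities turn the relation for `v s` into the one for `v̄ t`
  have hconj (v : V8) (t) : β (octMul (octConj v.ofLp) t) = octMul (octConj (φ v).ofLp) (δ t) := by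
    by_cases hv : octNormSq v.ofLp = 0
    · have h0 : v.ofLp = 0 := octNormSq_eq_zero.mp hv
      have h1 : (φ v).ofLp = 0 := octNormSq_eq_zero.mp ((hnorm v).trans hv)
      rw [h0, h1]
      simp [octMul, octConj, ← Prod.zero_eq_mk]
    · refine smul_right_injective _ hv ?_
      have e1 := octMul_octConj_left (φ v).ofLp (β (octMul (octConj v.ofLp) t))
      rw [← h, octMul_octConj_right, map_smul, octMul_smul_right] at e1
      rw [show Quaternion.normSq (φ v).ofLp.1 + Quaternion.normSq (φ v).ofLp.2
        = octNormSq v.ofLp from hnorm v] at e1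
      exact e1.symm
  obtain ⟨γ, hγ⟩ := exists_spin_of_intertwiner φ (β.prodMap δ)
    (fun s => by rw [LinearMap.prodMap_apply, spinorNormSq, spinorNormSq, hβ, hδ])
    (LinearMap.ext fun s => by simp [Module.End.mul_apply, cliffordRep_volumeElement])
    (fun v => LinearMap.ext fun s => by
      simp [Module.End.mul_apply, gamma_apply, h, hconj])
  exact ⟨γ, fun s => by rw [hγ]; rfl⟩

/-- Clifford multiplication is equivariant under `Spin(8)`. -/
theorem gamma_rotate (γ : Spin8) (v : V8) (s : Spinor) :
    gamma (rotate γ v) (cliffordRep γ s) = cliffordRep γ (gamma v s) := by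
  have hγ : ((γ⁻¹ : Spin8) : Cl8) * (γ : Cl8) = 1 := by
    rw [← Submonoid.coe_mul, inv_mul_cancel, Submonoid.coe_one]
  rw [← cliffordRep_ι, ι_rotate, ← cliffordRep_ι, ← Module.End.mul_apply, ← map_mul, mul_assoc, hγ,
    mul_one, map_mul, Module.End.mul_apply]

/-! ### The lift of `Sp(1) × Sp(1)` -/

theorem Sp1_normSq (u : Sp1) : Quaternion.normSq (u : ℍ[ℝ]) = 1 := by
  have h := Unitary.star_mul_self_of_mem u.2
  rw [Quaternion.star_mul_self] at h
  exact Quaternion.coe_injective (by simpa using h)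

theorem Sp1_star_mul (u : Sp1) : star (u : ℍ[ℝ]) * (u : ℍ[ℝ]) = 1 :=
  Unitary.star_mul_self_of_mem u.2

theorem Sp1_star_mul_cancel (u : Sp1) (x : ℍ[ℝ]) : star (u : ℍ[ℝ]) * ((u : ℍ[ℝ]) * x) = x := by
  rw [← mul_assoc, Sp1_star_mul, one_mul]

/-- Left multiplication by a pair of unit quaternions, as an isometry of `ℍ ⊕ ℍ`. -/
def leftMulIsometry (u : Sp1 × Sp1) : V8 ≃ₗᵢ[ℝ] V8 :=
  LinearIsometry.toLinearIsometryEquiv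
    { toFun := leftMul u
      map_add' := fun v w => by
        apply WithLp.ofLp_injective 2
        simp [leftMul, pt, mul_add]
      map_smul' := fun c v => by
        apply WithLp.ofLp_injective 2
        simp [leftMul, pt]
      norm_map' := fun v => by
        rw [← sq_eq_sq₀ (norm_nonneg _) (norm_nonneg _)]
        change ‖pt _ _‖ ^ 2 = _
        rw [norm_pt_sq, map_mul, map_mul, Sp1_normSq, Sp1_normSq, V8_norm_sq, one_mul,
          one_mul] } rfl

theorem leftMulIsometry_apply (u : Sp1 × Sp1) (v : V8) : leftMulIsometry u v = leftMul u v := rfl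

/-- The action of `(u₁, u₂)` on positive spinors. -/
def posAction (u : Sp1 × Sp1) : (ℍ[ℝ] × ℍ[ℝ]) →ₗ[ℝ] (ℍ[ℝ] × ℍ[ℝ]) :=
  LinearMap.id.prodMap
    (LinearMap.mulLeft ℝ (u.2 : ℍ[ℝ]) ∘ₗ LinearMap.mulRight ℝ (star (u.1 : ℍ[ℝ])))

theorem posAction_apply (u : Sp1 × Sp1) (s : ℍ[ℝ] × ℍ[ℝ]) :
    posAction u s = (s.1, (u.2 : ℍ[ℝ]) * (s.2 * star (u.1 : ℍ[ℝ]))) := rfl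

/-- The action of `(u₁, u₂)` on negative spinors. -/
def negAction (u : Sp1 × Sp1) : (ℍ[ℝ] × ℍ[ℝ]) →ₗ[ℝ] (ℍ[ℝ] × ℍ[ℝ]) :=
  (LinearMap.mulLeft ℝ (u.1 : ℍ[ℝ])).prodMap (LinearMap.mulLeft ℝ (u.2 : ℍ[ℝ]))

theorem negAction_apply (u : Sp1 × Sp1) (s : ℍ[ℝ] × ℍ[ℝ]) :
    negAction u s = ((u.1 : ℍ[ℝ]) * s.1, (u.2 : ℍ[ℝ]) * s.2) := rfl

/-- The associativity of the quaternions makes `leftMulIsometry`, `posAction`, `negAction` a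
triality triple. -/
theorem exists_spinLift (u : Sp1 × Sp1) :
    ∃ γ : Spin8, ∀ s, cliffordRep γ s = (posAction u s.1, negAction u s.2) := by
  refine exists_spin_of_triality (leftMulIsometry u) _ _ (fun s => ?_) (fun t => ?_) fun v s => ?_
  · simp only [octNormSq, posAction_apply, map_mul, Sp1_normSq, Quaternion.normSq_star]
    ring
  · simp only [octNormSq, negAction_apply, map_mul, Sp1_normSq, one_mul]
  · rw [leftMulIsometry_apply]
    simp only [octMul, negAction_apply, posAction_apply, leftMul, pt, mul_add, mul_sub, star_mul,
      star_star]
    refine Prod.ext ?_ ?_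
    · simp only [mul_assoc, Sp1_star_mul_cancel]
      rfl
    · simp only [mul_assoc, Sp1_star_mul_cancel]
      rfl

/-- The homomorphism `Sp(1) × Sp(1) → Spin(8)` lifting left multiplication on `ℍ ⊕ ℍ`. The element
of `Spin(8)` is chosen by its action on spinors, which determines it. -/
def spinLift : Sp1 × Sp1 →* Spin8 where
  toFun u := (exists_spinLift u).choose
  map_one' := by
    apply spin_eq_of_cliffordRep_eq
    refine LinearMap.ext fun s => ?_
    rw [(exists_spinLift 1).choose_spec]
    simp [posAction_apply, negAction_apply]
  map_mul' u w := by
    apply spin_eq_of_cliffordRep_eq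
    refine LinearMap.ext fun s => ?_
    rw [Submonoid.coe_mul, map_mul, Module.End.mul_apply, (exists_spinLift _).choose_spec,
      (exists_spinLift _).choose_spec, (exists_spinLift _).choose_spec]
    simp [posAction_apply, negAction_apply, mul_assoc]

theorem cliffordRep_spinLift (u : Sp1 × Sp1) (s : Spinor) :
    cliffordRep (spinLift u) s = (posAction u s.1, negAction u s.2) :=
  (exists_spinLift u).choose_spec s

theorem rotate_spinLift (u : Sp1 × Sp1) (v : V8) : rotate (spinLift u) v = leftMul u v := by
  apply WithLp.ofLp_injective 2
  have h := gamma_rotate (spinLift u) v ((1, 0), 0)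
  rw [cliffordRep_spinLift, gamma_fst, cliffordRep_spinLift] at h
  have h2 := congrArg Prod.snd h
  simp only [posAction_apply, map_zero, gamma_fst, octMul_one_right, zero_mul, mul_zero] at h2
  exact h2

theorem isSpinLift_spinLift : IsSpinLift spinLift := by
  refine ⟨fun u w h => ?_, rotate_spinLift⟩
  have h1 : leftMul u (pt 1 1) = leftMul w (pt 1 1) := by
    rw [← rotate_spinLift, ← rotate_spinLift, h]
  have h2 := congrArg (fun v : V8 => v.ofLp) h1
  simp only [leftMul, pt] at h2
  exact Prod.ext (Subtype.ext (by simpa using congrArg Prod.fst h2))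
    (Subtype.ext (by simpa using congrArg Prod.snd h2))

/-! ### Transitivity on positive spinors -/

theorem octConj_octConj (p : ℍ[ℝ] × ℍ[ℝ]) : octConj (octConj p) = p := by
  simp [octConj]

theorem octMul_neg_left (p q : ℍ[ℝ] × ℍ[ℝ]) : octMul (-p) q = -octMul p q := by
  rw [← neg_one_smul ℝ p, octMul_smul_left, neg_one_smul]

/-- Polarised right alternativity of the octonions. -/
theorem octMul_conj_add_conj_octMul (t a s : ℍ[ℝ] × ℍ[ℝ]) :
    octMul (octMul t (octConj a)) s + octMul (octMul t (octConj s)) a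
      = (2 * inner ℝ (WithLp.toLp 2 a : V8) (WithLp.toLp 2 s : V8)) • t := by
  obtain ⟨a, b⟩ := a
  obtain ⟨c, d⟩ := s
  simp only [WithLp.prod_inner_apply, Quaternion.inner_def, octMul, octConj]
  refine Prod.ext ?_ ?_ <;> apply Quaternion.ext <;> simp <;> ring

/-- Right alternativity of the octonions. -/
theorem octMul_octMul_conj (t s : ℍ[ℝ] × ℍ[ℝ]) :
    octMul (octMul t s) (octConj s) = octNormSq s • t := by
  obtain ⟨a, b⟩ := s
  simp only [octNormSq, Quaternion.normSq_def', octMul, octConj]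
  refine Prod.ext ?_ ?_ <;> apply Quaternion.ext <;> simp <;> ring

theorem reflection_apply_of_norm_one {a : V8} (ha : ‖a‖ = 1) (s : V8) :
    (ℝ ∙ a)ᗮ.reflection s = s - (2 * inner ℝ a s) • a := by
  rw [Submodule.reflection_orthogonal_apply, Submodule.reflection_singleton_apply, ha]
  simp only [RCLike.ofReal_real_eq_id, id, one_pow, div_one]
  module

/-- The reflection `R` in `a^⊥` is one half of a triality: `(t ā) R s = -(t s̄) a`. A second
reflection removes the conjugation and the sign. -/
theorem octMul_reflection {a : V8} (ha : ‖a‖ = 1) (t : ℍ[ℝ] × ℍ[ℝ]) (s : V8) :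
    octMul (octMul t (octConj a.ofLp)) ((ℝ ∙ a)ᗮ.reflection s).ofLp
      = -octMul (octMul t (octConj s.ofLp)) a.ofLp := by
  have h1 := octMul_conj_add_conj_octMul t a.ofLp s.ofLp
  have h2 := octMul_octMul_conj t (octConj a.ofLp)
  rw [octConj_octConj, octNormSq_conj, octNormSq_ofLp, ha, one_pow, one_smul] at h2
  rw [reflection_apply_of_norm_one ha, WithLp.ofLp_sub, WithLp.ofLp_smul, sub_eq_add_neg,
    octMul_add_right, octMul_neg_right, octMul_smul_right, h2, eq_sub_of_add_eq h1]
  abel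

theorem reflection_octConj {b : V8} (hb : ‖b‖ = 1) (s : V8) :
    (ℝ ∙ (WithLp.toLp 2 (octConj b.ofLp) : V8))ᗮ.reflection (WithLp.toLp 2 (octConj s.ofLp))
      = WithLp.toLp 2 (octConj ((ℝ ∙ b)ᗮ.reflection s).ofLp) := by
  have hb' : ‖(WithLp.toLp 2 (octConj b.ofLp) : V8)‖ = 1 := by
    rw [← sq_eq_sq₀ (norm_nonneg _) zero_le_one, ← octNormSq_ofLp, octNormSq_conj, octNormSq_ofLp,
      hb]
  rw [reflection_apply_of_norm_one hb, reflection_apply_of_norm_one hb']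
  apply WithLp.ofLp_injective 2
  have hin : inner ℝ (WithLp.toLp 2 (octConj b.ofLp) : V8) (WithLp.toLp 2 (octConj s.ofLp))
      = inner ℝ b s := by
    simp [WithLp.prod_inner_apply, Quaternion.inner_def, octConj]
  rw [hin, WithLp.ofLp_sub, WithLp.ofLp_smul, WithLp.ofLp_sub, WithLp.ofLp_smul, sub_eq_add_neg,
    sub_eq_add_neg, ← neg_smul, ← neg_smul, octConj_add, octConj_smul]

/-- Right multiplication of octonions by a unit octonion, as an isometry of `ℝ⁸`. -/
def rightMulIsometry {a : V8} (ha : ‖a‖ = 1) : V8 ≃ₗᵢ[ℝ] V8 :=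
  LinearIsometry.toLinearIsometryEquiv
    { toFun := fun v => WithLp.toLp 2 (octMul v.ofLp a.ofLp)
      map_add' := fun v w => by
        rw [WithLp.ofLp_add, octMul_add_left, WithLp.toLp_add]
      map_smul' := fun c v => by
        rw [WithLp.ofLp_smul, octMul_smul_left, WithLp.toLp_smul]; rfl
      norm_map' := fun v => by
        rw [← sq_eq_sq₀ (norm_nonneg _) (norm_nonneg _)]
        change ‖(WithLp.toLp 2 _ : V8)‖ ^ 2 = _
        rw [← octNormSq_ofLp, octNormSq_mul, octNormSq_ofLp, octNormSq_ofLp, ha]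
        ring } rfl

theorem rightMulIsometry_apply {a : V8} (ha : ‖a‖ = 1) (v : V8) :
    (rightMulIsometry ha v).ofLp = octMul v.ofLp a.ofLp := rfl

theorem norm_toLp_octConj (a : V8) : ‖(WithLp.toLp 2 (octConj a.ofLp) : V8)‖ = ‖a‖ := by
  rw [← sq_eq_sq₀ (norm_nonneg _) (norm_nonneg _), ← octNormSq_ofLp, octNormSq_conj, octNormSq_ofLp]

/-- A linear isometry of `ℝ⁸`, viewed on pairs of quaternions. -/
def onPairs (φ : V8 ≃ₗᵢ[ℝ] V8) : (ℍ[ℝ] × ℍ[ℝ]) →ₗ[ℝ] (ℍ[ℝ] × ℍ[ℝ]) where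
  toFun s := (φ (WithLp.toLp 2 s)).ofLp
  map_add' s t := by simp
  map_smul' c s := by simp

theorem onPairs_apply (φ : V8 ≃ₗᵢ[ℝ] V8) (s : ℍ[ℝ] × ℍ[ℝ]) :
    onPairs φ s = (φ (WithLp.toLp 2 s)).ofLp := rfl

theorem octNormSq_onPairs (φ : V8 ≃ₗᵢ[ℝ] V8) (s : ℍ[ℝ] × ℍ[ℝ]) :
    octNormSq (onPairs φ s) = octNormSq s := by
  rw [onPairs_apply, octNormSq_ofLp, φ.norm_map, ← octNormSq_ofLp]

/-- A product of two reflections of the positive spinors is realised by an element of `Spin(8)`,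
which acts on vectors by `v ↦ (v b) ā` and on negative spinors by `t ↦ (t b̄) a`. -/
theorem exists_spin_reflection_reflection {a b : V8} (ha : ‖a‖ = 1) (hb : ‖b‖ = 1) :
    ∃ γ : Spin8, ∀ s : V8, cliffordRep γ (s.ofLp, 0)
      = (((ℝ ∙ a)ᗮ.reflection ((ℝ ∙ b)ᗮ.reflection s)).ofLp, 0) := by
  have ha' := (norm_toLp_octConj a).trans ha
  have hb' := (norm_toLp_octConj b).trans hb
  obtain ⟨γ, hγ⟩ := exists_spin_of_triality ((rightMulIsometry hb).trans (rightMulIsometry ha'))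
    (onPairs ((ℝ ∙ b)ᗮ.reflection.trans (ℝ ∙ a)ᗮ.reflection))
    (onPairs ((rightMulIsometry hb').trans (rightMulIsometry ha)))
    (octNormSq_onPairs _) (octNormSq_onPairs _) (fun v s => by
      have h1 := octMul_reflection ha (octMul v.ofLp b.ofLp)
        ((ℝ ∙ b)ᗮ.reflection (WithLp.toLp 2 s))
      have h2 := octMul_reflection hb' v.ofLp (WithLp.toLp 2 (octConj s))
      have h3 := reflection_octConj hb (WithLp.toLp 2 s)
      simp only [octConj_octConj] at h2 h3
      simp only [onPairs_apply, LinearIsometryEquiv.trans_apply, rightMulIsometry_apply]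
      rw [h1]
      rw [h3] at h2
      simp only at h2
      rw [h2, octMul_neg_left, neg_neg])
  refine ⟨γ, fun s => ?_⟩
  rw [hγ, map_zero]
  rfl

/-- A product of an even number of reflections of the positive spinors is realised by an element of
`Spin(8)`. -/
theorem exists_spin_of_even_list : ∀ l : List V8, (∀ v ∈ l, ‖v‖ = 1) → Even l.length →
    ∃ γ : Spin8, ∀ s : V8, cliffordRep γ (s.ofLp, 0)
      = (((l.map fun v => (ℝ ∙ v)ᗮ.reflection).prod s).ofLp, 0)
  | [], _, _ => ⟨1, fun s => by simp⟩
  | [_], _, h => by simp at h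
  | a :: b :: l, hl, h => by
    obtain ⟨γ, hγ⟩ := exists_spin_of_even_list l
      (fun v hv => hl v (List.mem_cons_of_mem _ (List.mem_cons_of_mem _ hv)))
      (by simpa [Nat.even_add_one] using h)
    obtain ⟨δ, hδ⟩ := exists_spin_reflection_reflection (hl a (by simp)) (hl b (by simp))
    refine ⟨δ * γ, fun s => ?_⟩
    rw [Submonoid.coe_mul, map_mul, Module.End.mul_apply, hγ, hδ]
    rfl

/-- The embedding `(q, r) ↦ (q, r)` of `ℍ ⊕ ℝ` in `ℍ ⊕ ℍ`. Its image consists of the positive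
spinors fixed by the diagonal `Sp(1)`. -/
def standardEmbedding : (ℍ[ℝ] × ℝ) →ₗ[ℝ] V8 :=
  (WithLp.linearEquiv 2 ℝ (ℍ[ℝ] × ℍ[ℝ])).symm.toLinearMap ∘ₗ
    LinearMap.id.prodMap (Algebra.linearMap ℝ ℍ[ℝ])

theorem standardEmbedding_apply (q : ℍ[ℝ]) (r : ℝ) : standardEmbedding (q, r) = pt q (r : ℍ[ℝ]) :=
  rfl

theorem finrank_range_standardEmbedding : Module.finrank ℝ standardEmbedding.range = 5 := by
  rw [LinearMap.finrank_range_of_inj, Module.finrank_prod, Quaternion.finrank_eq_four,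
    Module.finrank_self]
  rintro ⟨q, r⟩ ⟨q', r'⟩ h
  rw [standardEmbedding_apply, standardEmbedding_apply] at h
  have h' := congrArg (fun v : V8 => v.ofLp) h
  simp only [pt, Prod.mk.injEq] at h'
  exact Prod.ext h'.1 (Quaternion.coe_injective h'.2)

/-- An orthogonal transformation moves a subspace into any other of at least the same dimension. -/
theorem exists_linearIsometry_of_finrank_le {E : Type*} [NormedAddCommGroup E]
    [InnerProductSpace ℝ E] [FiniteDimensional ℝ E] (U W : Submodule ℝ E)
    (h : Module.finrank ℝ U ≤ Module.finrank ℝ W) :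
    ∃ φ : E ≃ₗᵢ[ℝ] E, ∀ s ∈ U, φ s ∈ W := by
  let b := stdOrthonormalBasis ℝ U
  let c := stdOrthonormalBasis ℝ W
  let f : U →ₗ[ℝ] W := b.toBasis.constr ℝ (fun i => c (Fin.castLE h i))
  have hf : Orthonormal ℝ (f ∘ b.toBasis) := by
    have : f ∘ b.toBasis = fun i => c (Fin.castLE h i) := by
      ext1 i
      simp [f]
    rw [this]
    exact c.orthonormal.comp _ (Fin.castLE_injective h)
  let F : U →ₗᵢ[ℝ] W := f.isometryOfOrthonormal (v := b.toBasis) (by simp) hf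
  refine ⟨(W.subtypeₗᵢ.comp F).extend.toLinearIsometryEquiv rfl, fun s hs => ?_⟩
  have := (W.subtypeₗᵢ.comp F).extend_apply ⟨s, hs⟩
  simp only [LinearIsometry.coe_toLinearIsometryEquiv]
  rw [this]
  exact (F ⟨s, hs⟩).2

/-- `Spin(8)` acts transitively on the five-dimensional spaces of positive spinors, because it acts
on the positive spinors through all of `SO(8)`. -/
theorem exists_spin_standard_mem (W : Submodule ℝ Spinor) (hW : W ≤ positiveSpinors)
    (h : 5 ≤ Module.finrank ℝ W) :
    ∃ g : Spin8, ∀ (q : ℍ[ℝ]) (r : ℝ), cliffordRep g ((q, (r : ℍ[ℝ])), 0) ∈ W := by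
  let ι : V8 →ₗ[ℝ] Spinor :=
    LinearMap.inl ℝ _ _ ∘ₗ (WithLp.linearEquiv 2 ℝ (ℍ[ℝ] × ℍ[ℝ])).toLinearMap
  have hι (v : V8) : ι v = (v.ofLp, 0) := rfl
  have hmap : (W.comap ι).map ι = W := by
    rw [Submodule.map_comap_eq, inf_eq_right]
    intro s hs
    refine ⟨WithLp.toLp 2 s.1, ?_⟩
    rw [hι]
    exact Prod.ext rfl ((mem_positiveSpinors s).mp (hW hs)).symm
  have hfin : 5 ≤ Module.finrank ℝ (W.comap ι) := by
    refine h.trans ?_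
    conv_lhs => rw [← hmap]
    exact Submodule.finrank_map_le _ _
  obtain ⟨φ, hφ⟩ := exists_linearIsometry_of_finrank_le standardEmbedding.range (W.comap ι)
    (finrank_range_standardEmbedding.trans_le hfin)
  obtain ⟨l, hl, rfl⟩ := exists_list_reflection φ
  suffices hs : ∃ g : Spin8, ∀ (q : ℍ[ℝ]) (r : ℝ), cliffordRep g ((q, (r : ℍ[ℝ])), 0)
      = ι ((l.map fun v => (ℝ ∙ v)ᗮ.reflection).prod (standardEmbedding (q, r))) by
    obtain ⟨g, hg⟩ := hs
    exact ⟨g, fun q r => by rw [hg]; exact hφ _ ⟨_, rfl⟩⟩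
  rcases Nat.even_or_odd l.length with he | ho
  · obtain ⟨g, hg⟩ := exists_spin_of_even_list l hl he
    exact ⟨g, fun q r => hg (standardEmbedding (q, r))⟩
  · -- an odd product is corrected by a reflection fixing the standard subspace
    have he : ‖pt 0 (quat 0 1 0 0)‖ = 1 := by
      rw [← sq_eq_sq₀ (norm_nonneg _) zero_le_one, norm_pt_sq]
      simp [Quaternion.normSq_def']
    obtain ⟨g, hg⟩ := exists_spin_of_even_list (l ++ [pt 0 (quat 0 1 0 0)]) (fun v hv => by
      rcases List.mem_append.mp hv with hv | hv
      · exact hl v hv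
      · rw [List.mem_singleton.mp hv, he]) (by simpa [Nat.even_add_one] using ho)
    refine ⟨g, fun q r => ?_⟩
    have h1 := hg (standardEmbedding (q, r))
    rw [List.map_append, List.prod_append, List.map_singleton, List.prod_singleton] at h1
    have h2 : (ℝ ∙ pt 0 (quat 0 1 0 0))ᗮ.reflection (standardEmbedding (q, r))
        = standardEmbedding (q, r) := by
      rw [reflection_apply_of_norm_one he, standardEmbedding_apply]
      simp [pt, WithLp.prod_inner_apply, Quaternion.inner_def]
    rw [LinearIsometryEquiv.coe_mul, Function.comp_apply, h2] at h1
    exact h1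

/-! ### The stabiliser of the standard subspace -/

/-- An element of `Spin(8)` fixing the standard five positive spinors lies in the diagonal
`Sp(1)`. -/
theorem mem_diagonal_of_fixes_standard (γ : Spin8)
    (h : ∀ (q : ℍ[ℝ]) (r : ℝ), cliffordRep γ ((q, (r : ℍ[ℝ])), 0) = ((q, (r : ℍ[ℝ])), 0)) :
    γ ∈ diagonal.map spinLift := by
  -- the vector representation commutes with right multiplication by the standard spinors `(q, r)`
  have hr (v : ℍ[ℝ] × ℍ[ℝ]) (q : ℍ[ℝ]) (r : ℝ) : cliffordRep γ (0, octMul v (q, (r : ℍ[ℝ])))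
      = (0, octMul (rotate γ (WithLp.toLp 2 v)).ofLp (q, (r : ℍ[ℝ]))) := by
    have := gamma_rotate γ (WithLp.toLp 2 v) ((q, (r : ℍ[ℝ])), 0)
    rw [h, gamma_fst, gamma_fst] at this
    exact this.symm
  have hneg (v : ℍ[ℝ] × ℍ[ℝ]) : cliffordRep γ (0, v) = (0, (rotate γ (WithLp.toLp 2 v)).ofLp) := by
    have := hr v 1 0
    simpa [octMul_one_right] using this
  have hmul (v : ℍ[ℝ] × ℍ[ℝ]) (q : ℍ[ℝ]) (r : ℝ) :
      (rotate γ (WithLp.toLp 2 (octMul v (q, (r : ℍ[ℝ]))))).ofLp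
        = octMul (rotate γ (WithLp.toLp 2 v)).ofLp (q, (r : ℍ[ℝ])) := by
    have := hr v q r
    rw [hneg] at this
    exact congrArg Prod.snd this
  set p := (rotate γ (WithLp.toLp 2 (1, 0))).ofLp with hp
  have hx (q : ℍ[ℝ]) : (rotate γ (WithLp.toLp 2 (q, 0))).ofLp = (p.1 * q, p.2 * star q) := by
    have := hmul (1, 0) q 0
    simp [octMul] at this
    exact this
  -- for `φ` the vector representation, compare `φ (i j)` with `φ (i) j`
  have hp2 : p.2 = 0 := by
    have h1 := hmul (quat 0 1 0 0, 0) (quat 0 0 1 0) 0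
    rw [hx] at h1
    simp only [octMul, star_zero, zero_mul, mul_zero, sub_zero, add_zero, Quaternion.coe_zero,
      zero_add, hx] at h1
    have h2 := congrArg Prod.snd h1
    simp only [star_mul, mul_assoc] at h2
    have h3 := sub_eq_zero.mpr h2
    rw [← mul_sub, mul_eq_zero] at h3
    refine h3.resolve_right fun h4 => ?_
    have := congrArg (fun q : ℍ[ℝ] => q.imK) h4
    norm_num at this
  have hy (q : ℍ[ℝ]) : (rotate γ (WithLp.toLp 2 (0, q))).ofLp = (0, p.1 * q) := by
    have := hmul (q, 0) 0 1
    simpa [octMul, hx, hp2] using this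
  have hnorm : Quaternion.normSq p.1 = 1 := by
    have h1 := norm_rotate γ (pt 1 0)
    have h2 : octNormSq p = ‖pt 1 0‖ ^ 2 := by
      rw [← h1, hp, octNormSq_ofLp]; rfl
    rw [norm_pt_sq, octNormSq, hp2] at h2
    simpa using h2
  have hu : p.1 ∈ unitary ℍ[ℝ] := by
    rw [Unitary.mem_iff, Quaternion.star_mul_self, Quaternion.self_mul_star, hnorm]
    simp
  let u : Sp1 := ⟨p.1, hu⟩
  refine ⟨(u, u), ⟨u, rfl⟩, ?_⟩
  apply spin_eq_of_cliffordRep_eq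
  have hsnd (v : ℍ[ℝ] × ℍ[ℝ]) : cliffordRep γ (0, v) = (0, (p.1 * v.1, p.1 * v.2)) := by
    have e : ((0 : ℍ[ℝ] × ℍ[ℝ]), v) = (0, (v.1, 0)) + (0, (0, v.2)) := by simp
    rw [e, map_add, hneg, hneg, hx, hy, hp2]
    simp
  have hsnd' (v : ℍ[ℝ] × ℍ[ℝ]) :
      cliffordRep (spinLift (u, u)) (0, v) = (0, (p.1 * v.1, p.1 * v.2)) := by
    rw [cliffordRep_spinLift, map_zero]; rfl
  have hrot : rotate (spinLift (u, u)) (pt 1 0) = rotate γ (pt 1 0) := by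
    rw [rotate_spinLift]
    apply WithLp.ofLp_injective 2
    have := hx 1
    simp only [pt] at this ⊢
    rw [this, hp2]
    simp [leftMul, pt, u]
  have hfst (s : ℍ[ℝ] × ℍ[ℝ]) :
      cliffordRep (spinLift (u, u)) (s, 0) = cliffordRep γ (s, 0) := by
    have e : ((s, 0) : Spinor) = gamma (pt 1 0) (0, -s) := by
      rw [gamma_snd, pt]
      simp [octConj, octMul]
    rw [e, ← gamma_rotate, ← gamma_rotate, hrot, hsnd, hsnd']
  refine LinearMap.ext fun s => ?_
  have e : s = (s.1, 0) + (0, s.2) := by simp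
  rw [e, map_add, map_add, hfst, hsnd, hsnd']

/-! ### Smooth structures on the base of a local homeomorphism -/

section Quotient

open Filter Topology

variable {E : Type*} [NormedAddCommGroup E] [NormedSpace ℝ E] {H : Type*} [TopologicalSpace H]
  {I : ModelWithCorners ℝ E H} {M : Type*} [TopologicalSpace M] [ChartedSpace H M]
  {N : Type*} [TopologicalSpace N]

/-- The charted space structure on the target of a surjective local homeomorphism whose charts are
all the local inverses followed by charts of the source. -/
@[reducible] noncomputable def chartedSpaceOfLocalHomeomorph {f : M → N} (hf : IsLocalHomeomorph f)
    (hs : Function.Surjective f) : ChartedSpace H N where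
  atlas := {e | ∃ x : M, e = (hf.localInverseAt x).trans (chartAt H x)}
  chartAt q := (hf.localInverseAt (hs q).choose).trans (chartAt H (hs q).choose)
  mem_chart_source q := by
    have h (x : M) (hx : f x = q) : q ∈ ((hf.localInverseAt x).trans (chartAt H x)).source := by
      subst hx
      simp
    exact h _ (hs q).choose_spec
  chart_mem_atlas q := ⟨_, rfl⟩

/-- A surjective local homeomorphism whose fibres are permuted transitively by smooth deck
transformations carries the smooth structure of its source to its target. -/
theorem exists_smooth_structure_of_deck [IsManifold I ∞ M] {f : M → N} (hf : IsLocalHomeomorph f)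
    (hs : Function.Surjective f)
    (hdeck : ∀ x y, f x = f y → ∃ g : M → M, ContMDiff I I ∞ g ∧ g x = y ∧ ∀ z, f (g z) = f z) :
    ∃ _ : ChartedSpace H N, IsManifold I ∞ N ∧ IsLocalDiffeomorph I I ∞ f := by
  -- a local inverse composed with `f` agrees locally with a deck transformation
  have hloc (a x : M) (hx : f x ∈ (hf.localInverseAt a).source) :
      ContMDiffAt I I ∞ (fun z => hf.localInverseAt a (f z)) x := by
    obtain ⟨g, hg, hgx, hgf⟩ := hdeck x (hf.localInverseAt a (f x))
      (hf.apply_localInverseAt_of_mem hx).symm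
    refine hg.contMDiffAt.congr_of_eventuallyEq ?_
    have h1 : ∀ᶠ z in 𝓝 x, f z ∈ (hf.localInverseAt a).source :=
      hf.continuous.continuousAt.eventually ((hf.localInverseAt a).open_source.mem_nhds hx)
    have h2 : ∀ᶠ z in 𝓝 x, g z ∈ (hf.localInverseAt a).target := by
      refine hg.continuous.continuousAt.eventually ((hf.localInverseAt a).open_target.mem_nhds ?_)
      rw [hgx]
      exact (hf.localInverseAt a).map_source hx
    filter_upwards [h1, h2] with z hz1 hz2
    refine hf.injOn_localInverseAt_target ((hf.localInverseAt a).map_source hz1) hz2 ?_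
    rw [hf.apply_localInverseAt_of_mem hz1, hgf]
  let := chartedSpaceOfLocalHomeomorph (H := H) hf hs
  have hN : IsManifold I ∞ N := by
    refine isManifold_of_contDiffOn I ∞ N ?_
    rintro _ _ ⟨a, rfl⟩ ⟨b, rfl⟩
    set e := (hf.localInverseAt a).trans (chartAt H a)
    set e' := (hf.localInverseAt b).trans (chartAt H b)
    have htrans : ContMDiffOn I I ∞ (e.symm.trans e') (e.symm.trans e').source := by
      intro y hy
      have hy1 : y ∈ (chartAt H a).target := by simp [e, e'] at hy; tauto
      have hy2 : f ((chartAt H a).symm y) ∈ (hf.localInverseAt b).source := by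
        simp [e, e'] at hy; tauto
      have hy3 : hf.localInverseAt b (f ((chartAt H a).symm y)) ∈ (chartAt H b).source := by
        simp [e, e'] at hy; tauto
      have c1 := contMDiffOn_chart_symm (I := I) (n := ∞) (x := a) |>.contMDiffAt
        ((chartAt H a).open_target.mem_nhds hy1)
      have c2 := hloc b _ hy2
      have c3 := contMDiffOn_chart (I := I) (n := ∞) (x := b) |>.contMDiffAt
        ((chartAt H b).open_source.mem_nhds hy3)
      have c := c3.comp y (c2.comp y c1)
      refine ContMDiffAt.contMDiffWithinAt
        (c.congr_of_eventuallyEq (Eventually.of_forall fun z => ?_))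
      simp [e, e']
    have h1 := I.contMDiff.comp_contMDiffOn (htrans.comp
      (s := I.symm ⁻¹' (e.symm.trans e').source ∩ Set.range I)
      (I.contMDiffOn_symm.mono Set.inter_subset_right) fun z hz => hz.1)
    exact h1.contDiffOn
  have hmem (z : M) : (hf.localInverseAt z).trans (chartAt H z) ∈ IsManifold.maximalAtlas I ∞ N :=
    IsManifold.subset_maximalAtlas ⟨z, rfl⟩
  have hsmooth : ContMDiff I I ∞ f := by
    intro z
    have c1 := contMDiffOn_chart (I := I) (n := ∞) (x := z) |>.contMDiffAt
      (chart_source_mem_nhds H z)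
    have c2 := contMDiffAt_symm_of_mem_maximalAtlas (hmem z) (x := chartAt H z z) (by simp)
    refine (c2.comp z c1).congr_of_eventuallyEq ?_
    filter_upwards [chart_source_mem_nhds H z] with w hw
    simp [(chartAt H z).left_inv hw]
  refine ⟨this, hN, fun x => ⟨⟨(hf.localInverseAt x).toPartialEquiv.symm,
    (hf.localInverseAt x).open_target, (hf.localInverseAt x).open_source, ?_, ?_⟩, ?_, ?_⟩⟩
  · change ContMDiffOn I I ∞ (hf.localInverseAt x).symm _
    rw [hf.localInverseAt_symm]
    exact hsmooth.contMDiffOn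
  · change ContMDiffOn I I ∞ (hf.localInverseAt x) (hf.localInverseAt x).source
    intro q hq
    obtain ⟨z, rfl⟩ := hs q
    have hz : f z ∈ ((hf.localInverseAt z).trans (chartAt H z)).source := by simp
    have c1 := contMDiffAt_of_mem_maximalAtlas (hmem z) hz
    have c2 := contMDiffOn_chart_symm (I := I) (n := ∞) (x := z) |>.contMDiffAt
        (chart_target_mem_nhds H z)
    have e1 : ((hf.localInverseAt z).trans (chartAt H z)) (f z) = chartAt H z z := by simp
    rw [← e1] at c2
    have c3 := hloc x z hq
    have e2 : (chartAt H z).symm (((hf.localInverseAt z).trans (chartAt H z)) (f z)) = z := by simp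
    have c4 := (c2.comp _ c1)
    refine ContMDiffAt.contMDiffWithinAt
      ((ContMDiffAt.comp_of_eq c3 c4 e2).congr_of_eventuallyEq ?_)
    filter_upwards [((hf.localInverseAt z).trans (chartAt H z)).open_source.mem_nhds hz] with w hw
    have hw1 : w ∈ (hf.localInverseAt z).source := by simp at hw; tauto
    have hw2 : hf.localInverseAt z w ∈ (chartAt H z).source := by simp at hw; tauto
    simp [(chartAt H z).left_inv hw2, hf.apply_localInverseAt_of_mem hw1]
  · exact hf.self_mem_localInverseAt_target
  · intro z _
    change f z = (hf.localInverseAt x).symm z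
    rw [hf.localInverseAt_symm]

end Quotient

/-! ### Quotients of the seven-sphere -/

theorem rotate_isLinear (γ : Spin8) : ∃ L : V8 →L[ℝ] V8, ∀ v, rotate γ v = L v := by
  have hadd (v w : V8) : rotate γ (v + w) = rotate γ v + rotate γ w := by
    apply ι_injective
    rw [ι_rotate, map_add, map_add, ι_rotate, ι_rotate, mul_add, add_mul]
  have hsmul (c : ℝ) (v : V8) : rotate γ (c • v) = c • rotate γ v := by
    apply ι_injective
    rw [ι_rotate, map_smul, map_smul, ι_rotate, mul_smul_comm, smul_mul_assoc]
  exact ⟨LinearMap.toContinuousLinearMap ⟨⟨rotate γ, hadd⟩, hsmul⟩, fun v => rfl⟩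

/-- `Spin(8)` acts on `S⁷` by restrictions of linear maps. -/
theorem contMDiff_smul_S7 (γ : Spin8) : ContMDiff (𝓡 7) (𝓡 7) ∞ (fun x : S7 => γ • x) := by
  obtain ⟨L, hL⟩ := rotate_isLinear γ
  have h : ContMDiff (𝓡 7) 𝓘(ℝ, V8) ∞ (fun x : S7 => rotate γ x) := by
    simp only [hL]
    exact L.contDiff.contMDiff.comp contMDiff_coe_sphere
  exact h.codRestrict_sphere fun x => (γ • x).2

theorem isSmoothQuotient_of_actsFreely (Γ : Subgroup Spin8) [Finite Γ] (h : ActsFreely Γ) :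
    IsSmoothQuotient Γ := by
  have hc : ContinuousConstSMul Γ S7 := ⟨fun γ => (contMDiff_smul_S7 γ).continuous⟩
  have hfree : IsCancelSMul Γ S7 := by
    rw [isCancelSMul_iff_eq_one_of_smul_eq]
    intro γ x hx
    have : γ ∈ MulAction.stabilizer Γ x := hx
    rwa [h x, Subgroup.mem_bot] at this
  have hT2 : T2Space (OrbitSpace Γ) := t2Space_of_properlyDiscontinuousSMul_of_t2Space
  have hSC : SecondCountableTopology (OrbitSpace Γ) := ContinuousConstSMul.secondCountableTopology
  refine ⟨hT2, hSC, ?_⟩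
  refine exists_smooth_structure_of_deck
    (isQuotientCoveringMap_quotientMk_of_properlyDiscontinuousSMul (G := Γ)
      (E := S7)).isCoveringMap.isLocalHomeomorph Quotient.mk_surjective fun x y hxy => ?_
  obtain ⟨γ, hγ⟩ := Quotient.exact hxy.symm
  exact ⟨fun z => γ • z, contMDiff_smul_S7 γ, hγ, fun z => Quotient.sound ⟨γ, rfl⟩⟩

/-! ### Traces and conjugation of unit quaternions -/

theorem Sp1_sq_sum (g : Sp1) : (g : ℍ[ℝ]).re ^ 2 + (g : ℍ[ℝ]).imI ^ 2 + (g : ℍ[ℝ]).imJ ^ 2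
    + (g : ℍ[ℝ]).imK ^ 2 = 1 := by
  rw [← Quaternion.normSq_def', Sp1_normSq]

theorem Sp1_coe_inv (g : Sp1) : ((g⁻¹ : Sp1) : ℍ[ℝ]) = star (g : ℍ[ℝ]) := rfl

theorem Sp1_ext {g h : Sp1} (h0 : (g : ℍ[ℝ]).re = (h : ℍ[ℝ]).re)
    (h1 : (g : ℍ[ℝ]).imI = (h : ℍ[ℝ]).imI) (h2 : (g : ℍ[ℝ]).imJ = (h : ℍ[ℝ]).imJ)
    (h3 : (g : ℍ[ℝ]).imK = (h : ℍ[ℝ]).imK) : g = h :=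
  Subtype.ext (Quaternion.ext_iff.mpr ⟨h0, h1, h2, h3⟩)

@[simp] theorem re_Sp1_inv (g : Sp1) : ((g⁻¹ : Sp1) : ℍ[ℝ]).re = (g : ℍ[ℝ]).re := by
  simp [Sp1_coe_inv]
@[simp] theorem imI_Sp1_inv (g : Sp1) : ((g⁻¹ : Sp1) : ℍ[ℝ]).imI = -(g : ℍ[ℝ]).imI := by
  simp [Sp1_coe_inv]
@[simp] theorem imJ_Sp1_inv (g : Sp1) : ((g⁻¹ : Sp1) : ℍ[ℝ]).imJ = -(g : ℍ[ℝ]).imJ := by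
  simp [Sp1_coe_inv]
@[simp] theorem imK_Sp1_inv (g : Sp1) : ((g⁻¹ : Sp1) : ℍ[ℝ]).imK = -(g : ℍ[ℝ]).imK := by
  simp [Sp1_coe_inv]

@[simp] theorem re_Sp1_mul (g h : Sp1) : ((g * h : Sp1) : ℍ[ℝ]).re
    = (g : ℍ[ℝ]).re * (h : ℍ[ℝ]).re - (g : ℍ[ℝ]).imI * (h : ℍ[ℝ]).imI
      - (g : ℍ[ℝ]).imJ * (h : ℍ[ℝ]).imJ - (g : ℍ[ℝ]).imK * (h : ℍ[ℝ]).imK := by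
  simp
@[simp] theorem imI_Sp1_mul (g h : Sp1) : ((g * h : Sp1) : ℍ[ℝ]).imI
    = (g : ℍ[ℝ]).re * (h : ℍ[ℝ]).imI + (g : ℍ[ℝ]).imI * (h : ℍ[ℝ]).re
      + (g : ℍ[ℝ]).imJ * (h : ℍ[ℝ]).imK - (g : ℍ[ℝ]).imK * (h : ℍ[ℝ]).imJ := by
  simp
@[simp] theorem imJ_Sp1_mul (g h : Sp1) : ((g * h : Sp1) : ℍ[ℝ]).imJ
    = (g : ℍ[ℝ]).re * (h : ℍ[ℝ]).imJ - (g : ℍ[ℝ]).imI * (h : ℍ[ℝ]).imK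
      + (g : ℍ[ℝ]).imJ * (h : ℍ[ℝ]).re + (g : ℍ[ℝ]).imK * (h : ℍ[ℝ]).imI := by
  simp
@[simp] theorem imK_Sp1_mul (g h : Sp1) : ((g * h : Sp1) : ℍ[ℝ]).imK
    = (g : ℍ[ℝ]).re * (h : ℍ[ℝ]).imK + (g : ℍ[ℝ]).imI * (h : ℍ[ℝ]).imJ
      - (g : ℍ[ℝ]).imJ * (h : ℍ[ℝ]).imI + (g : ℍ[ℝ]).imK * (h : ℍ[ℝ]).re := by
  simp

@[simp] theorem re_unitQuaternion (a b c d : ℝ) (h) :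
    ((unitQuaternion a b c d h : Sp1) : ℍ[ℝ]).re = a := rfl
@[simp] theorem imI_unitQuaternion (a b c d : ℝ) (h) :
    ((unitQuaternion a b c d h : Sp1) : ℍ[ℝ]).imI = b := rfl
@[simp] theorem imJ_unitQuaternion (a b c d : ℝ) (h) :
    ((unitQuaternion a b c d h : Sp1) : ℍ[ℝ]).imJ = c := rfl
@[simp] theorem imK_unitQuaternion (a b c d : ℝ) (h) :
    ((unitQuaternion a b c d h : Sp1) : ℍ[ℝ]).imK = d := rfl

theorem re_Sp1_le_one (g : Sp1) : (g : ℍ[ℝ]).re ≤ 1 := by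
  nlinarith [Sp1_sq_sum g]

theorem eq_one_of_re_eq_one {g : Sp1} (h : (g : ℍ[ℝ]).re = 1) : g = 1 := by
  have h1 := Sp1_sq_sum g
  rw [h] at h1
  apply Sp1_ext
  · simpa using h
  all_goals
    simp only [OneMemClass.coe_one, Quaternion.imI_one, Quaternion.imJ_one, Quaternion.imK_one]
    nlinarith

theorem Sp1_coe_neg (g : Sp1) : ((-g : Sp1) : ℍ[ℝ]) = -(g : ℍ[ℝ]) := rfl

theorem re_mul_comm_Sp1 (g h : Sp1) : ((g * h : Sp1) : ℍ[ℝ]).re = ((h * g : Sp1) : ℍ[ℝ]).re := by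
  simp only [re_Sp1_mul]
  ring

theorem re_conj_Sp1 (g h : Sp1) : ((g * h * g⁻¹ : Sp1) : ℍ[ℝ]).re = (h : ℍ[ℝ]).re := by
  rw [re_mul_comm_Sp1, ← mul_assoc, inv_mul_cancel, one_mul]

theorem re_mul_add_re_mul_inv (g h : Sp1) :
    ((g * h : Sp1) : ℍ[ℝ]).re + ((g * h⁻¹ : Sp1) : ℍ[ℝ]).re
      = 2 * (g : ℍ[ℝ]).re * (h : ℍ[ℝ]).re := by
  simp only [re_Sp1_mul, re_Sp1_inv, imI_Sp1_inv, imJ_Sp1_inv, imK_Sp1_inv]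
  ring

/-- The half-trace of a commutator of unit quaternions with the same half-trace, as a
polynomial in that half-trace and `Re (b b'⁻¹)`. -/
theorem re_commutator {b b' : Sp1} (h : (b : ℍ[ℝ]).re = (b' : ℍ[ℝ]).re) :
    ((b' * b * b'⁻¹ * b⁻¹ : Sp1) : ℍ[ℝ]).re
      = 2 * ((b * b'⁻¹ : Sp1) : ℍ[ℝ]).re ^ 2 - 4 * (b : ℍ[ℝ]).re ^ 2 * ((b * b'⁻¹ : Sp1) : ℍ[ℝ]).re
        + 4 * (b : ℍ[ℝ]).re ^ 2 - 1 := by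
  have h1 := Sp1_sq_sum b
  have h2 := Sp1_sq_sum b'
  simp only [re_Sp1_mul, imI_Sp1_mul, imJ_Sp1_mul, imK_Sp1_mul, re_Sp1_inv, imI_Sp1_inv,
    imJ_Sp1_inv, imK_Sp1_inv, ← h] at h2 ⊢
  generalize (b : ℍ[ℝ]).re = c at *
  generalize (b : ℍ[ℝ]).imI = x at *
  generalize (b : ℍ[ℝ]).imJ = y at *
  generalize (b : ℍ[ℝ]).imK = z at *
  generalize (b' : ℍ[ℝ]).imI = u at *
  generalize (b' : ℍ[ℝ]).imJ = v at *
  generalize (b' : ℍ[ℝ]).imK = w at *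
  linear_combination (2 * c ^ 2 - (c ^ 2 + u ^ 2 + v ^ 2 + w ^ 2)) * h1 + (2 * c ^ 2 - 1) * h2

/-- Conjugation by a nonzero quaternion agrees with conjugation by a unit quaternion. -/
theorem exists_Sp1_conj_eq {q : ℍ[ℝ]} (hq : q ≠ 0) :
    ∃ h : Sp1, ((∃ r : ℝ, 0 < r ∧ (h : ℍ[ℝ]) = r • q)) ∧
      ∀ g : Sp1, Quaternion.normSq q • ((h * g * h⁻¹ : Sp1) : ℍ[ℝ]) = q * (g : ℍ[ℝ]) * star q := by
  have hn : Quaternion.normSq q ≠ 0 := fun h => hq (Quaternion.normSq_eq_zero.mp h)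
  have hn0 : 0 < Quaternion.normSq q := lt_of_le_of_ne Quaternion.normSq_nonneg hn.symm
  set r := (√(Quaternion.normSq q))⁻¹ with hr
  have hr2 : r * r * Quaternion.normSq q = 1 := by
    rw [hr, ← mul_inv, Real.mul_self_sqrt hn0.le, inv_mul_cancel₀ hn]
  have hu : r • q ∈ unitary ℍ[ℝ] := by
    rw [Unitary.mem_iff, Quaternion.star_mul_self, Quaternion.self_mul_star, Quaternion.normSq_smul,
      sq, hr2]
    simp
  refine ⟨⟨r • q, hu⟩, ⟨r, by positivity, rfl⟩, fun g => ?_⟩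
  rw [Submonoid.coe_mul, Submonoid.coe_mul, Sp1_coe_inv]
  simp only [Quaternion.star_smul, smul_mul_assoc, mul_smul_comm, smul_smul]
  rw [show Quaternion.normSq q * (r * r) = 1 by linarith, one_smul]

/-- Every unit quaternion is conjugate to an element `α + β i` with `β ≥ 0`. -/
theorem exists_conj_complex (g : Sp1) : ∃ h : Sp1, 0 ≤ ((h * g * h⁻¹ : Sp1) : ℍ[ℝ]).imI ∧
    ((h * g * h⁻¹ : Sp1) : ℍ[ℝ]).imJ = 0 ∧ ((h * g * h⁻¹ : Sp1) : ℍ[ℝ]).imK = 0 := by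
  set x := (g : ℍ[ℝ]).imI with hx
  set y := (g : ℍ[ℝ]).imJ with hy
  set z := (g : ℍ[ℝ]).imK with hz
  set r := √(x ^ 2 + y ^ 2 + z ^ 2) with hr
  have hr2 : r ^ 2 = x ^ 2 + y ^ 2 + z ^ 2 := Real.sq_sqrt (by positivity)
  have hr0 : 0 ≤ r := Real.sqrt_nonneg _
  -- with `p = Im g = x i + y j + z k`, the quaternion `q = r - i p` satisfies `q p = r i q`
  by_cases hq : quat (r + x) 0 z (-y) = 0
  · -- here `y = z = 0` and `x ≤ 0`, and conjugation by `j` changes the sign of `x`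
    have h1 : r + x = 0 := congrArg (fun q : ℍ[ℝ] => q.re) hq
    have h2 : z = 0 := congrArg (fun q : ℍ[ℝ] => q.imJ) hq
    have h3 : -y = 0 := congrArg (fun q : ℍ[ℝ] => q.imK) hq
    refine ⟨quatJ, ?_⟩
    simp [quatJ, ← hx, ← hy, ← hz, h2, neg_eq_zero.mp h3]
    linarith
  · obtain ⟨h, -, hh⟩ := exists_Sp1_conj_eq hq
    have hn : Quaternion.normSq (quat (r + x) 0 z (-y)) = 2 * r * (r + x) := by
      rw [Quaternion.normSq_def']
      simp only [quat_re, quat_imI, quat_imJ, quat_imK]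
      linear_combination (-1) * hr2
    have hn0 : 2 * r * (r + x) ≠ 0 := by
      rw [← hn]
      exact fun h => hq (Quaternion.normSq_eq_zero.mp h)
    have hg := hh g
    rw [hn, Quaternion.ext_iff] at hg
    simp only [Quaternion.imI_smul, Quaternion.imJ_smul, Quaternion.imK_smul, Quaternion.imI_mul,
      Quaternion.imJ_mul, Quaternion.imK_mul, Quaternion.re_mul, Quaternion.re_star,
      Quaternion.imI_star, Quaternion.imJ_star, Quaternion.imK_star, quat_re, quat_imI, quat_imJ,
      quat_imK, ← hx, ← hy, ← hz, smul_eq_mul] at hg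
    obtain ⟨-, e1, e2, e3⟩ := hg
    refine ⟨h, ?_, ?_, ?_⟩
    · have : ((h * g * h⁻¹ : Sp1) : ℍ[ℝ]).imI = r := by
        refine mul_left_cancel₀ hn0 (e1.trans ?_)
        linear_combination (-(2 * r + x)) * hr2
      rw [this]
      exact hr0
    · refine mul_left_cancel₀ hn0 (e2.trans ?_)
      linear_combination y * hr2
    · refine mul_left_cancel₀ hn0 (e3.trans ?_)
      linear_combination z * hr2

/-- A rotation about the axis `i` brings the `j, k`-part of a unit quaternion to the half-line of
positive multiples of `j`. -/
theorem exists_conj_fixing_complex (g : Sp1) : ∃ u : Sp1,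
    (u : ℍ[ℝ]).imJ = 0 ∧ (u : ℍ[ℝ]).imK = 0 ∧
    ((u * g * u⁻¹ : Sp1) : ℍ[ℝ]).imI = (g : ℍ[ℝ]).imI ∧
    0 ≤ ((u * g * u⁻¹ : Sp1) : ℍ[ℝ]).imJ ∧ ((u * g * u⁻¹ : Sp1) : ℍ[ℝ]).imK = 0 := by
  set x := (g : ℍ[ℝ]).imI with hx
  set c := (g : ℍ[ℝ]).imJ with hc
  set d := (g : ℍ[ℝ]).imK with hd
  set r := √(c ^ 2 + d ^ 2) with hr
  have hr2 : r ^ 2 = c ^ 2 + d ^ 2 := Real.sq_sqrt (by positivity)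
  have hr0 : 0 ≤ r := Real.sqrt_nonneg _
  -- the argument of `q = r + c - d i` is half of that of `c - d i`, so `q (c j + d k) = r j q`
  by_cases hq : quat (r + c) (-d) 0 0 = 0
  · -- here `d = 0` and `c ≤ 0`, and conjugation by `i` changes the sign of `c`
    have h1 : r + c = 0 := congrArg (fun q : ℍ[ℝ] => q.re) hq
    have h2 : -d = 0 := congrArg (fun q : ℍ[ℝ] => q.imI) hq
    refine ⟨unitQuaternion 0 1 0 0 (by norm_num), ?_⟩
    simp [← hx, ← hc, ← hd, neg_eq_zero.mp h2]
    linarith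
  · obtain ⟨h, ⟨s, -, hs⟩, hh⟩ := exists_Sp1_conj_eq hq
    have hn : Quaternion.normSq (quat (r + c) (-d) 0 0) = 2 * r * (r + c) := by
      rw [Quaternion.normSq_def']
      simp only [quat_re, quat_imI, quat_imJ, quat_imK]
      linear_combination (-1) * hr2
    have hn0 : 2 * r * (r + c) ≠ 0 := by
      rw [← hn]
      exact fun h => hq (Quaternion.normSq_eq_zero.mp h)
    have hg := hh g
    rw [hn, Quaternion.ext_iff] at hg
    simp only [Quaternion.imI_smul, Quaternion.imJ_smul, Quaternion.imK_smul, Quaternion.imI_mul,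
      Quaternion.imJ_mul, Quaternion.imK_mul, Quaternion.re_mul, Quaternion.re_star,
      Quaternion.imI_star, Quaternion.imJ_star, Quaternion.imK_star, quat_re, quat_imI, quat_imJ,
      quat_imK, ← hx, ← hc, ← hd, smul_eq_mul] at hg
    obtain ⟨-, e1, e2, e3⟩ := hg
    refine ⟨h, by simp [hs], by simp [hs], ?_, ?_, ?_⟩
    · refine mul_left_cancel₀ hn0 (e1.trans ?_)
      linear_combination (-x) * hr2
    · have : ((h * g * h⁻¹ : Sp1) : ℍ[ℝ]).imJ = r := by
        refine mul_left_cancel₀ hn0 (e2.trans ?_)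
        linear_combination (-2 * r - c) * hr2
      rw [this]
      exact hr0
    · refine mul_left_cancel₀ hn0 (e3.trans ?_)
      linear_combination d * hr2

/-- A pair of unit quaternions is determined up to conjugation by the three half-traces
`Re a`, `Re b`, `Re (a b)`. -/
theorem exists_conj_pair {a b a' b' : Sp1} (ha1 : (a : ℍ[ℝ]).re ^ 2 < 1)
    (ha : (a : ℍ[ℝ]).re = (a' : ℍ[ℝ]).re) (hb : (b : ℍ[ℝ]).re = (b' : ℍ[ℝ]).re)
    (hab : ((a * b : Sp1) : ℍ[ℝ]).re = ((a' * b' : Sp1) : ℍ[ℝ]).re) :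
    ∃ h : Sp1, h * a * h⁻¹ = a' ∧ h * b * h⁻¹ = b' := by
  -- both pairs are brought to the normal form `α + β i`, `γ + δ i + ε j` with `β, ε ≥ 0`
  have nf (a b : Sp1) : ∃ h : Sp1, 0 ≤ ((h * a * h⁻¹ : Sp1) : ℍ[ℝ]).imI ∧
      ((h * a * h⁻¹ : Sp1) : ℍ[ℝ]).imJ = 0 ∧ ((h * a * h⁻¹ : Sp1) : ℍ[ℝ]).imK = 0 ∧
      0 ≤ ((h * b * h⁻¹ : Sp1) : ℍ[ℝ]).imJ ∧ ((h * b * h⁻¹ : Sp1) : ℍ[ℝ]).imK = 0 := by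
    obtain ⟨h, h1, h2, h3⟩ := exists_conj_complex a
    obtain ⟨u, u1, u2, -, u4, u5⟩ := exists_conj_fixing_complex (h * b * h⁻¹)
    have e : u * h * a * (u * h)⁻¹ = h * a * h⁻¹ := by
      have hcomm : u * (h * a * h⁻¹) = h * a * h⁻¹ * u := by
        apply Sp1_ext
        · rw [re_mul_comm_Sp1]
        · rw [imI_Sp1_mul, imI_Sp1_mul (h * a * h⁻¹), u1, u2, h2, h3]; ring
        · rw [imJ_Sp1_mul, imJ_Sp1_mul (h * a * h⁻¹), u1, u2, h2, h3]; ring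
        · rw [imK_Sp1_mul, imK_Sp1_mul (h * a * h⁻¹), u1, u2, h2, h3]; ring
      calc u * h * a * (u * h)⁻¹ = u * (h * a * h⁻¹) * u⁻¹ := by group
        _ = h * a * h⁻¹ := by rw [hcomm, mul_inv_cancel_right]
    have e' : u * h * b * (u * h)⁻¹ = u * (h * b * h⁻¹) * u⁻¹ := by group
    exact ⟨u * h, by rwa [e], by rwa [e], by rwa [e], by rwa [e'], by rwa [e']⟩
  obtain ⟨h, h1, h2, h3, h4, h5⟩ := nf a b
  obtain ⟨k, k1, k2, k3, k4, k5⟩ := nf a' b'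
  have ra := re_conj_Sp1 h a
  have ra' := re_conj_Sp1 k a'
  have rb := re_conj_Sp1 h b
  have rb' := re_conj_Sp1 k b'
  have rab : ((h * a * h⁻¹ * (h * b * h⁻¹) : Sp1) : ℍ[ℝ]).re
      = ((k * a' * k⁻¹ * (k * b' * k⁻¹) : Sp1) : ℍ[ℝ]).re := by
    rw [show h * a * h⁻¹ * (h * b * h⁻¹) = h * (a * b) * h⁻¹ by group,
      show k * a' * k⁻¹ * (k * b' * k⁻¹) = k * (a' * b') * k⁻¹ by group, re_conj_Sp1, re_conj_Sp1,
      hab]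
  rw [re_Sp1_mul (h * a * h⁻¹), re_Sp1_mul (k * a' * k⁻¹)] at rab
  have n1 := Sp1_sq_sum (h * a * h⁻¹)
  have n2 := Sp1_sq_sum (k * a' * k⁻¹)
  have n3 := Sp1_sq_sum (h * b * h⁻¹)
  have n4 := Sp1_sq_sum (k * b' * k⁻¹)
  suffices hs : h * a * h⁻¹ = k * a' * k⁻¹ ∧ h * b * h⁻¹ = k * b' * k⁻¹ by
    refine ⟨k⁻¹ * h, ?_, ?_⟩
    · calc k⁻¹ * h * a * (k⁻¹ * h)⁻¹ = k⁻¹ * (h * a * h⁻¹) * k := by group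
        _ = a' := by rw [hs.1]; group
    · calc k⁻¹ * h * b * (k⁻¹ * h)⁻¹ = k⁻¹ * (h * b * h⁻¹) * k := by group
        _ = b' := by rw [hs.2]; group
  generalize h * a * h⁻¹ = A at *
  generalize h * b * h⁻¹ = B at *
  generalize k * a' * k⁻¹ = A' at *
  generalize k * b' * k⁻¹ = B' at *
  have eA : (A : ℍ[ℝ]).re = (A' : ℍ[ℝ]).re := by rw [ra, ra', ha]
  have eB : (B : ℍ[ℝ]).re = (B' : ℍ[ℝ]).re := by rw [rb, rb', hb]
  rw [h2, h3] at n1 rab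
  rw [k2, k3] at n2 rab
  have eAI : (A : ℍ[ℝ]).imI = (A' : ℍ[ℝ]).imI := by
    rw [← sq_eq_sq₀ h1 k1]
    rw [eA] at n1
    linarith
  have hpos : (A' : ℍ[ℝ]).imI ≠ 0 := by
    intro h0
    rw [h0, ← eA, ra] at n2
    linarith
  have eBI : (B : ℍ[ℝ]).imI = (B' : ℍ[ℝ]).imI := by
    rw [eA, eB, eAI] at rab
    exact mul_left_cancel₀ hpos (by linarith)
  have eBJ : (B : ℍ[ℝ]).imJ = (B' : ℍ[ℝ]).imJ := by
    rw [← sq_eq_sq₀ h4 k4]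
    rw [h5, eB, eBI] at n3
    rw [k5] at n4
    linarith
  exact ⟨Sp1_ext eA eAI (h2.trans k2.symm) (h3.trans k3.symm),
    Sp1_ext eB eBI eBJ (h5.trans k5.symm)⟩

/-! ### Finite subgroups of the circle and of its normaliser -/

/-- The conjugate subgroup `h G h⁻¹` of `Sp(1)`. -/
def conjSp1 (h : Sp1) (G : Subgroup Sp1) : Subgroup Sp1 := G.map (MulAut.conj h).toMonoidHom

theorem mem_conjSp1 {h x : Sp1} {G : Subgroup Sp1} : x ∈ conjSp1 h G ↔ h⁻¹ * x * h ∈ G := by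
  constructor
  · rintro ⟨g, hg, rfl⟩
    simpa [mul_assoc] using hg
  · exact fun hx => ⟨_, hx, by simp [mul_assoc]⟩

theorem conj_mem_conjSp1 {h x : Sp1} {G : Subgroup Sp1} (hx : x ∈ G) :
    h * x * h⁻¹ ∈ conjSp1 h G :=
  ⟨x, hx, rfl⟩

theorem conjSp1_conjSp1 (h k : Sp1) (G : Subgroup Sp1) :
    conjSp1 h (conjSp1 k G) = conjSp1 (h * k) G := by
  ext x
  simp only [mem_conjSp1, mul_inv_rev, mul_assoc]

instance (h : Sp1) (G : Subgroup Sp1) [Finite G] : Finite (conjSp1 h G) :=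
  Finite.Set.finite_image (G : Set Sp1) _

theorem neg_one_mem_conjSp1 {h : Sp1} {G : Subgroup Sp1} (hG : -1 ∈ G) : -1 ∈ conjSp1 h G := by
  rw [mem_conjSp1]
  simpa using hG

/-- The circle of unit quaternions `α + β i`. -/
def circleSp1 : Subgroup Sp1 where
  carrier := {g | (g : ℍ[ℝ]).imJ = 0 ∧ (g : ℍ[ℝ]).imK = 0}
  mul_mem' := by
    rintro a b ⟨h1, h2⟩ ⟨h3, h4⟩
    simp only [Set.mem_ofPred_eq, imJ_Sp1_mul, imK_Sp1_mul, h1, h2, h3, h4]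
    constructor <;> ring
  one_mem' := ⟨rfl, rfl⟩
  inv_mem' := by
    rintro a ⟨h1, h2⟩
    simp [h1, h2]

theorem mem_circleSp1 {g : Sp1} :
    g ∈ circleSp1 ↔ (g : ℍ[ℝ]).imJ = 0 ∧ (g : ℍ[ℝ]).imK = 0 := Iff.rfl

/-- The inclusion of the circle in `ℂ`. -/
def circleToComplex : circleSp1 →* ℂ where
  toFun g := ⟨((g : Sp1) : ℍ[ℝ]).re, ((g : Sp1) : ℍ[ℝ]).imI⟩
  map_one' := rfl
  map_mul' a b := by
    obtain ⟨a, h1, h2⟩ := a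
    obtain ⟨b, h3, h4⟩ := b
    apply Complex.ext
    · simp [h1, h2, h3, h4]
    · simp [h1, h2, h3, h4]

theorem circleToComplex_injective : Function.Injective circleToComplex := by
  rintro ⟨a, h1, h2⟩ ⟨b, h3, h4⟩ h
  exact Subtype.ext (Sp1_ext (congrArg Complex.re h) (congrArg Complex.im h)
    (h1.trans h3.symm) (h2.trans h4.symm))

theorem expI_mem_circleSp1 (θ : ℝ) : expI θ ∈ circleSp1 := ⟨rfl, rfl⟩

theorem circleToComplex_expI (θ : ℝ) :
    circleToComplex ⟨expI θ, expI_mem_circleSp1 θ⟩ = Complex.exp (θ * Complex.I) := by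
  apply Complex.ext
  · rw [Complex.exp_ofReal_mul_I_re]; rfl
  · rw [Complex.exp_ofReal_mul_I_im]; rfl

/-- A finite subgroup of the circle is generated by any element that is a primitive root of unity
of the right order. -/
theorem eq_closure_of_isPrimitiveRoot {G : Subgroup Sp1} [Finite G] (hG : G ≤ circleSp1)
    {e : Sp1} (he : e ∈ circleSp1)
    (hexp : IsPrimitiveRoot (circleToComplex ⟨e, he⟩) (Nat.card G)) :
    G = Subgroup.closure {e} := by
  have hn : Nat.card G ≠ 0 := Nat.card_pos.ne'
  generalize hcard : Nat.card G = n at *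
  let f : G →* ℂ := circleToComplex.comp (Subgroup.inclusion hG)
  have hf : Function.Injective f :=
    circleToComplex_injective.comp (Subgroup.inclusion_injective hG)
  have : IsCyclic G := isCyclic_of_injective_ringHom f hf
  obtain ⟨g, hg⟩ := IsCyclic.exists_generator (α := G)
  have hord : orderOf g = n := hcard ▸ orderOf_eq_card_of_forall_mem_zpowers hg
  have hprim : IsPrimitiveRoot (f g) n := by
    rw [← hord, ← orderOf_injective f hf]
    exact IsPrimitiveRoot.orderOf _
  have : NeZero n := ⟨hn⟩
  have hmem : e ∈ G := by
    obtain ⟨k, -, hk⟩ := hprim.eq_pow_of_pow_eq_one hexp.pow_eq_one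
    have h1 : circleToComplex (Subgroup.inclusion hG (g ^ k)) = circleToComplex ⟨e, he⟩ := by
      rw [map_pow, map_pow]
      exact hk
    have h2 : ((g ^ k : G) : Sp1) = e := congrArg Subtype.val (circleToComplex_injective h1)
    rw [← h2]
    exact (g ^ k).2
  refine le_antisymm (fun x hx => ?_) ((Subgroup.closure_le _).mpr (by simpa using hmem))
  have hx1 : circleToComplex ⟨x, hG hx⟩ ^ n = 1 := by
    have h1 : f ⟨x, hx⟩ ^ n = 1 := by rw [← map_pow, ← hcard, pow_card_eq_one', map_one]
    exact h1
  obtain ⟨k, -, hk⟩ := hexp.eq_pow_of_pow_eq_one hx1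
  rw [← map_pow] at hk
  have h2 := congrArg (fun g : circleSp1 => (g : Sp1)) (circleToComplex_injective hk)
  simp only [Subgroup.coe_pow] at h2
  rw [← h2]
  exact pow_mem (Subgroup.mem_closure_singleton_self e) k

/-- A finite subgroup of the circle is generated by `e^{2πi/n}`, where `n` is its order. -/
theorem eq_closure_expI {G : Subgroup Sp1} [Finite G] (hG : G ≤ circleSp1) :
    G = Subgroup.closure {expI (2 * Real.pi / Nat.card G)} := by
  have hn : Nat.card G ≠ 0 := Nat.card_pos.ne'
  refine eq_closure_of_isPrimitiveRoot hG (expI_mem_circleSp1 _) ?_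
  have h := Complex.isPrimitiveRoot_exp (Nat.card G) hn
  rw [circleToComplex_expI]
  have e : ((2 * Real.pi / Nat.card G : ℝ) : ℂ) * Complex.I
      = 2 * Real.pi * Complex.I / Nat.card G := by
    push_cast
    ring
  rwa [e]

theorem even_card_of_neg_one_mem {G : Subgroup Sp1} [Finite G] (h : -1 ∈ G) :
    Even (Nat.card G) := by
  have h1 : orderOf (⟨-1, h⟩ : G) = 2 := by
    refine orderOf_eq_prime (Subtype.ext (by simp)) fun h1 => ?_
    have h2 : ((-1 : Sp1) : ℍ[ℝ]).re = ((1 : Sp1) : ℍ[ℝ]).re :=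
      congrArg (fun g : G => ((g : Sp1) : ℍ[ℝ]).re) h1
    rw [Sp1_coe_neg] at h2
    norm_num at h2
  rw [even_iff_two_dvd, ← h1]
  exact orderOf_dvd_natCard _

/-- A finite subgroup of the circle that contains `-1` is generated by `e^{πi/m}`, where `2m` is
its order. -/
theorem exists_eq_closure_expI_pi_div {G : Subgroup Sp1} [Finite G] (hG : G ≤ circleSp1)
    (h : -1 ∈ G) :
    ∃ m : ℕ, 1 ≤ m ∧ Nat.card G = 2 * m ∧ G = Subgroup.closure {expI (Real.pi / m)} := by
  obtain ⟨m, hm⟩ := even_iff_two_dvd.mp (even_card_of_neg_one_mem h)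
  have hpos : 0 < Nat.card G := Nat.card_pos
  refine ⟨m, by omega, hm, ?_⟩
  have h1 := eq_closure_expI hG
  rwa [hm, Nat.cast_mul, Nat.cast_ofNat, mul_div_mul_left _ _ two_ne_zero] at h1

theorem quatJ_mul_self : quatJ * quatJ = -1 := by
  apply Sp1_ext <;> simp [quatJ, Sp1_coe_neg]

/-- A finite subgroup of `circle ∪ circle · j` that contains `j` and an element of the circle
other than `±1` is binary dihedral. -/
theorem isADE_of_quatJ_mem {G : Subgroup Sp1} [Finite G]
    (hG : ∀ g ∈ G, g ∈ circleSp1 ∨ ((g : ℍ[ℝ]).re = 0 ∧ (g : ℍ[ℝ]).imI = 0))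
    (hj : quatJ ∈ G) {b : Sp1} (hb : b ∈ G) (hbc : b ∈ circleSp1) (hbI : (b : ℍ[ℝ]).imI ≠ 0) :
    IsADE G := by
  let C : Subgroup Sp1 := G ⊓ circleSp1
  have : Finite C := Finite.of_injective (Subgroup.inclusion (inf_le_left : C ≤ G))
    (Subgroup.inclusion_injective _)
  have hneg : (-1 : Sp1) ∈ C := by
    refine ⟨quatJ_mul_self ▸ mul_mem hj hj, ?_⟩
    simp [mem_circleSp1, Sp1_coe_neg]
  obtain ⟨n, hn1, hcard, hC⟩ := exists_eq_closure_expI_pi_div (inf_le_right : C ≤ _) hneg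
  have hn : 2 ≤ n := by
    by_contra hlt
    obtain rfl : n = 1 := by omega
    have hbb : b * b = 1 := by
      have h1 := pow_card_eq_one' (x := (⟨b, hb, hbc⟩ : C))
      rw [hcard] at h1
      have h2 := congrArg Subtype.val h1
      simpa [pow_two] using h2
    have h1 := congrArg (fun g : Sp1 => (g : ℍ[ℝ]).imI) hbb
    have h2 := congrArg (fun g : Sp1 => (g : ℍ[ℝ]).re) hbb
    simp [hbc.1, hbc.2] at h1 h2
    have h3 : (b : ℍ[ℝ]).re * (b : ℍ[ℝ]).imI = 0 := by linarith
    rcases mul_eq_zero.mp h3 with h3 | h3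
    · rw [h3] at h2
      nlinarith
    · exact hbI h3
  have heq : G = Subgroup.closure {quatJ, expI (Real.pi / n)} := by
    have hCle : C ≤ Subgroup.closure {quatJ, expI (Real.pi / n)} := by
      refine hC.le.trans ?_
      exact Subgroup.closure_mono (by simp)
    apply le_antisymm
    · intro g hg
      rcases hG g hg with h | ⟨h1, h2⟩
      · exact hCle ⟨hg, h⟩
      · have hJ : quatJ ∈ Subgroup.closure {quatJ, expI (Real.pi / n)} :=
          Subgroup.subset_closure (by simp)
        rw [← Subgroup.mul_mem_cancel_left _ hJ]
        refine hCle ⟨mul_mem hj hg, ?_⟩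
        simp [mem_circleSp1, quatJ, h1, h2]
    · rw [Subgroup.closure_le, Set.insert_subset_iff, Set.singleton_subset_iff]
      refine ⟨hj, ?_⟩
      have : expI (Real.pi / n) ∈ C := by
        exact hC.ge (Subgroup.subset_closure rfl)
      exact this.1
  rw [heq]
  exact IsADE.D n hn

/-- A finite subgroup of the normaliser `circle ∪ circle · j` of the circle that is not contained
in the circle and contains an element of the circle other than `±1` is conjugate to a binary
dihedral group containing `j`. -/
theorem exists_conj_isADE_of_normalizer {G : Subgroup Sp1} [Finite G]
    (hG : ∀ g ∈ G, g ∈ circleSp1 ∨ ((g : ℍ[ℝ]).re = 0 ∧ (g : ℍ[ℝ]).imI = 0))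
    (hne : ¬ G ≤ circleSp1) {b : Sp1} (hb : b ∈ G) (hbc : b ∈ circleSp1)
    (hbI : (b : ℍ[ℝ]).imI ≠ 0) :
    ∃ h : Sp1, IsADE (conjSp1 h G) ∧ quatJ ∈ conjSp1 h G := by
  obtain ⟨g, hg, hgc⟩ := Set.not_subset.mp hne
  obtain ⟨u, u1, u2, u3, u4, u5⟩ := exists_conj_fixing_complex g
  obtain ⟨g1, g2⟩ := (hG g hg).resolve_left hgc
  have huj : u * g * u⁻¹ = quatJ := by
    have hre := re_conj_Sp1 u g
    have hs := Sp1_sq_sum (u * g * u⁻¹)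
    rw [hre, g1, u3, g2, u5] at hs
    refine Sp1_ext (by simpa [g1, quatJ] using hre) (by simpa [g2, quatJ] using u3) ?_
      (by simpa [quatJ] using u5)
    have : ((u * g * u⁻¹ : Sp1) : ℍ[ℝ]).imJ = 1 := by nlinarith
    rw [this]
    simp [quatJ]
  have hcomm {x : Sp1} (hx : x ∈ circleSp1) : u * x * u⁻¹ = x := by
    rw [mul_inv_eq_iff_eq_mul]
    obtain ⟨x1, x2⟩ := hx
    apply Sp1_ext <;> simp [u1, u2, x1, x2] <;> ring
  have hJ : quatJ ∈ conjSp1 u G := huj ▸ conj_mem_conjSp1 hg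
  refine ⟨u, isADE_of_quatJ_mem ?_ hJ (hcomm hbc ▸ conj_mem_conjSp1 hb) hbc hbI, hJ⟩
  rintro _ ⟨x, hx, rfl⟩
  change u * x * u⁻¹ ∈ circleSp1 ∨ ((u * x * u⁻¹ : Sp1) : ℍ[ℝ]).re = 0
    ∧ ((u * x * u⁻¹ : Sp1) : ℍ[ℝ]).imI = 0
  rcases hG x hx with h | ⟨h1, h2⟩
  · left
    rwa [hcomm h]
  · right
    rw [re_conj_Sp1]
    simp [u1, u2, h1, h2]

/-! ### The traces of a finite group of unit quaternions -/

theorem re_mul_self_mul (g h : Sp1) :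
    ((g * (g * h) : Sp1) : ℍ[ℝ]).re
      = 2 * (g : ℍ[ℝ]).re * ((g * h : Sp1) : ℍ[ℝ]).re - (h : ℍ[ℝ]).re := by
  have := Sp1_sq_sum g
  simp
  linear_combination (-(h : ℍ[ℝ]).re) * this

theorem re_eq_of_mul_self_eq_one {g : Sp1} (h : g * g = 1) :
    (g : ℍ[ℝ]).re = 1 ∨ (g : ℍ[ℝ]).re = -1 := by
  have h1 := congrArg (fun g : Sp1 => (g : ℍ[ℝ]).re) h
  have := Sp1_sq_sum g
  simp at h1
  exact mul_self_eq_one_iff.mp (by linarith)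

/-- Let `c < cos (π/6)` bound the real parts of the elements `≠ 1` of a finite group `G ∋ -1` of
unit quaternions. The elements of `G` on the same circle as a given one form a cyclic group of order
`2m`, generated by a conjugate of `e^{πi/m}`. Therefore `m ≤ 5`, and there are few possible real
parts. -/
theorem re_mem_of_re_le {G : Subgroup Sp1} [Finite G] (hneg : -1 ∈ G) {c : ℝ}
    (hc : ∀ g ∈ G, g ≠ 1 → (g : ℍ[ℝ]).re ≤ c) (hc1 : c < √3 / 2) {g : Sp1} (hg : g ∈ G)
    (h0 : 0 ≤ (g : ℍ[ℝ]).re) (h1 : (g : ℍ[ℝ]).re < 1) :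
    (g : ℍ[ℝ]).re = 0 ∨ (g : ℍ[ℝ]).re = 1 / 2 ∨ (g : ℍ[ℝ]).re = √2 / 2 ∨
      (Real.goldenRatio / 2 ≤ c ∧
        ((g : ℍ[ℝ]).re = Real.goldenRatio / 2 ∨ (g : ℍ[ℝ]).re = (Real.goldenRatio - 1) / 2)) := by
  obtain ⟨h, -, hh1, hh2⟩ := exists_conj_complex g
  let C : Subgroup Sp1 := conjSp1 h G ⊓ circleSp1
  have : Finite C := Finite.of_injective (Subgroup.inclusion (inf_le_left : C ≤ conjSp1 h G))
    (Subgroup.inclusion_injective _)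
  have hC1 : (-1 : Sp1) ∈ C :=
    ⟨neg_one_mem_conjSp1 hneg, by simp [mem_circleSp1, Sp1_coe_neg]⟩
  obtain ⟨m, hm, hcard, hC⟩ := exists_eq_closure_expI_pi_div (inf_le_right : C ≤ _) hC1
  have hmc : m ≠ 1 → Real.cos (Real.pi / m) ≤ c := by
    intro hm1
    have hmem : expI (Real.pi / m) ∈ C := hC.ge (Subgroup.subset_closure rfl)
    have h2 := mem_conjSp1.mp hmem.1
    have hre : ((h⁻¹ * expI (Real.pi / m) * h : Sp1) : ℍ[ℝ]).re = Real.cos (Real.pi / m) := by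
      have := re_conj_Sp1 h⁻¹ (expI (Real.pi / m))
      rw [inv_inv] at this
      rw [this]
      simp [expI]
    rw [← hre]
    refine hc _ h2 fun h3 => ?_
    have h4 : expI (Real.pi / m) = 1 := by
      have : expI (Real.pi / m) = h * 1 * h⁻¹ := by rw [← h3]; group
      simpa using this
    have h5 : Real.sin (Real.pi / m) = 0 := by
      simpa [expI] using congrArg (fun g : Sp1 => (g : ℍ[ℝ]).imI) h4
    have hm2 : (2 : ℝ) ≤ m := by exact_mod_cast (by omega : 2 ≤ m)
    refine (Real.sin_pos_of_pos_of_lt_pi (by positivity) ?_).ne' h5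
    rw [div_lt_iff₀ (by linarith)]
    nlinarith [Real.pi_pos]
  have hm5 : m ≤ 5 := by
    by_contra hlt
    have hm6 : (6 : ℝ) ≤ m := by exact_mod_cast (by omega : 6 ≤ m)
    have h2 := hmc (by omega)
    have h3 : Real.cos (Real.pi / 6) ≤ Real.cos (Real.pi / m) := by
      apply Real.cos_le_cos_of_nonneg_of_le_pi (by positivity)
      · linarith [Real.pi_pos]
      · exact div_le_div_of_nonneg_left Real.pi_pos.le (by norm_num) hm6
    rw [Real.cos_pi_div_six] at h3
    linarith
  have hpow : g ^ m * g ^ m = 1 := by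
    have h2 := pow_card_eq_one' (x := (⟨h * g * h⁻¹, conj_mem_conjSp1 hg, hh1, hh2⟩ : C))
    rw [hcard] at h2
    have h3 : (h * g * h⁻¹) ^ (2 * m) = 1 := congrArg Subtype.val h2
    rw [conj_pow, conj_eq_one_iff] at h3
    rwa [← pow_add, ← two_mul]
  have hpm := re_eq_of_mul_self_eq_one hpow
  set x := (g : ℍ[ℝ]).re with hx
  have t1 : ((g ^ 1 : Sp1) : ℍ[ℝ]).re = x := by simp [hx]
  have trec (k : ℕ) : ((g ^ (k + 2) : Sp1) : ℍ[ℝ]).re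
      = 2 * x * ((g ^ (k + 1) : Sp1) : ℍ[ℝ]).re - ((g ^ k : Sp1) : ℍ[ℝ]).re := by
    rw [pow_succ' g (k + 1), pow_succ' g k, re_mul_self_mul]
  -- the Chebyshev polynomials
  have t0 : ((g ^ 0 : Sp1) : ℍ[ℝ]).re = 1 := by simp
  have t2 : ((g ^ 2 : Sp1) : ℍ[ℝ]).re = 2 * x ^ 2 - 1 := by
    rw [trec 0, zero_add, t1, t0]; ring
  have t3 : ((g ^ 3 : Sp1) : ℍ[ℝ]).re = 4 * x ^ 3 - 3 * x := by
    rw [trec 1, t2, t1]; ring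
  have t4 : ((g ^ 4 : Sp1) : ℍ[ℝ]).re = 8 * x ^ 4 - 8 * x ^ 2 + 1 := by
    rw [trec 2, t3, t2]; ring
  have t5 : ((g ^ 5 : Sp1) : ℍ[ℝ]).re = 16 * x ^ 5 - 20 * x ^ 3 + 5 * x := by
    rw [trec 3, t4, t3]; ring
  have hφ := Real.goldenRatio_sq
  have hφ1 := Real.one_lt_goldenRatio
  have hφ2 : Real.goldenRatio = (1 + √5) / 2 := rfl
  interval_cases m
  · rw [t1] at hpm
    rcases hpm with h | h <;> linarith
  · rw [t2] at hpm
    left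
    rcases hpm with h | h
    · exfalso; nlinarith
    · exact pow_eq_zero_iff two_ne_zero |>.mp (by linarith)
  · rw [t3] at hpm
    right; left
    rcases hpm with h | h
    · exfalso
      have : (1 - x) * (2 * x + 1) ^ 2 = 0 := by linarith
      have : 0 < (1 - x) * (2 * x + 1) ^ 2 := by
        have : 0 < 1 - x := by linarith
        positivity
      linarith
    · have h2 : (x + 1) * (2 * x - 1) ^ 2 = 0 := by linarith
      have h3 := (mul_eq_zero.mp h2).resolve_left (by linarith)
      have := pow_eq_zero_iff two_ne_zero |>.mp h3
      linarith
  · rw [t4] at hpm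
    rcases hpm with h | h
    · left
      have h2 : x ^ 2 * (1 - x ^ 2) = 0 := by linarith
      have h3 := (mul_eq_zero.mp h2).resolve_right (by nlinarith)
      exact pow_eq_zero_iff two_ne_zero |>.mp h3
    · right; right; left
      have h2 : (2 * x ^ 2 - 1) ^ 2 = 0 := by linarith
      have h3 := pow_eq_zero_iff two_ne_zero |>.mp h2
      rw [← sq_eq_sq₀ h0 (by positivity), div_pow, Real.sq_sqrt (by norm_num)]
      linarith
  · rw [t5] at hpm
    right; right; right
    have hcc := hmc (by norm_num)
    have h55 : Real.cos (Real.pi / (5 : ℕ)) = Real.goldenRatio / 2 := by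
      rw [hφ2]
      push_cast
      rw [Real.cos_pi_div_five]
      ring
    rw [h55] at hcc
    refine ⟨hcc, ?_⟩
    rcases hpm with h | h
    · right
      have h2 : (1 - x) * (4 * x ^ 2 + 2 * x - 1) ^ 2 = 0 := by linarith
      have h3 := pow_eq_zero_iff two_ne_zero |>.mp
        ((mul_eq_zero.mp h2).resolve_left (by linarith))
      have h4 : (2 * x - (Real.goldenRatio - 1)) * (2 * x + Real.goldenRatio) = 0 := by
        linear_combination h3 - hφ
      have := (mul_eq_zero.mp h4).resolve_right (by linarith)
      linarith
    · left
      have h2 : (1 + x) * (4 * x ^ 2 - 2 * x - 1) ^ 2 = 0 := by linarith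
      have h3 := pow_eq_zero_iff two_ne_zero |>.mp
        ((mul_eq_zero.mp h2).resolve_left (by linarith))
      have h4 : (2 * x - Real.goldenRatio) * (2 * x + (Real.goldenRatio - 1)) = 0 := by
        linear_combination h3 - hφ
      have := (mul_eq_zero.mp h4).resolve_right (by linarith)
      linarith

/-! ### Maximality of the polyhedral groups -/

/-- The quaternion `i`. -/
def quatI : Sp1 := unitQuaternion 0 1 0 0 (by norm_num)

theorem quatZeta'_mul_quatZeta : quatZeta' * quatZeta = quatI := by
  apply Sp1_ext <;> simp [quatZeta, quatZeta', quatI]; norm_num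

theorem quatZeta_mul_quatZeta' : quatZeta * quatZeta' = quatJ := by
  apply Sp1_ext <;> simp [quatZeta, quatZeta', quatJ]; norm_num

theorem quatXi_mul_quatXi : quatXi * quatXi = quatI := by
  have h : √2 * √2 = 2 := Real.mul_self_sqrt (by norm_num)
  apply Sp1_ext <;> simp [quatXi, quatI, ← mul_inv, h]; norm_num

theorem quatZeta_mul_quatI : quatZeta * quatI = quatJ * quatZeta := by
  apply Sp1_ext <;> simp [quatZeta, quatI, quatJ]

theorem inv_goldenRatio_eq : Real.goldenRatio⁻¹ = Real.goldenRatio - 1 := by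
  rw [Real.inv_goldenRatio]
  linarith [Real.goldenRatio_add_goldenConj]

/-- The element `j` of the binary icosahedral group as a word in the generators. -/
theorem quatZeta_mul_quatEta_mul_quatEta : quatZeta * quatEta * quatEta = quatEta * quatJ := by
  have h := Real.goldenRatio_sq
  apply Sp1_ext <;> simp only [quatZeta, quatEta, quatJ, inv_goldenRatio_eq, re_Sp1_mul,
    imI_Sp1_mul, imJ_Sp1_mul, imK_Sp1_mul, re_unitQuaternion, imI_unitQuaternion,
    imJ_unitQuaternion, imK_unitQuaternion] <;> generalize Real.goldenRatio = φ at h ⊢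
  · linear_combination (-1 / 4) * h
  · linear_combination (1 / 4) * h
  · linear_combination (1 / 4) * h
  · linear_combination (-1 / 4) * h

/-- An element of `G ∖ S` whose real part is maximal in its coset. -/
theorem exists_max_re_coset {G S : Subgroup Sp1} [Finite G] (hS : S ≤ G) (h : ¬ G ≤ S) :
    ∃ x ∈ G, x ∉ S ∧ ∀ s ∈ S, ((x * s : Sp1) : ℍ[ℝ]).re ≤ (x : ℍ[ℝ]).re := by
  obtain ⟨g, hg, hgS⟩ := Set.not_subset.mp h
  have : Finite S := Finite.of_injective _ (Subgroup.inclusion_injective hS)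
  obtain ⟨⟨s₀, hS₀⟩, hs₀⟩ := Finite.exists_max (fun s : S => ((g * s : Sp1) : ℍ[ℝ]).re)
  refine ⟨g * s₀, mul_mem hg (hS hS₀),
    fun hx => hgS ((Subgroup.mul_mem_cancel_right _ hS₀).mp hx), fun s hs => ?_⟩
  rw [mul_assoc]
  exact hs₀ ⟨s₀ * s, mul_mem hS₀ hs⟩

/-- The Voronoi cell of `1` with respect to the 24 Hurwitz units lies in the cone
over an octahedron. -/
theorem abs_add_abs_add_abs_le_re {S : Subgroup Sp1} (hI : quatI ∈ S) (hJ : quatJ ∈ S)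
    (hζ : quatZeta ∈ S) {x : Sp1}
    (hx : ∀ s ∈ S, ((x * s : Sp1) : ℍ[ℝ]).re ≤ (x : ℍ[ℝ]).re) :
    |(x : ℍ[ℝ]).imI| + |(x : ℍ[ℝ]).imJ| + |(x : ℍ[ℝ]).imK| ≤ (x : ℍ[ℝ]).re := by
  have conjm {a b : Sp1} (ha : a ∈ S) (hb : b ∈ S) : a * b * a⁻¹ ∈ S :=
    mul_mem (mul_mem ha hb) (inv_mem ha)
  have h1 := hx _ hζ
  have h2 := hx _ (inv_mem hζ)
  have h3 := hx _ (conjm hI hζ)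
  have h4 := hx _ (inv_mem (conjm hI hζ))
  have h5 := hx _ (conjm hJ hζ)
  have h6 := hx _ (inv_mem (conjm hJ hζ))
  have h7 := hx _ (conjm (mul_mem hI hJ) hζ)
  have h8 := hx _ (inv_mem (conjm (mul_mem hI hJ) hζ))
  simp [quatI, quatJ, quatZeta] at h1 h2 h3 h4 h5 h6 h7 h8
  rcases abs_cases (x : ℍ[ℝ]).imI with ⟨e1, -⟩ | ⟨e1, -⟩ <;>
  rcases abs_cases (x : ℍ[ℝ]).imJ with ⟨e2, -⟩ | ⟨e2, -⟩ <;>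
  rcases abs_cases (x : ℍ[ℝ]).imK with ⟨e3, -⟩ | ⟨e3, -⟩ <;>
  rw [e1, e2, e3] <;> linarith

/-- A finite group of unit quaternions whose nontrivial elements have real part at most `1/2` is
not larger than the binary tetrahedral group. -/
theorem eq_E6 {G : Subgroup Sp1} [Finite G] (hc : ∀ g ∈ G, g ≠ 1 → (g : ℍ[ℝ]).re ≤ 1 / 2)
    (h1 : quatZeta ∈ G) (h2 : quatZeta' ∈ G) :
    G = Subgroup.closure {quatZeta, quatZeta'} := by
  set S := Subgroup.closure {quatZeta, quatZeta'} with hS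
  have hSG : S ≤ G := by
    rw [hS, Subgroup.closure_le, Set.insert_subset_iff, Set.singleton_subset_iff]
    exact ⟨h1, h2⟩
  have hζ : quatZeta ∈ S := Subgroup.subset_closure (by simp)
  have hζ' : quatZeta' ∈ S := Subgroup.subset_closure (by simp)
  have hI : quatI ∈ S := quatZeta'_mul_quatZeta ▸ mul_mem hζ' hζ
  have hJ : quatJ ∈ S := quatZeta_mul_quatZeta' ▸ mul_mem hζ hζ'
  refine le_antisymm ?_ hSG
  by_contra hne
  obtain ⟨x, hxG, hxS, hx⟩ := exists_max_re_coset hSG hne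
  have h3 := abs_add_abs_add_abs_le_re hI hJ hζ hx
  have h4 := hc x hxG (fun h => hxS (h ▸ one_mem S))
  have h5 := Sp1_sq_sum x
  rw [← sq_abs (x : ℍ[ℝ]).imI, ← sq_abs (x : ℍ[ℝ]).imJ, ← sq_abs (x : ℍ[ℝ]).imK] at h5
  have a1 := abs_nonneg (x : ℍ[ℝ]).imI
  have a2 := abs_nonneg (x : ℍ[ℝ]).imJ
  have a3 := abs_nonneg (x : ℍ[ℝ]).imK
  nlinarith [mul_nonneg a1 a2, mul_nonneg a1 a3, mul_nonneg a2 a3]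

/-- The numerical contradiction behind the maximality of the binary octahedral and icosahedral
groups, where `t` is `1` and `φ`: the bounds give
`1 - (Re x)² = |Im x|² ≤ t (1 - Re x) Re x`. -/
theorem not_abs_im_le {x : Sp1} {t : ℝ} (ht : t < 2)
    (h : |(x : ℍ[ℝ]).imI| + |(x : ℍ[ℝ]).imJ| + |(x : ℍ[ℝ]).imK| ≤ (x : ℍ[ℝ]).re)
    (hx : (x : ℍ[ℝ]).re < 1)
    (hI : |(x : ℍ[ℝ]).imI| ≤ t * (1 - (x : ℍ[ℝ]).re))
    (hJ : |(x : ℍ[ℝ]).imJ| ≤ t * (1 - (x : ℍ[ℝ]).re))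
    (hK : |(x : ℍ[ℝ]).imK| ≤ t * (1 - (x : ℍ[ℝ]).re)) : False := by
  have h5 := Sp1_sq_sum x
  rw [← sq_abs (x : ℍ[ℝ]).imI, ← sq_abs (x : ℍ[ℝ]).imJ, ← sq_abs (x : ℍ[ℝ]).imK] at h5
  have a1 := abs_nonneg (x : ℍ[ℝ]).imI
  have a2 := abs_nonneg (x : ℍ[ℝ]).imJ
  have a3 := abs_nonneg (x : ℍ[ℝ]).imK
  generalize |(x : ℍ[ℝ]).imI| = p at *
  generalize |(x : ℍ[ℝ]).imJ| = q at *
  generalize |(x : ℍ[ℝ]).imK| = r at *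
  generalize (x : ℍ[ℝ]).re = y at *
  have hd : 0 < 1 - y := by linarith
  have ht0 : 0 ≤ t := by
    by_contra hlt
    nlinarith
  have key : (1 - y) * (1 + y) ≤ (1 - y) * (t * y) := by
    have := mul_le_mul_of_nonneg_left h (mul_nonneg ht0 hd.le)
    nlinarith [mul_le_mul_of_nonneg_left hI a1, mul_le_mul_of_nonneg_left hJ a2,
      mul_le_mul_of_nonneg_left hK a3]
  have := le_of_mul_le_mul_left key hd
  nlinarith

/-- Conjugation by `quatZeta`, which permutes `i`, `j`, `k` cyclically, preserves the bounds on the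
real parts of a coset. -/
theorem re_conj_quatZeta_mul_le {S : Subgroup Sp1} (hζ : quatZeta ∈ S) {c : ℝ} {y : Sp1}
    (hy : ∀ s ∈ S, ((y * s : Sp1) : ℍ[ℝ]).re ≤ c) :
    ∀ s ∈ S, ((quatZeta * y * quatZeta⁻¹ * s : Sp1) : ℍ[ℝ]).re ≤ c := by
  intro s hs
  rw [show quatZeta * y * quatZeta⁻¹ * s
    = quatZeta * (y * (quatZeta⁻¹ * s * quatZeta)) * quatZeta⁻¹ by group, re_conj_Sp1]
  exact hy _ (mul_mem (mul_mem (inv_mem hζ) hs) hζ)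

theorem imI_conj_quatZeta (x : Sp1) :
    ((quatZeta * x * quatZeta⁻¹ : Sp1) : ℍ[ℝ]).imI = (x : ℍ[ℝ]).imK := by
  simp [quatZeta]; ring

theorem imJ_conj_quatZeta (x : Sp1) :
    ((quatZeta * x * quatZeta⁻¹ : Sp1) : ℍ[ℝ]).imJ = (x : ℍ[ℝ]).imI := by
  simp [quatZeta]; ring

theorem imK_conj_quatZeta (x : Sp1) :
    ((quatZeta * x * quatZeta⁻¹ : Sp1) : ℍ[ℝ]).imK = (x : ℍ[ℝ]).imJ := by
  simp [quatZeta]; ring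

/-- A finite group of unit quaternions whose nontrivial elements have real part at most `1/√2` is
not larger than the binary octahedral group. -/
theorem eq_E7 {G : Subgroup Sp1} [Finite G] (hc : ∀ g ∈ G, g ≠ 1 → (g : ℍ[ℝ]).re ≤ √2 / 2)
    (h1 : quatZeta ∈ G) (h2 : quatXi ∈ G) :
    G = Subgroup.closure {quatZeta, quatXi} ∧ quatJ ∈ G := by
  set S := Subgroup.closure {quatZeta, quatXi} with hS
  have hSG : S ≤ G := by
    rw [hS, Subgroup.closure_le, Set.insert_subset_iff, Set.singleton_subset_iff]
    exact ⟨h1, h2⟩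
  have hζ : quatZeta ∈ S := Subgroup.subset_closure (by simp)
  have hξ : quatXi ∈ S := Subgroup.subset_closure (by simp)
  have hI : quatI ∈ S := by
    rw [← quatXi_mul_quatXi]
    exact mul_mem hξ hξ
  have hJ : quatJ ∈ S := by
    have : quatZeta * quatI * quatZeta⁻¹ = quatJ := by
      rw [quatZeta_mul_quatI, mul_inv_cancel_right]
    rw [← this]
    exact mul_mem (mul_mem hζ hI) (inv_mem hζ)
  refine ⟨le_antisymm ?_ hSG, hSG hJ⟩
  by_contra hne
  obtain ⟨x, hxG, hxS, hx⟩ := exists_max_re_coset hSG hne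
  have h3 := abs_add_abs_add_abs_le_re hI hJ hζ hx
  have hcS {s : Sp1} (hs : s ∈ S) : ((x * s : Sp1) : ℍ[ℝ]).re ≤ √2 / 2 :=
    hc _ (mul_mem hxG (hSG hs)) fun h => hxS
      ((Subgroup.mul_mem_cancel_right _ hs).mp (h ▸ one_mem S))
  have h22 : √2 * √2 = 2 := Real.mul_self_sqrt (by norm_num)
  have h20 : 0 < √2 := by positivity
  have b0 := hcS (one_mem S)
  rw [mul_one] at b0
  -- this bounds `i`-parts, and rotation by `quatZeta` permutes the three axes
  have key {y : Sp1} (hy : ∀ s ∈ S, ((y * s : Sp1) : ℍ[ℝ]).re ≤ √2 / 2) :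
      |(y : ℍ[ℝ]).imI| ≤ 1 * (1 - (y : ℍ[ℝ]).re) := by
    have b1 := hy _ hξ
    have b2 := hy _ (inv_mem hξ)
    have hinv : (√2)⁻¹ = √2 / 2 := by field_simp; linarith
    simp [quatXi, hinv] at b1 b2
    rw [abs_le]
    constructor <;> refine le_of_mul_le_mul_left ?_ h20 <;> linarith
  have k0 := key fun s hs => hcS hs
  have k1 := key (re_conj_quatZeta_mul_le hζ fun s hs => hcS hs)
  have k2 := key (re_conj_quatZeta_mul_le hζ (re_conj_quatZeta_mul_le hζ fun s hs => hcS hs))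
  rw [imI_conj_quatZeta, re_conj_Sp1] at k1
  rw [imI_conj_quatZeta, imK_conj_quatZeta, re_conj_Sp1, re_conj_Sp1] at k2
  exact not_abs_im_le one_lt_two h3 (by nlinarith) k0 k2 k1

/-- A finite group of unit quaternions whose nontrivial elements have real part at most `φ/2` is
not larger than the binary icosahedral group. -/
theorem eq_E8 {G : Subgroup Sp1} [Finite G]
    (hc : ∀ g ∈ G, g ≠ 1 → (g : ℍ[ℝ]).re ≤ Real.goldenRatio / 2)
    (h1 : quatZeta ∈ G) (h2 : quatEta ∈ G) :
    G = Subgroup.closure {quatZeta, quatEta} ∧ quatJ ∈ G := by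
  set S := Subgroup.closure {quatZeta, quatEta} with hS
  have hSG : S ≤ G := by
    rw [hS, Subgroup.closure_le, Set.insert_subset_iff, Set.singleton_subset_iff]
    exact ⟨h1, h2⟩
  have hζ : quatZeta ∈ S := Subgroup.subset_closure (by simp)
  have hη : quatEta ∈ S := Subgroup.subset_closure (by simp)
  have hJ : quatJ ∈ S := by
    rw [← Subgroup.mul_mem_cancel_left _ hη, ← quatZeta_mul_quatEta_mul_quatEta]
    exact mul_mem (mul_mem hζ hη) hη
  have hI : quatI ∈ S := by
    rw [← Subgroup.mul_mem_cancel_left _ hζ, quatZeta_mul_quatI]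
    exact mul_mem hJ hζ
  refine ⟨le_antisymm ?_ hSG, hSG hJ⟩
  by_contra hne
  obtain ⟨x, hxG, hxS, hx⟩ := exists_max_re_coset hSG hne
  have h3 := abs_add_abs_add_abs_le_re hI hJ hζ hx
  have hcS {s : Sp1} (hs : s ∈ S) : ((x * s : Sp1) : ℍ[ℝ]).re ≤ Real.goldenRatio / 2 :=
    hc _ (mul_mem hxG (hSG hs)) fun h => hxS
      ((Subgroup.mul_mem_cancel_right _ hs).mp (h ▸ one_mem S))
  have conjm {a b : Sp1} (ha : a ∈ S) (hb : b ∈ S) : a * b * a⁻¹ ∈ S :=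
    mul_mem (mul_mem ha hb) (inv_mem ha)
  have b0 := hcS (one_mem S)
  rw [mul_one] at b0
  have hφ := Real.goldenRatio_sq
  have hφ1 := Real.one_lt_goldenRatio
  have hφ2 := Real.goldenRatio_lt_two
  -- the sum of the bounds for the two conjugates `(φ ± φ⁻¹ i + j)/2` of `quatEta` bounds `j`-parts,
  -- and rotation by `quatZeta` permutes the three axes
  have key {y : Sp1} (hy : ∀ s ∈ S, ((y * s : Sp1) : ℍ[ℝ]).re ≤ Real.goldenRatio / 2) :
      |(y : ℍ[ℝ]).imJ| ≤ Real.goldenRatio * (1 - (y : ℍ[ℝ]).re) := by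
    have b1 := hy _ hη
    have b2 := hy _ (conjm hJ hη)
    have b3 := hy _ (inv_mem hη)
    have b4 := hy _ (inv_mem (conjm hJ hη))
    simp [quatEta, quatJ] at b1 b2 b3 b4
    rw [abs_le]
    constructor <;> linarith
  have k0 := key fun s hs => hcS hs
  have k1 := key (re_conj_quatZeta_mul_le hζ fun s hs => hcS hs)
  have k2 := key (re_conj_quatZeta_mul_le hζ (re_conj_quatZeta_mul_le hζ fun s hs => hcS hs))
  rw [imJ_conj_quatZeta, re_conj_Sp1] at k1
  rw [imJ_conj_quatZeta, imI_conj_quatZeta, re_conj_Sp1, re_conj_Sp1] at k2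
  exact not_abs_im_le hφ2 h3 (by linarith) k1 k0 k2

/-! ### The finite groups of unit quaternions -/

/-- If conjugation by every element of `G` fixes or inverts `b ≠ ±1`, then `G` normalises the
circle through `b`. -/
theorem exists_conj_le_circleSp1_or_isADE {G : Subgroup Sp1} [Finite G] {b : Sp1} (hb : b ∈ G)
    (hb1 : (b : ℍ[ℝ]).re ^ 2 < 1) (h : ∀ g ∈ G, g * b = b * g ∨ g * b = b⁻¹ * g) :
    ∃ h : Sp1, conjSp1 h G ≤ circleSp1 ∨ (IsADE (conjSp1 h G) ∧ quatJ ∈ conjSp1 h G) := by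
  obtain ⟨k, -, hkb⟩ := exists_conj_complex b
  have hn := Sp1_sq_sum (k * b * k⁻¹)
  have hre := re_conj_Sp1 k b
  have hmem : k * b * k⁻¹ ∈ conjSp1 k G := conj_mem_conjSp1 hb
  have hconj : ∀ x ∈ conjSp1 k G, x * (k * b * k⁻¹) = (k * b * k⁻¹) * x ∨
      x * (k * b * k⁻¹) = (k * b * k⁻¹)⁻¹ * x := by
    rintro _ ⟨g, hg, rfl⟩
    change k * g * k⁻¹ * _ = _ * (k * g * k⁻¹) ∨ k * g * k⁻¹ * _ = _ * (k * g * k⁻¹)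
    refine (h g hg).imp (fun e => ?_) fun e => ?_
    · calc k * g * k⁻¹ * (k * b * k⁻¹) = k * (g * b) * k⁻¹ := by group
        _ = _ := by rw [e]; group
    · calc k * g * k⁻¹ * (k * b * k⁻¹) = k * (g * b) * k⁻¹ := by group
        _ = _ := by rw [e]; group
  generalize k * b * k⁻¹ = d at *
  rw [hkb.1, hkb.2, hre] at hn
  have hI : (d : ℍ[ℝ]).imI ≠ 0 := by
    intro h0
    rw [h0] at hn
    linarith
  by_cases hle : conjSp1 k G ≤ circleSp1
  · exact ⟨k, Or.inl hle⟩
  obtain ⟨u, hu⟩ := exists_conj_isADE_of_normalizer (G := conjSp1 k G) (fun x hx => by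
    have cancel {t : ℝ} (ht : (d : ℍ[ℝ]).imI * t = 0) : t = 0 :=
      (mul_eq_zero.mp ht).resolve_left hI
    refine (hconj x hx).imp (fun e => ⟨?_, ?_⟩) fun e => ⟨?_, ?_⟩
    · have := congrArg (fun q : Sp1 => (q : ℍ[ℝ]).imK) e
      simp [hkb.1, hkb.2] at this
      exact cancel (by linarith)
    · have := congrArg (fun q : Sp1 => (q : ℍ[ℝ]).imJ) e
      simp [hkb.1, hkb.2] at this
      exact cancel (by linarith)
    · have := congrArg (fun q : Sp1 => (q : ℍ[ℝ]).imI) e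
      simp [hkb.1, hkb.2] at this
      exact cancel (by linarith)
    · have := congrArg (fun q : Sp1 => (q : ℍ[ℝ]).re) e
      simp [hkb.1, hkb.2] at this
      exact cancel (by linarith)) hle hmem hkb hI
  rw [conjSp1_conjSp1] at hu
  exact ⟨u * k, Or.inr hu⟩

theorem mul_eq_inv_mul_of_re_eq_zero {g b : Sp1} (hg : (g : ℍ[ℝ]).re = 0) (hb : (b : ℍ[ℝ]).re = 0)
    (hgb : ((g * b : Sp1) : ℍ[ℝ]).re = 0) : g * b = b⁻¹ * g := by
  rw [re_Sp1_mul, hg, hb] at hgb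
  apply Sp1_ext <;> simp [hg, hb] <;> linarith

theorem re_le_of_mem_conjSp1 {G : Subgroup Sp1} {c : ℝ}
    (hc : ∀ g ∈ G, g ≠ 1 → (g : ℍ[ℝ]).re ≤ c) (h : Sp1) :
    ∀ g ∈ conjSp1 h G, g ≠ 1 → (g : ℍ[ℝ]).re ≤ c := by
  rintro _ ⟨g, hg, rfl⟩ hne
  change ((h * g * h⁻¹ : Sp1) : ℍ[ℝ]).re ≤ c
  rw [re_conj_Sp1]
  exact hc g hg fun e => hne (by simp [e])

/-- Among the non-commuting pairs of elements of maximal real part `c` in a finite group, take one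
with `Re (b b'⁻¹)` maximal: comparison with the pair `(b' b b'⁻¹, b)` gives
`4c² - 1 ≤ 2 Re (b b'⁻¹) ≤ 2c`, a bound on `c`. -/
theorem re_bounds_of_pair {G : Subgroup Sp1} [Finite G] {c : ℝ} (hc0 : 0 < c) (hc1 : c < 1)
    (hc : ∀ g ∈ G, g ≠ 1 → (g : ℍ[ℝ]).re ≤ c)
    (h : ∃ b ∈ G, ∃ b' ∈ G, (b : ℍ[ℝ]).re = c ∧ (b' : ℍ[ℝ]).re = c ∧ b ≠ b' ∧ b ≠ b'⁻¹) :
    c < √3 / 2 ∧ ∃ b ∈ G, ∃ b' ∈ G, (b : ℍ[ℝ]).re = c ∧ (b' : ℍ[ℝ]).re = c ∧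
      ((b * b' : Sp1) : ℍ[ℝ]).re ≤ c ∧ ((b * b'⁻¹ : Sp1) : ℍ[ℝ]).re ≤ c ∧
      ((b * b' : Sp1) : ℍ[ℝ]).re + ((b * b'⁻¹ : Sp1) : ℍ[ℝ]).re = 2 * c ^ 2 := by
  let P : Set (Sp1 × Sp1) := {p | (p.1 ∈ G ∧ p.2 ∈ G) ∧
    (p.1 : ℍ[ℝ]).re = c ∧ (p.2 : ℍ[ℝ]).re = c ∧ p.1 ≠ p.2 ∧ p.1 ≠ p.2⁻¹}
  have hG : (G : Set Sp1).Finite := Set.toFinite _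
  have hP : P.Finite := (hG.prod hG).subset fun p hp => hp.1
  obtain ⟨b₀, hb₀, b₁, hb₁, hP₀⟩ := h
  obtain ⟨⟨b, b'⟩, ⟨⟨hb, hb'⟩, e, e', hne, hne'⟩, hmax⟩ := Set.exists_max_image P
    (fun p => ((p.1 * p.2⁻¹ : Sp1) : ℍ[ℝ]).re) hP ⟨(b₀, b₁), ⟨hb₀, hb₁⟩, hP₀⟩
  dsimp only at hb hb' e e' hne hne' hmax
  have hX : ((b * b' : Sp1) : ℍ[ℝ]).re ≤ c :=
    hc _ (mul_mem hb hb') fun h => hne' (mul_eq_one_iff_eq_inv.mp h)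
  have hY : ((b * b'⁻¹ : Sp1) : ℍ[ℝ]).re ≤ c :=
    hc _ (mul_mem hb (inv_mem hb')) fun h => hne (mul_inv_eq_one.mp h)
  have hXY := re_mul_add_re_mul_inv b b'
  rw [e, e'] at hXY
  refine ⟨?_, b, hb, b', hb', e, e', hX, hY, by rw [hXY]; ring⟩
  have hR := re_commutator (e.trans e'.symm)
  rw [e] at hR
  set ρ := ((b * b'⁻¹ : Sp1) : ℍ[ℝ]).re with hρ
  set R := ((b' * b * b'⁻¹ * b⁻¹ : Sp1) : ℍ[ℝ]).re with hRdef
  have hρ1 : ρ < 1 := by linarith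
  have hcc : c ^ 2 < 1 := by nlinarith
  -- `(b' b b'⁻¹, b)` is again a non-commuting pair
  have hRle : R ≤ ρ := by
    refine hmax (b' * b * b'⁻¹, b) ⟨⟨mul_mem (mul_mem hb' hb) (inv_mem hb'), hb⟩, ?_, e, ?_, ?_⟩
    · rw [re_conj_Sp1, e]
    · intro h
      have h1 : R = 1 := by
        rw [hRdef, show b' * b * b'⁻¹ * b⁻¹ = 1 from mul_inv_eq_one.mpr h]
        rfl
      have h2 : (ρ - 1) * (2 * ρ + 2 - 4 * c ^ 2) = 0 := by linarith
      have h3 := (mul_eq_zero.mp h2).resolve_left (by linarith)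
      linarith
    · intro h
      have h1 : R = 2 * c ^ 2 - 1 := by
        rw [hRdef, show b' * b * b'⁻¹ * b⁻¹ = b⁻¹ * b⁻¹ by rw [← h]]
        have := Sp1_sq_sum b
        rw [e] at this
        simp [e]
        linarith
      have h2 : (ρ - c ^ 2) ^ 2 + c ^ 2 * (1 - c ^ 2) = 0 := by linarith
      have h3 : 0 < c ^ 2 * (1 - c ^ 2) := mul_pos (by positivity) (by linarith)
      nlinarith [sq_nonneg (ρ - c ^ 2)]
  have h1 : 0 ≤ (1 - ρ) * (2 * ρ - (4 * c ^ 2 - 1)) := by linarith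
  have h2 := nonneg_of_mul_nonneg_right h1 (by linarith)
  by_contra hlt
  have h3 : √3 * √3 = 3 := Real.mul_self_sqrt (by norm_num)
  have h4 : 0 ≤ √3 := by positivity
  nlinarith

/-- Two elements of order 6 with imaginary product are conjugate to the standard generators of the
binary tetrahedral group. -/
theorem exists_conj_E6 {G : Subgroup Sp1} [Finite G]
    (hc : ∀ g ∈ G, g ≠ 1 → (g : ℍ[ℝ]).re ≤ 1 / 2) {x y : Sp1} (hx : x ∈ G) (hy : y ∈ G)
    (hxc : (x : ℍ[ℝ]).re = 1 / 2) (hyc : (y : ℍ[ℝ]).re = 1 / 2)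
    (hxy : ((x * y : Sp1) : ℍ[ℝ]).re = 0) :
    ∃ h : Sp1, IsADE (conjSp1 h G) ∧ quatJ ∈ conjSp1 h G := by
  obtain ⟨h, h2, h3⟩ := exists_conj_pair (a := x) (b := y) (a' := quatZeta) (b' := quatZeta')
    (by rw [hxc]; norm_num) (by rw [hxc]; simp [quatZeta])
    (by rw [hyc]; simp [quatZeta']) (by rw [hxy]; simp [quatZeta, quatZeta'])
  have m1 : quatZeta ∈ conjSp1 h G := h2 ▸ conj_mem_conjSp1 hx
  have m2 : quatZeta' ∈ conjSp1 h G := h3 ▸ conj_mem_conjSp1 hy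
  refine ⟨h, ?_, quatZeta_mul_quatZeta' ▸ mul_mem m1 m2⟩
  rw [eq_E6 (re_le_of_mem_conjSp1 hc h) m1 m2]
  exact IsADE.E6

/-- Two elements of maximal real part in the binary octahedral or icosahedral group whose product
has order 6: that product and the first of them are conjugate to the standard generators. -/
theorem exists_conj_E7_or_E8 {G : Subgroup Sp1} [Finite G] {c : ℝ}
    (hc : ∀ g ∈ G, g ≠ 1 → (g : ℍ[ℝ]).re ≤ c) {x y : Sp1} (hx : x ∈ G) (hy : y ∈ G)
    (hxc : (x : ℍ[ℝ]).re = c) (hyc : (y : ℍ[ℝ]).re = c)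
    (hxy : ((x * y : Sp1) : ℍ[ℝ]).re = 1 / 2) (hcc : c = √2 / 2 ∨ c = Real.goldenRatio / 2) :
    ∃ h : Sp1, IsADE (conjSp1 h G) ∧ quatJ ∈ conjSp1 h G := by
  have hxyx : ((x * y * x : Sp1) : ℍ[ℝ]).re = 0 := by
    rw [re_mul_comm_Sp1, re_mul_self_mul, hxy, hxc, hyc]
    ring
  -- `x y x` is imaginary, and so are the products of the standard generators
  have hlt : ((x * y : Sp1) : ℍ[ℝ]).re ^ 2 < 1 := by rw [hxy]; norm_num
  have h1 : ((x * y : Sp1) : ℍ[ℝ]).re = (quatZeta : ℍ[ℝ]).re := by rw [hxy]; simp [quatZeta]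
  rcases hcc with rfl | rfl
  · obtain ⟨h, h2, h3⟩ := exists_conj_pair (b := x) (b' := quatXi) hlt h1
      (by
          rw [hxc]
          simp only [quatXi, re_unitQuaternion]
          field_simp
          exact Real.sq_sqrt zero_le_two)
      (by rw [hxyx]; simp [quatXi, quatZeta])
    have := eq_E7 (re_le_of_mem_conjSp1 hc h) (h2 ▸ conj_mem_conjSp1 (mul_mem hx hy))
      (h3 ▸ conj_mem_conjSp1 hx)
    refine ⟨h, ?_, this.2⟩
    rw [this.1]
    exact IsADE.E7
  · obtain ⟨h, h2, h3⟩ := exists_conj_pair (b := x) (b' := quatEta) hlt h1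
      (by rw [hxc]; simp only [quatEta, re_unitQuaternion])
      (by
        rw [hxyx]
        simp only [quatEta, quatZeta, re_Sp1_mul, re_unitQuaternion, imI_unitQuaternion,
          imJ_unitQuaternion, imK_unitQuaternion, inv_goldenRatio_eq]
        ring)
    have := eq_E8 (re_le_of_mem_conjSp1 hc h) (h2 ▸ conj_mem_conjSp1 (mul_mem hx hy))
      (h3 ▸ conj_mem_conjSp1 hx)
    refine ⟨h, ?_, this.2⟩
    rw [this.1]
    exact IsADE.E8

/-- A finite group of unit quaternions that contains `-1` is, up to conjugation, contained in the
circle or one of the binary dihedral and polyhedral groups, which contain `j`. -/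
theorem exists_conj_of_neg_one_mem {G : Subgroup Sp1} [Finite G] (hneg : -1 ∈ G) :
    ∃ h : Sp1, conjSp1 h G ≤ circleSp1 ∨ (IsADE (conjSp1 h G) ∧ quatJ ∈ conjSp1 h G) := by
  have hnm {g : Sp1} (hg : g ∈ G) : -g ∈ G := by
    rw [← neg_one_mul]
    exact mul_mem hneg hg
  by_cases hpm : ∀ g ∈ G, g = 1 ∨ g = -1
  · refine ⟨1, Or.inl ?_⟩
    rintro _ ⟨g, hg, rfl⟩
    rcases hpm g hg with rfl | rfl <;> simp [mem_circleSp1, Sp1_coe_neg]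
  push Not at hpm
  obtain ⟨g₀, hg₀, hg₀1, hg₀2⟩ := hpm
  obtain ⟨b, ⟨hb, hb1⟩, hmax⟩ := Set.exists_max_image {g : Sp1 | g ∈ G ∧ g ≠ 1}
    (fun g => (g : ℍ[ℝ]).re) ((Set.toFinite (G : Set Sp1)).subset fun g hg => hg.1)
    ⟨g₀, hg₀, hg₀1⟩
  set c := (b : ℍ[ℝ]).re with hcb
  have hc (g) (hg : g ∈ G) (hg1 : g ≠ 1) : (g : ℍ[ℝ]).re ≤ c := hmax g ⟨hg, hg1⟩
  have hc1 : c < 1 := lt_of_le_of_ne (re_Sp1_le_one b) fun h => hb1 (eq_one_of_re_eq_one h)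
  have hc0 : 0 ≤ c := by
    have h1 := hc g₀ hg₀ hg₀1
    have h2 := hc (-g₀) (hnm hg₀) fun h => hg₀2 (by rw [← h, neg_neg])
    rw [Sp1_coe_neg, Quaternion.re_neg] at h2
    linarith
  have hb2 : (b : ℍ[ℝ]).re ^ 2 < 1 := by
    rw [← hcb]
    nlinarith
  by_cases hA : ∀ g ∈ G, g * b = b * g ∨ g * b = b⁻¹ * g
  · exact exists_conj_le_circleSp1_or_isADE hb hb2 hA
  have hcpos : 0 < c := by
    refine lt_of_le_of_ne hc0 fun hc00 => hA fun g hg => ?_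
    -- all elements other than `±1` are imaginary
    have hre (x) (hx : x ∈ G) : x = 1 ∨ x = -1 ∨ (x : ℍ[ℝ]).re = 0 := by
      by_contra! hcon
      have h1 := hc x hx hcon.1
      have h2 := hc (-x) (hnm hx) fun h => hcon.2.1 (by rw [← h, neg_neg])
      rw [Sp1_coe_neg, Quaternion.re_neg] at h2
      exact hcon.2.2 (by linarith)
    rcases hre g hg with rfl | rfl | h1
    · left; simp
    · left; simp
    rcases hre _ (mul_mem hg hb) with h2 | h2 | h2
    · left
      rw [mul_eq_one_iff_eq_inv.mp h2]
      simp
    · left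
      have : g = -b⁻¹ := by rw [eq_mul_inv_of_mul_eq h2]; simp
      rw [this]
      simp
    · right
      exact mul_eq_inv_mul_of_re_eq_zero h1 (hcb.symm.trans hc00.symm) h2
  push Not at hA
  obtain ⟨g, hg, hg1, hg2⟩ := hA
  obtain ⟨hc3, b, hb, b', hb', e, e', hX, hY, hXY⟩ := re_bounds_of_pair hcpos hc1 hc
    ⟨g * b * g⁻¹, mul_mem (mul_mem hg hb) (inv_mem hg), b, hb, re_conj_Sp1 g b, rfl,
      fun h => hg1 (mul_inv_eq_iff_eq_mul.mp h), fun h => hg2 (mul_inv_eq_iff_eq_mul.mp h)⟩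
  clear hcb hb2
  have trace {x : Sp1} (hx : x ∈ G) (h0 : 0 ≤ (x : ℍ[ℝ]).re) (h1 : (x : ℍ[ℝ]).re ≤ c) :=
    re_mem_of_re_le hneg hc hc3 hx h0 (h1.trans_lt hc1)
  have tX (h0 : 0 ≤ ((b * b' : Sp1) : ℍ[ℝ]).re) := trace (mul_mem hb hb') h0 hX
  have tY (h0 : 0 ≤ ((b * b'⁻¹ : Sp1) : ℍ[ℝ]).re) := trace (mul_mem hb (inv_mem hb')) h0 hY
  have s1 : (1.414 : ℝ) < √2 := Real.lt_sqrt (by norm_num) |>.mpr (by norm_num)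
  have s2 : √2 < 1.415 := (Real.sqrt_lt' (by norm_num)).mpr (by norm_num)
  have s3 : √2 ^ 2 = 2 := Real.sq_sqrt (by norm_num)
  have s4 : (2.236 : ℝ) < √5 := Real.lt_sqrt (by norm_num) |>.mpr (by norm_num)
  have s5 : √5 < 2.237 := (Real.sqrt_lt' (by norm_num)).mpr (by norm_num)
  have hφ : Real.goldenRatio = (1 + √5) / 2 := rfl
  have hφ2 := Real.goldenRatio_sq
  have f1 : 1.618 ≤ Real.goldenRatio := by rw [hφ]; linarith
  have f2 : Real.goldenRatio < 1.619 := by rw [hφ]; linarith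
  clear hφ s4 s5
  have e'' : ((b'⁻¹ : Sp1) : ℍ[ℝ]).re = c := by rw [re_Sp1_inv, e']
  suffices ∃ h : Sp1, IsADE (conjSp1 h G) ∧ quatJ ∈ conjSp1 h G from
    this.imp fun h => Or.inr
  generalize hXd : ((b * b' : Sp1) : ℍ[ℝ]).re = X at *
  generalize hYd : ((b * b'⁻¹ : Sp1) : ℍ[ℝ]).re = Y at *
  have tc := trace hb (by rw [e]; exact hc0) (by rw [e])
  rw [e] at tc
  -- the real parts of `b b'` and `b b'⁻¹` come from the same short list and have sum `2c²`
  rcases tc with h | h | h | ⟨-, h | h⟩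
  · linarith
  · rw [h] at hXY hX hY tX tY
    rcases tX (by linarith) with h1 | h1 | h1 | ⟨h1, -⟩
    · exact exists_conj_E6 (h ▸ hc) hb hb' (e.trans h) (e'.trans h) (hXd.trans h1)
    · exact exists_conj_E6 (h ▸ hc) hb (inv_mem hb') (e.trans h) (e''.trans h) (by linarith)
    · linarith
    · linarith
  · have hcc : c ^ 2 = 1 / 2 := by rw [h, div_pow, s3]; norm_num
    rw [hcc] at hXY
    rw [h] at hX hY tX tY
    rcases tX (by linarith) with h1 | h1 | h1 | ⟨h1, -⟩
    · linarith
    · exact exists_conj_E7_or_E8 hc hb hb' e e' (hXd.trans h1) (Or.inl h)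
    · rcases tY (by linarith) with h2 | h2 | h2 | ⟨h2, -⟩ <;> linarith
    · linarith
  · have hcc : c ^ 2 = (Real.goldenRatio + 1) / 4 := by rw [h, div_pow, hφ2]; norm_num
    rw [hcc] at hXY
    rw [h] at hX hY tX tY
    rcases tX (by linarith) with h1 | h1 | h1 | ⟨-, h1 | h1⟩
    · linarith
    · exact exists_conj_E7_or_E8 hc hb hb' e e' (hXd.trans h1) (Or.inr h)
    · rcases tY (by linarith) with h2 | h2 | h2 | ⟨-, h2 | h2⟩ <;> linarith
    · exact exists_conj_E7_or_E8 hc hb (inv_mem hb') e e'' (by linarith) (Or.inr h)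
    · linarith
  · have h5 := (re_mem_of_re_le hneg hc hc3 hb (by rw [e]; exact hc0) (by rw [e]; exact hc1))
    rw [e] at h5
    rcases h5 with h5 | h5 | h5 | ⟨h5, -⟩ <;> linarith

/-- A finite group of unit quaternions is conjugate to one of the ADE groups. -/
theorem exists_conj_isADE (G : Subgroup Sp1) [Finite G] : ∃ h : Sp1, IsADE (conjSp1 h G) := by
  have circle {h : Sp1} (hle : conjSp1 h G ≤ circleSp1) : IsADE (conjSp1 h G) := by
    have := IsADE.A (Nat.card (conjSp1 h G)) Nat.card_pos
    rwa [← eq_closure_expI hle] at this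
  by_cases hneg : -1 ∈ G
  · obtain ⟨h, hh | hh⟩ := exists_conj_of_neg_one_mem hneg
    · exact ⟨h, circle hh⟩
    · exact ⟨h, hh.1⟩
  -- otherwise `G ∪ -G` is a group without imaginary elements, hence conjugate into the circle
  let G' : Subgroup Sp1 :=
    { carrier := {g | g ∈ G ∨ -g ∈ G}
      mul_mem' := by
        rintro a b (ha | ha) (hb | hb)
        · exact Or.inl (mul_mem ha hb)
        · exact Or.inr (by simpa using mul_mem ha hb)
        · exact Or.inr (by simpa using mul_mem ha hb)
        · exact Or.inl (by simpa using mul_mem ha hb)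
      one_mem' := Or.inl (one_mem G)
      inv_mem' := by
        rintro a (ha | ha)
        · exact Or.inl (inv_mem ha)
        · exact Or.inr (by simpa using inv_mem ha) }
  have hfin : Finite G' := by
    have hG : (G : Set Sp1).Finite := Set.toFinite _
    refine Set.Finite.to_subtype (s := (G' : Set Sp1)) ((hG.union (hG.image Neg.neg)).subset ?_)
    rintro g (hg | hg)
    · exact Or.inl hg
    · exact Or.inr ⟨-g, hg, neg_neg g⟩
  have hGG' : G ≤ G' := fun g hg => Or.inl hg
  obtain ⟨h, hh | ⟨-, hh⟩⟩ := exists_conj_of_neg_one_mem (G := G') (Or.inr (by simp))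
  · exact ⟨h, circle ((Subgroup.map_mono hGG').trans hh)⟩
  · exfalso
    have hsq : (h⁻¹ * quatJ * h) * (h⁻¹ * quatJ * h) = -1 := by
      rw [show (h⁻¹ * quatJ * h) * (h⁻¹ * quatJ * h) = h⁻¹ * (quatJ * quatJ) * h by group,
        quatJ_mul_self]
      simp
    rcases mem_conjSp1.mp hh with h1 | h1
    · exact hneg (hsq ▸ mul_mem h1 h1)
    · refine hneg ?_
      rw [← hsq, ← neg_mul_neg]
      exact mul_mem h1 h1

/-! ### Groups with five invariant spinors -/

theorem mem_conj {g x : Spin8} {Γ : Subgroup Spin8} : x ∈ conj g Γ ↔ g⁻¹ * x * g ∈ Γ := by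
  constructor
  · rintro ⟨γ, hγ, rfl⟩
    simpa [mul_assoc] using hγ
  · exact fun hx => ⟨_, hx, by simp [mul_assoc]⟩

theorem conj_mem_conj {g γ : Spin8} {Γ : Subgroup Spin8} (hγ : γ ∈ Γ) : g * γ * g⁻¹ ∈ conj g Γ :=
  ⟨γ, hγ, rfl⟩

theorem conj_conj (g h : Spin8) (Γ : Subgroup Spin8) : conj g (conj h Γ) = conj (g * h) Γ := by
  ext x
  simp only [mem_conj, mul_inv_rev, mul_assoc]

/-- A group with five linearly independent invariant positive spinors is conjugate to a subgroup of
the diagonal `Sp(1)`: move the invariant spinors to the standard ones. -/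
theorem exists_conj_le_diagonal (Γ : Subgroup Spin8)
    (h : 5 ≤ Module.finrank ℝ (invariantSpinors Γ)) :
    ∃ g : Spin8, conj g Γ ≤ diagonal.map spinLift := by
  obtain ⟨g, hg⟩ := exists_spin_standard_mem (invariantSpinors Γ) inf_le_left h
  refine ⟨g⁻¹, fun x hx => mem_diagonal_of_fixes_standard x fun q r => ?_⟩
  rw [mem_conj, inv_inv] at hx
  have h1 := (Submodule.mem_inf.mp (hg q r)).2
  simp only [Submodule.mem_iInf] at h1
  have h2 := h1 _ hx
  rw [Module.End.mem_eigenspace_iff, one_smul] at h2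
  have h3 : cliffordRep (x : Cl8) ((q, (r : ℍ[ℝ])), 0)
      = cliffordRep ((g⁻¹ * (g * x * g⁻¹ * g) : Spin8) : Cl8) ((q, (r : ℍ[ℝ])), 0) := by
    congr 3
    group
  rw [h3, Submonoid.coe_mul, Submonoid.coe_mul, map_mul, map_mul, Module.End.mul_apply,
    Module.End.mul_apply, h2, ← Module.End.mul_apply, ← map_mul, ← Submonoid.coe_mul,
    inv_mul_cancel, Submonoid.coe_one, map_one, Module.End.one_apply]

/-- An element of the diagonal `Sp(1)` other than `1` fixes no nonzero vector. -/
theorem eq_one_of_mem_diagonal_of_rotate_eq {γ : Spin8} (hγ : γ ∈ diagonal.map spinLift) {v : V8}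
    (hv : v ≠ 0) (h : rotate γ v = v) : γ = 1 := by
  obtain ⟨_, ⟨a, rfl⟩, rfl⟩ := hγ
  rw [rotate_spinLift] at h
  have key {x : ℍ[ℝ]} (hx : x ≠ 0) (hax : (a : ℍ[ℝ]) * x = x) : a = 1 :=
    Subtype.ext (mul_right_cancel₀ hx (by rw [hax, OneMemClass.coe_one, one_mul]))
  have h1 : (a : ℍ[ℝ]) * v.fst = v.fst := congrArg (fun w : V8 => w.fst) h
  have h2 : (a : ℍ[ℝ]) * v.snd = v.snd := congrArg (fun w : V8 => w.snd) h
  have ha : a = 1 := by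
    by_cases h0 : v.fst = 0
    · refine key (fun h3 => hv ?_) h2
      exact WithLp.ofLp_injective 2 (Prod.ext h0 h3)
    · exact key h0 h1
  rw [ha, map_one, map_one]

theorem eq_one_of_rotate_eq {Γ : Subgroup Spin8} {g : Spin8}
    (hg : conj g Γ ≤ diagonal.map spinLift) {γ : Spin8} (hγ : γ ∈ Γ) {v : V8} (hv : v ≠ 0)
    (h : rotate γ v = v) : γ = 1 := by
  have h1 := eq_one_of_mem_diagonal_of_rotate_eq (hg (conj_mem_conj hγ)) (v := rotate g v)
    (fun h0 => hv (by rw [← norm_eq_zero, ← norm_rotate g, h0, norm_zero])) (by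
      rw [rotate_mul, rotate_mul, ← rotate_mul g⁻¹ g, inv_mul_cancel, rotate_one, h])
  rwa [conj_eq_one_iff] at h1

theorem actsFreely_of_conj_le_diagonal {Γ : Subgroup Spin8} {g : Spin8}
    (hg : conj g Γ ≤ diagonal.map spinLift) : ActsFreely Γ := by
  intro x
  rw [Subgroup.eq_bot_iff_forall]
  intro γ hγ
  have h1 : rotate (γ : Spin8) (x : V8) = x :=
    congrArg Subtype.val (MulAction.mem_stabilizer_iff.mp hγ)
  have hx : (x : V8) ≠ 0 := ne_zero_of_mem_unit_sphere x
  exact Subtype.ext (eq_one_of_rotate_eq hg γ.2 hx h1)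

/-- The kernels of the two projections of a conjugate of `Γ` in `Sp(1) × Sp(1)` are trivial, because
`(a, 1)` and `(1, b)` fix nonzero vectors of `ℍ ⊕ ℍ`. -/
theorem goursat_eq_bot {Γ : Subgroup Spin8} {g₀ : Spin8}
    (hg₀ : conj g₀ Γ ≤ diagonal.map spinLift) {g : Spin8} {C : Subgroup (Sp1 × Sp1)}
    (hC : conj g Γ = C.map spinLift) : C.goursatFst = ⊥ ∧ C.goursatSnd = ⊥ := by
  have hconj : conj (g₀ * g⁻¹) (conj g Γ) ≤ diagonal.map spinLift := by
    rwa [conj_conj, inv_mul_cancel_right]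
  have key {u : Sp1 × Sp1} (hu : u ∈ C) {v : V8} (hv : v ≠ 0) (h : leftMul u v = v) : u = 1 := by
    have hmem : spinLift u ∈ conj g Γ := hC ▸ ⟨u, hu, rfl⟩
    have := eq_one_of_rotate_eq hconj hmem hv ((rotate_spinLift u v).trans h)
    exact isSpinLift_spinLift.1 (this.trans (map_one _).symm)
  have h01 : pt 0 1 ≠ 0 := fun h => one_ne_zero (congrArg (fun v : V8 => v.snd) h)
  have h10 : pt 1 0 ≠ 0 := fun h => one_ne_zero (congrArg (fun v : V8 => v.fst) h)
  constructor
  · rw [Subgroup.eq_bot_iff_forall]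
    intro a ha
    rw [Subgroup.mem_goursatFst] at ha
    exact congrArg Prod.fst (key ha h01 (by simp [leftMul, pt]))
  · rw [Subgroup.eq_bot_iff_forall]
    intro b hb
    rw [Subgroup.mem_goursatSnd] at hb
    exact congrArg Prod.snd (key hb h10 (by simp [leftMul, pt]))

/-- A finite group conjugate to a subgroup of the diagonal `Sp(1)` is conjugate to the diagonal
copy of an ADE group. -/
theorem exists_conj_eq_graph {Γ : Subgroup Spin8} [Finite Γ] {g : Spin8}
    (hg : conj g Γ ≤ diagonal.map spinLift) :
    ∃ (g : Spin8) (A : Subgroup Sp1), IsADE A ∧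
      conj g Γ = (graph A (MulEquiv.refl A)).map spinLift := by
  let δ : Sp1 →* Spin8 := spinLift.comp ((MonoidHom.id Sp1).prod (MonoidHom.id Sp1))
  have hδ : Function.Injective δ := fun a b h =>
    congrArg Prod.fst (isSpinLift_spinLift.1 h)
  let B : Subgroup Sp1 := (conj g Γ).comap δ
  have hfin : Finite B := by
    have : Finite (conj g Γ) := Finite.Set.finite_image (Γ : Set Spin8) _
    exact Finite.of_injective (fun b : B => (⟨δ b, b.2⟩ : conj g Γ))
      fun a b h => Subtype.ext (hδ (congrArg Subtype.val h))
  obtain ⟨h, hh⟩ := exists_conj_isADE B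
  refine ⟨δ h * g, conjSp1 h B, hh, ?_⟩
  rw [← conj_conj]
  ext x
  constructor
  · intro hx
    rw [mem_conj] at hx
    obtain ⟨_, ⟨a, rfl⟩, ha⟩ := hg hx
    change δ a = _ at ha
    have haB : a ∈ B := by
      change δ a ∈ conj g Γ
      rwa [ha]
    refine ⟨(h * a * h⁻¹, h * a * h⁻¹), ⟨⟨_, conj_mem_conjSp1 haB⟩, rfl⟩, ?_⟩
    change δ (h * a * h⁻¹) = x
    rw [map_mul, map_mul, map_inv, ha]
    group
  · rintro ⟨_, ⟨⟨b, hb⟩, rfl⟩, rfl⟩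
    change δ b ∈ _
    rw [mem_conj, ← map_inv, ← map_mul, ← map_mul]
    exact mem_conjSp1.mp hb

end SphericalOrbifold

end

open SphericalOrbifold in
theorem mainTheorem2 :
    ∃ j : Sp1 × Sp1 →* Spin8, IsSpinLift j ∧
      ∀ Γ : Subgroup Spin8, Finite Γ → (∀ γ ∈ Γ, (γ : Cl8) ≠ -1) →
        5 ≤ Module.finrank ℝ (invariantSpinors Γ) →
        (∃ g : Spin8, conj g Γ ≤ diagonal.map j) ∧
        (∀ (g : Spin8) (C : Subgroup (Sp1 × Sp1)), conj g Γ = C.map j →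
          C.goursatFst = ⊥ ∧ C.goursatSnd = ⊥) ∧
        ActsFreely Γ ∧
        IsSmoothQuotient Γ ∧
        (∃ (g : Spin8) (A : Subgroup Sp1), IsADE A ∧
          conj g Γ = (graph A (MulEquiv.refl A)).map j) := by
  refine ⟨spinLift, isSpinLift_spinLift, fun Γ hΓ _ h5 => ?_⟩
  obtain ⟨g, hg⟩ := exists_conj_le_diagonal Γ h5
  have hfree := actsFreely_of_conj_le_diagonal hg
  exact ⟨⟨g, hg⟩, fun _ _ hC => goursat_eq_bot hg hC, hfree,
    isSmoothQuotient_of_actsFreely Γ hfree, exists_conj_eq_graph hg⟩
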